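/- Let $n\ge 2$. Let $f_n(x)=x_1^2+\cdots+x_n^2-x_{n+1}^2$ on $\mathbb R^{n+1}$, let $H^n=\{x: f_n(x)=-1,\ x_{n+1}>0\}$, and let $\mathrm{SO}^+(n,1)$ be the group of real matrices of determinant $1$ that preserve $f_n$ and leave $H^n$ invariant. Let $\eta:\mathrm{Spin}^+(n,1)\to \mathrm{SO}^+(n,1)$ and $\sigma:\mathrm{Spin}(n)\to\mathrm{SO}(n)$ be the double covering epimorphisms $x\mapsto (v\mapsto xvx^{-1})$ of the spin groups, where $\mathrm{Spin}^+(n,1)$ is the identity component of $\mathrm{Spin}(n,1)$. Embed $\mathrm{SO}(n)$ in $\mathrm{SO}^+(n,1)$ by $B\mapsto\hat B=\mathrm{diag}(B,1)$, and $\mathrm{Spin}(n)$ in $\mathrm{Spin}^+(n,1)$ by the map $s\mapsto\hat s$ induced by $\mathbb R^n\subset\mathbb R^{n+1}$, so that $\eta(\hat s)=\widehat{\sigma(s)}$. Let $\Gamma$ be a torsion-free discrete subgroup of $\mathrm{SO}^+(n,1)$. The oriented orthonormal frame bundle of the hyperbolic space-form $\Gamma\backslash H^n$ is identified with $\Gamma\backslash\mathrm{SO}^+(n,1)$,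 with projection $\varepsilon(\Gamma A)=\Gamma(Ae_{n+1})$ and right $\mathrm{SO}(n)$-action $(\Gamma A)B=\Gamma (A\hat B)$. A spin structure on $\Gamma\backslash H^n$ is a double covering projection $\rho:P\to\Gamma\backslash\mathrm{SO}^+(n,1)$ such that $P$ is a principal $\mathrm{Spin}(n)$-bundle over $\Gamma\backslash H^n$ with bundle projection $\varepsilon\rho$, and $\rho(xs)=\rho(x)\sigma(s)$ for all $x\in P$ and $s\in\mathrm{Spin}(n)$. Two spin structures $\rho:P\to\Gamma\backslash\mathrm{SO}^+(n,1)$ and $\rho':P'\to\Gamma\backslash\mathrm{SO}^+(n,1)$ are equivalent if there is a diffeomorphism $\xi:P\to P'$ with $\rho'\xi=\rho$ and $\xi(xs)=\xi(x)s$ for all $x\in P$ and $s\in\mathrm{Spin}(n)$. Then the set of equivalence classes of spin structures on $\Gamma\backslash H^n$ is in one-to-one correspondence with the set of subgroups $\hat\Gamma$ of $\mathrm{Spin}^+(n,1)$ such that $\eta$ maps $\hat\Gamma$ isomorphically onto $\Gamma$. Under this correspondence, such a subgroup $\hat\Gamma$ corresponds to the equivalence class of the spin structure $$\rho:\hat\Gamma\backslash\mathrm{Spin}^+(n,1)\to\Gamma\backslash\mathrm{SO}^+(n,1),\qquad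 \rho(\hat\Gamma g)=\Gamma\,\eta(g),$$ induced by $\eta$, with right action $(\hat\Gamma g)s=\hat\Gamma(g\hat s)$. -/

import Mathlib

namespace HypSpin

noncomputable section

open CliffordAlgebra
open scoped Matrix MatrixGroups ContDiff Manifold

section Adjoint

variable {M : Type*} [AddCommGroup M] [Module ℝ M]

/-- The linear left inverse of the embedding `M → CliffordAlgebra Q`. -/
def vecPart (Q : QuadraticForm ℝ M) : CliffordAlgebra Q →ₗ[ℝ] M :=
  ExteriorAlgebra.ιInv ∘ₗ (equivExterior Q).toLinearMap

lemma vecPart_ι (Q : QuadraticForm ℝ M) (v : M) : vecPart Q (ι Q v) = v := by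
  have h : equivExterior Q (ι Q v) = ExteriorAlgebra.ι ℝ v :=
    changeForm_ι changeForm.associated_neg_proof v
  rw [vecPart, LinearMap.comp_apply, LinearEquiv.coe_coe, h]
  exact ExteriorAlgebra.ι_leftInverse v

lemma ι_inj (Q : QuadraticForm ℝ M) {v w : M} (h : ι Q v = ι Q w) : v = w := by
  rw [← vecPart_ι Q v, h, vecPart_ι]

/-- The conjugation action `Ad(x)(v) = x v x⁻¹` of an element of the spin group on vectors. -/
def adEnd (Q : QuadraticForm ℝ M) (x : spinGroup Q) : Module.End ℝ M :=
  vecPart Q ∘ₗ LinearMap.mulLeft ℝ (x : CliffordAlgebra Q) ∘ₗ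
    LinearMap.mulRight ℝ ((x⁻¹ : spinGroup Q) : CliffordAlgebra Q) ∘ₗ ι Q

lemma coe_mul_inv (Q : QuadraticForm ℝ M) (x : spinGroup Q) :
    (x : CliffordAlgebra Q) * ((x⁻¹ : spinGroup Q) : CliffordAlgebra Q) = 1 := by
  rw [← Submonoid.coe_mul, mul_inv_cancel, Submonoid.coe_one]

lemma coe_inv_mul (Q : QuadraticForm ℝ M) (x : spinGroup Q) :
    ((x⁻¹ : spinGroup Q) : CliffordAlgebra Q) * (x : CliffordAlgebra Q) = 1 := by
  rw [← Submonoid.coe_mul, inv_mul_cancel, Submonoid.coe_one]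

lemma ι_adEnd (Q : QuadraticForm ℝ M) (x : spinGroup Q) (v : M) :
    ι Q (adEnd Q x v) =
      (x : CliffordAlgebra Q) * ι Q v * ((x⁻¹ : spinGroup Q) : CliffordAlgebra Q) := by
  have h := spinGroup.conjAct_smul_ι_mem_range_ι (Q := Q) (x := spinGroup.toUnits x)
    (by simp [spinGroup.toUnits]) v
  obtain ⟨u, hu⟩ := h
  rw [ConjAct.units_smul_def] at hu
  have hu' : ι Q u =
      (x : CliffordAlgebra Q) * ι Q v * ((x⁻¹ : spinGroup Q) : CliffordAlgebra Q) := hu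
  have : adEnd Q x v = vecPart Q
      ((x : CliffordAlgebra Q) * ι Q v * ((x⁻¹ : spinGroup Q) : CliffordAlgebra Q)) := by
    simp [adEnd, mul_assoc]
  rw [this, ← hu', vecPart_ι]

/-- `Ad` as a homomorphism from the spin group to the monoid of linear endomorphisms. -/
def adHom (Q : QuadraticForm ℝ M) : spinGroup Q →* Module.End ℝ M where
  toFun := adEnd Q
  map_one' := by
    ext v
    apply ι_inj Q
    rw [ι_adEnd]
    simp
  map_mul' x y := by
    ext v
    apply ι_inj Q
    rw [Module.End.mul_apply, ι_adEnd, ι_adEnd, ι_adEnd, _root_.mul_inv_rev]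
    simp only [Submonoid.coe_mul, mul_assoc]

end Adjoint

section Coordinates

variable {κ : Type} [Fintype κ] [DecidableEq κ]

/-- `Ad` as a homomorphism from the spin group to invertible matrices. -/
def adGL (Q : QuadraticForm ℝ (κ → ℝ)) : spinGroup Q →* GL κ ℝ :=
  (Matrix.GeneralLinearGroup.toLin (n := κ) (R := ℝ)).symm.toMonoidHom.comp (adHom Q).toHomUnits

lemma adGL_mulVec (Q : QuadraticForm ℝ (κ → ℝ)) (x : spinGroup Q) (v : κ → ℝ) :
    (adGL Q x : Matrix κ κ ℝ) *ᵥ v = adEnd Q x v := by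
  have h : Matrix.GeneralLinearGroup.toLin (adGL Q x) = (adHom Q).toHomUnits x := by
    simp [adGL]
  have h2 := congrArg (fun u : LinearMap.GeneralLinearGroup ℝ (κ → ℝ) => (u : Module.End ℝ (κ → ℝ)) v) h
  simpa [Matrix.GeneralLinearGroup.toLin, adHom] using h2

/-- The form `-(w₁ x₁² + ⋯ + w_k x_k²)`. -/
def negForm (w : κ → ℝ) : QuadraticForm ℝ (κ → ℝ) := -QuadraticMap.weightedSumSquares ℝ w

lemma negForm_apply (w : κ → ℝ) (v : κ → ℝ) : negForm w v = -∑ i, w i * (v i * v i) := by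
  simp [negForm]

lemma adEnd_form (Q : QuadraticForm ℝ (κ → ℝ)) (x : spinGroup Q) (v : κ → ℝ) :
    Q (adEnd Q x v) = Q v := by
  have h := ι_sq_scalar Q (adEnd Q x v)
  rw [ι_adEnd] at h
  have h2 : (x : CliffordAlgebra Q) * ι Q v * ((x⁻¹ : spinGroup Q) : CliffordAlgebra Q) *
      ((x : CliffordAlgebra Q) * ι Q v * ((x⁻¹ : spinGroup Q) : CliffordAlgebra Q)) =
      algebraMap ℝ _ (Q v) := by
    calc _ = (x : CliffordAlgebra Q) * ι Q v * (((x⁻¹ : spinGroup Q) : CliffordAlgebra Q) *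
      (x : CliffordAlgebra Q)) * ι Q v * ((x⁻¹ : spinGroup Q) : CliffordAlgebra Q) := by
          simp only [mul_assoc]
      _ = (x : CliffordAlgebra Q) * (ι Q v * ι Q v) *
            ((x⁻¹ : spinGroup Q) : CliffordAlgebra Q) := by
          rw [coe_inv_mul]; simp only [mul_assoc, one_mul]
      _ = _ := by
          rw [ι_sq_scalar, ← Algebra.commutes, mul_assoc, coe_mul_inv, mul_one]
  rw [h2] at h
  exact ((algebraMap ℝ (CliffordAlgebra Q)).injective h).symm

/-- The matrix of the reflection in the hyperplane orthogonal to `v`. -/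
def reflMat (w : κ → ℝ) (v : κ → ℝ) : Matrix κ κ ℝ :=
  1 - (2 / ∑ i, w i * (v i * v i)) • Matrix.vecMulVec v (fun i => w i * v i)

lemma reflMat_mulVec (w v u : κ → ℝ) :
    reflMat w v *ᵥ u =
      u - (2 * (∑ i, w i * (v i * u i)) / ∑ i, w i * (v i * v i)) • v := by
  have h : (fun i => w i * v i) ⬝ᵥ u = ∑ i, w i * (v i * u i) := by
    simp [dotProduct, mul_assoc]
  ext j
  simp only [reflMat, Matrix.sub_mulVec, Matrix.one_mulVec, Matrix.smul_mulVec,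
    Matrix.vecMulVec_mulVec, Pi.sub_apply, Pi.smul_apply, h, smul_eq_mul, MulOpposite.smul_eq_mul_unop,
    MulOpposite.unop_op]
  ring

lemma reflMat_det (w v : κ → ℝ) (hv : ∑ i, w i * (v i * v i) ≠ 0) : (reflMat w v).det = -1 := by
  have h : reflMat w v = 1 + Matrix.replicateCol Unit (-(2 / ∑ i, w i * (v i * v i)) • v) *
      Matrix.replicateRow Unit (fun i => w i * v i) := by
    ext i j
    simp [reflMat, Matrix.vecMulVec, Matrix.mul_apply]
    ring
  rw [h, Matrix.det_one_add_replicateCol_mul_replicateRow, dotProduct_smul]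
  have h2 : (fun i => w i * v i) ⬝ᵥ v = ∑ i, w i * (v i * v i) := by simp [dotProduct, mul_assoc]
  rw [h2, smul_eq_mul, neg_mul, div_mul_cancel₀ _ hv]
  norm_num

lemma ι_unit_inv (Q : QuadraticForm ℝ (κ → ℝ)) (x : (CliffordAlgebra Q)ˣ) (a : κ → ℝ)
    (ha : ι Q a = x) : Q a ≠ 0 ∧ ((x⁻¹ : (CliffordAlgebra Q)ˣ) : CliffordAlgebra Q) =
      ι Q ((Q a)⁻¹ • a) := by
  have h1 : (x : CliffordAlgebra Q) * x = algebraMap ℝ _ (Q a) := by rw [← ha, ι_sq_scalar]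
  have h0 : Q a ≠ 0 := by
    intro h
    rw [h, map_zero] at h1
    have h3 : (x * x : (CliffordAlgebra Q)ˣ).val = 0 := h1
    exact (x * x).ne_zero h3
  refine ⟨h0, ?_⟩
  rw [Units.inv_eq_of_mul_eq_one_right]
  rw [← ha, map_smul, mul_smul_comm, ι_sq_scalar, Algebra.algebraMap_eq_smul_one, smul_smul,
    inv_mul_cancel₀ h0, one_smul]

lemma polar_negForm (w a u : κ → ℝ) :
    QuadraticMap.polar (negForm w) a u = -(2 * ∑ i, w i * (a i * u i)) := by
  simp only [QuadraticMap.polar, negForm_apply, Pi.add_apply, Finset.mul_sum]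
  rw [← sub_eq_zero]
  simp only [← Finset.sum_neg_distrib, ← Finset.sum_sub_distrib]
  apply Finset.sum_eq_zero
  intro i _
  ring

/-- The twisted conjugation by a non-isotropic vector is a reflection. -/
lemma twisted_vector (w : κ → ℝ) (x : (CliffordAlgebra (negForm w))ˣ) (a : κ → ℝ)
    (ha : ι (negForm w) a = x) (u : κ → ℝ) :
    involute (x : CliffordAlgebra (negForm w)) * ι _ u *
      ((x⁻¹ : (CliffordAlgebra (negForm w))ˣ) : CliffordAlgebra (negForm w)) =
        ι _ (reflMat w a *ᵥ u) := by
  obtain ⟨h0, hinv⟩ := ι_unit_inv _ x a ha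
  rw [hinv, ← ha, involute_ι, reflMat_mulVec, map_smul, map_sub, map_smul]
  have hs := ι_mul_ι_add_swap (Q := negForm w) a u
  have hs' : ι (negForm w) a * ι _ u = algebraMap ℝ _ (QuadraticMap.polar (negForm w) a u) -
      ι _ u * ι _ a := by rw [← hs]; abel
  rw [neg_mul, hs', mul_smul_comm, neg_mul, sub_mul, mul_assoc, ι_sq_scalar, polar_negForm]
  rw [negForm_apply] at h0 ⊢
  rw [← Algebra.commutes (-∑ i, w i * (a i * a i)), ← Algebra.smul_def, ← Algebra.smul_def,
    neg_sub, smul_sub, smul_smul, smul_smul, inv_mul_cancel₀ h0, one_smul]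
  congr 2
  have h0' : ∑ i, w i * (a i * a i) ≠ 0 := by simpa using h0
  field_simp

/-- Induction over the Lipschitz group on products of vectors. -/
lemma lipschitz_induction (Q : QuadraticForm ℝ (κ → ℝ)) {p : (CliffordAlgebra Q)ˣ → Prop}
    (vec : ∀ (x : (CliffordAlgebra Q)ˣ) (a : κ → ℝ), ι Q a = x → p x) (one : p 1)
    (mul : ∀ x y, p x → p y → p (x * y)) {x : (CliffordAlgebra Q)ˣ}
    (hx : x ∈ lipschitzGroup Q) : p x := by
  unfold lipschitzGroup at hx
  induction hx using Subgroup.closure_induction'' with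
  | mem x hx => obtain ⟨a, ha⟩ := hx; exact vec x a ha
  | inv_mem x hx =>
    obtain ⟨a, ha⟩ := hx
    exact vec _ _ (ι_unit_inv Q x a ha).2.symm
  | one => exact one
  | mul y z _ _ hy hz => exact mul y z hy hz

lemma lipschitz_det (w : κ → ℝ) {x : (CliffordAlgebra (negForm w))ˣ}
    (hx : x ∈ lipschitzGroup (negForm w)) :
    ∃ (g : Matrix κ κ ℝ), involute (x : CliffordAlgebra (negForm w)) =
        g.det • (x : CliffordAlgebra (negForm w)) ∧
      ∀ u, involute (x : CliffordAlgebra (negForm w)) * ι _ u *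
        ((x⁻¹ : (CliffordAlgebra (negForm w))ˣ) : CliffordAlgebra (negForm w)) =
          ι _ (g *ᵥ u) := by
  refine lipschitz_induction _ (p := fun x => ∃ (g : Matrix κ κ ℝ),
      involute (x : CliffordAlgebra (negForm w)) = g.det • (x : CliffordAlgebra (negForm w)) ∧
      ∀ u, involute (x : CliffordAlgebra (negForm w)) * ι _ u *
        ((x⁻¹ : (CliffordAlgebra (negForm w))ˣ) : CliffordAlgebra (negForm w)) =
          ι _ (g *ᵥ u)) ?_ ?_ ?_ hx
  · intro x a ha
    have h0 := (ι_unit_inv _ x a ha).1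
    rw [negForm_apply] at h0
    refine ⟨reflMat w a, ?_, twisted_vector w x a ha⟩
    rw [reflMat_det w a (by simpa using h0), ← ha, involute_ι, neg_smul, one_smul]
  · exact ⟨1, by simp, by simp⟩
  · rintro x y ⟨g, hg, hgu⟩ ⟨h, hh, hhu⟩
    refine ⟨g * h, ?_, fun u => ?_⟩
    · rw [Units.val_mul, map_mul, hg, hh, Matrix.det_mul, smul_mul_smul_comm]
    · rw [← Matrix.mulVec_mulVec, ← hgu, ← hhu, _root_.mul_inv_rev, Units.val_mul, Units.val_mul, map_mul]
      simp only [mul_assoc]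

lemma det_adGL (w : κ → ℝ) (x : spinGroup (negForm w)) :
    (adGL (negForm w) x : Matrix κ κ ℝ).det = 1 := by
  obtain ⟨g, hg, hgu⟩ := lipschitz_det w
    (spinGroup.units_mem_lipschitzGroup (x := spinGroup.toUnits x) x.2)
  have hinv : involute (x : CliffordAlgebra (negForm w)) = x := spinGroup.involute_eq x.2
  have hg' : (x : CliffordAlgebra (negForm w)) = g.det • (x : CliffordAlgebra (negForm w)) :=
    hinv.symm.trans hg
  have hd : g.det = 1 := by
    have h1 := congrArg (· * ((x⁻¹ : spinGroup (negForm w)) : CliffordAlgebra (negForm w))) hg'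
    simp only [smul_mul_assoc, coe_mul_inv] at h1
    have h2 : algebraMap ℝ (CliffordAlgebra (negForm w)) 1 = algebraMap ℝ _ g.det := by
      rw [Algebra.algebraMap_eq_smul_one, Algebra.algebraMap_eq_smul_one, one_smul]; exact h1
    exact ((algebraMap ℝ (CliffordAlgebra (negForm w))).injective h2).symm
  have hEq : (adGL (negForm w) x : Matrix κ κ ℝ) = g := by
    apply Matrix.ext_of_mulVec_single
    intro i
    apply ι_inj (negForm w)
    rw [adGL_mulVec, ι_adEnd, ← hgu]
    conv_lhs => rw [← hinv]
    rfl
  rw [hEq, hd]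

end Coordinates

section Lorentz

/-- Index type of the coordinates of `ℝⁿ,¹`; the last coordinate `x_{n+1}` is `Sum.inr ()`. -/
abbrev Idx (n : ℕ) : Type := Fin n ⊕ Unit

/-- Real `(n+1) × (n+1)` matrices. -/
abbrev Mat (n : ℕ) : Type := Matrix (Idx n) (Idx n) ℝ

/-- The weights of the Lorentzian form `f_n`. -/
def lorentzWeight (n : ℕ) : Idx n → ℝ := Sum.elim (fun _ => 1) (fun _ => -1)

/-- The Lorentzian quadratic form `f_n(x) = x₁² + ⋯ + x_n² - x_{n+1}²`. -/
def lorentzForm (n : ℕ) : QuadraticForm ℝ (Idx n → ℝ) :=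
  QuadraticMap.weightedSumSquares ℝ (lorentzWeight n)

lemma lorentzForm_apply (n : ℕ) (x : Idx n → ℝ) :
    lorentzForm n x = ∑ i : Fin n, x (.inl i) ^ 2 - x (.inr ()) ^ 2 := by
  simp [lorentzForm, lorentzWeight, pow_two, sub_eq_add_neg]

lemma neg_lorentz (n : ℕ) (x : Idx n → ℝ) :
    negForm (lorentzWeight n) x = -lorentzForm n x := rfl

lemma refl_time (n : ℕ) (a u : Idx n → ℝ) (ha : lorentzForm n a ≠ 0)
    (hu : lorentzForm n u < 0) :
    0 < lorentzForm n a * ((reflMat (lorentzWeight n) a *ᵥ u) (.inr ()) * u (.inr ())) := by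
  have e1 : ∑ i, lorentzWeight n i * (a i * a i) = lorentzForm n a := by
    simp [lorentzForm]
  rw [reflMat_mulVec, e1]
  have e2 : ∑ i, lorentzWeight n i * (a i * u i) =
      ∑ i : Fin n, a (.inl i) * u (.inl i) - a (.inr ()) * u (.inr ()) := by
    simp [lorentzWeight, sub_eq_add_neg]
  rw [e2]
  have cs := Finset.sum_mul_sq_le_sq_mul_sq Finset.univ (fun i : Fin n => a (.inl i))
    (fun i : Fin n => u (.inl i))
  simp only [Pi.sub_apply, Pi.smul_apply, smul_eq_mul]
  have hA : 0 ≤ ∑ i : Fin n, a (.inl i) ^ 2 := Finset.sum_nonneg fun i _ => sq_nonneg _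
  have hU : 0 ≤ ∑ i : Fin n, u (.inl i) ^ 2 := Finset.sum_nonneg fun i _ => sq_nonneg _
  have e3 := lorentzForm_apply n a
  have e4 := lorentzForm_apply n u
  rw [e4] at hu
  generalize lorentzForm n a = q at *
  generalize a (.inr ()) = t at *
  generalize u (.inr ()) = s at *
  generalize ∑ i : Fin n, a (.inl i) ^ 2 = A at *
  generalize ∑ i : Fin n, u (.inl i) ^ 2 = U at *
  generalize ∑ i : Fin n, a (.inl i) * u (.inl i) = D at *
  have e5 : q * ((s - 2 * (D - t * s) / q * t) * s) = A * s ^ 2 + t ^ 2 * s ^ 2 - 2 * D * t * s := by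
    have : q * ((s - 2 * (D - t * s) / q * t) * s) = q * s ^ 2 - 2 * (D - t * s) * t * s := by
      field_simp
    rw [this, e3]; ring
  rw [e5]
  have hs : 0 < s ^ 2 := by linarith
  rcases eq_or_ne t 0 with ht | ht
  · subst ht
    have : 0 < A := lt_of_le_of_ne hA (by intro h; apply ha; rw [e3, ← h]; ring)
    nlinarith [mul_pos this hs]
  · have ht2 : 0 < t ^ 2 := by positivity
    have hts : 0 < t ^ 2 * s ^ 2 := mul_pos ht2 hs
    rcases hA.eq_or_lt with h | h
    · rw [← h, zero_mul] at cs
      have : D = 0 := by nlinarith [sq_nonneg D]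
      rw [this, ← h]; linarith
    · have h1 : D ^ 2 * (t ^ 2 * s ^ 2) < A * s ^ 2 * (t ^ 2 * s ^ 2) := by
        apply mul_lt_mul_of_pos_right _ hts
        nlinarith
      have h2 : (2 * D * t * s) ^ 2 < (A * s ^ 2 + t ^ 2 * s ^ 2) ^ 2 := by
        nlinarith [sq_nonneg (A * s ^ 2 - t ^ 2 * s ^ 2)]
      have h3 := abs_lt_of_sq_lt_sq h2 (by positivity)
      linarith [h3, le_abs_self (2 * D * t * s)]

lemma lipschitz_time (n : ℕ) {x : (CliffordAlgebra (negForm (lorentzWeight n)))ˣ}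
    (hx : x ∈ lipschitzGroup (negForm (lorentzWeight n))) :
    ∃ (g : Mat n) (c : ℝ),
      star (x : CliffordAlgebra (negForm (lorentzWeight n))) *
        (x : CliffordAlgebra (negForm (lorentzWeight n))) = algebraMap ℝ _ c ∧
      (∀ u, involute (x : CliffordAlgebra (negForm (lorentzWeight n))) * ι _ u *
        ((x⁻¹ : (CliffordAlgebra (negForm (lorentzWeight n)))ˣ) :
          CliffordAlgebra (negForm (lorentzWeight n))) = ι _ (g *ᵥ u)) ∧
      ∀ u, lorentzForm n u < 0 → lorentzForm n (g *ᵥ u) < 0 ∧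
        0 < c * ((g *ᵥ u) (.inr ()) * u (.inr ())) := by
  refine lipschitz_induction _ (p := fun x =>
    ∃ (g : Mat n) (c : ℝ),
      star (x : CliffordAlgebra (negForm (lorentzWeight n))) *
        (x : CliffordAlgebra (negForm (lorentzWeight n))) = algebraMap ℝ _ c ∧
      (∀ u, involute (x : CliffordAlgebra (negForm (lorentzWeight n))) * ι _ u *
        ((x⁻¹ : (CliffordAlgebra (negForm (lorentzWeight n)))ˣ) :
          CliffordAlgebra (negForm (lorentzWeight n))) = ι _ (g *ᵥ u)) ∧
      ∀ u, lorentzForm n u < 0 → lorentzForm n (g *ᵥ u) < 0 ∧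
        0 < c * ((g *ᵥ u) (.inr ()) * u (.inr ()))) ?_ ?_ ?_ hx
  · intro x a ha
    have h0 := (ι_unit_inv _ x a ha).1
    rw [neg_lorentz, neg_ne_zero] at h0
    refine ⟨reflMat _ a, lorentzForm n a, ?_, twisted_vector _ x a ha, fun u hu => ⟨?_, ?_⟩⟩
    · rw [← ha, star_ι, neg_mul, ι_sq_scalar, neg_lorentz, map_neg, neg_neg]
    · have e1 : ∑ i, lorentzWeight n i * (a i * a i) = lorentzForm n a := by simp [lorentzForm]
      have key : lorentzForm n (reflMat (lorentzWeight n) a *ᵥ u) = lorentzForm n u := by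
        rw [reflMat_mulVec, e1]
        have e2 := polar_negForm (lorentzWeight n) a u
        have e3 : QuadraticMap.polar (lorentzForm n) u a =
            2 * ∑ i, lorentzWeight n i * (a i * u i) := by
          rw [QuadraticMap.polar_comm, ← neg_inj, ← e2]
          simp only [QuadraticMap.polar, neg_lorentz]; ring
        rw [← e3, sub_eq_add_neg, ← neg_smul, QuadraticMap.map_add (lorentzForm n), QuadraticMap.map_smul,
          QuadraticMap.polar_smul_right, smul_eq_mul, smul_eq_mul]
        field_simp
        ring
      rw [key]; exact hu
    · exact refl_time n a u h0 hu
  · refine ⟨1, 1, by simp, by simp, fun u hu => ⟨by simpa using hu, ?_⟩⟩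
    rw [lorentzForm_apply] at hu
    have : 0 ≤ ∑ i : Fin n, u (.inl i) ^ 2 := Finset.sum_nonneg fun i _ => sq_nonneg _
    rw [Matrix.one_mulVec]
    nlinarith
  · rintro x y ⟨g, c, hc, hg, hgt⟩ ⟨h, d, hd, hh, hht⟩
    refine ⟨g * h, c * d, ?_, fun u => ?_, fun u hu => ?_⟩
    · rw [Units.val_mul, star_mul, mul_assoc, ← mul_assoc (star (x : CliffordAlgebra (negForm (lorentzWeight n)))) _ (y : CliffordAlgebra (negForm (lorentzWeight n))), hc,
        ← mul_assoc, ← Algebra.commutes, mul_assoc, hd, map_mul]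
    · rw [← Matrix.mulVec_mulVec, ← hg, ← hh, _root_.mul_inv_rev, Units.val_mul, Units.val_mul,
        map_mul]
      simp only [mul_assoc]
    · rw [← Matrix.mulVec_mulVec]
      obtain ⟨h1, h2⟩ := hht u hu
      obtain ⟨h3, h4⟩ := hgt _ h1
      refine ⟨h3, ?_⟩
      generalize (g *ᵥ h *ᵥ u) (.inr ()) = r at *
      generalize (h *ᵥ u) (.inr ()) = m at *
      have hm : m ≠ 0 := by rintro rfl; simp at h2
      have hm2 : 0 < m ^ 2 := by positivity
      have h5 := mul_pos h4 h2
      have h6 : c * (r * m) * (d * (m * u (.inr ()))) = m ^ 2 * (c * d * (r * u (.inr ()))) := by ring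
      rw [h6] at h5
      exact (mul_pos_iff_of_pos_left hm2).1 h5

/-- Hyperbolic `n`-space in the hyperboloid model, as a set. -/
def hyperboloid (n : ℕ) : Set (Idx n → ℝ) :=
  {x | lorentzForm n x = -1 ∧ 0 < x (.inr ())}

/-- The group `SO⁺(n,1)`: the matrices in `GL(n+1,ℝ)` that preserve `f_n`, leave `Hⁿ` invariant and
have determinant `1`. -/
def SOPlus (n : ℕ) : Subgroup (GL (Idx n) ℝ) where
  carrier := {A | (∀ x, lorentzForm n ((A : Mat n) *ᵥ x) = lorentzForm n x) ∧
    (∀ x, (A : Mat n) *ᵥ x ∈ hyperboloid n ↔ x ∈ hyperboloid n) ∧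
    (A : Mat n).det = 1}
  one_mem' := by simp
  mul_mem' := by
    rintro A B ⟨h1, h2, h3⟩ ⟨k1, k2, k3⟩
    refine ⟨fun x => ?_, fun x => ?_, ?_⟩
    · rw [Units.val_mul, ← Matrix.mulVec_mulVec, h1, k1]
    · rw [Units.val_mul, ← Matrix.mulVec_mulVec, h2, k2]
    · rw [Units.val_mul, Matrix.det_mul, h3, k3, one_mul]
  inv_mem' := by
    rintro A ⟨h1, h2, h3⟩
    have e : ∀ x, (A : Mat n) *ᵥ ((A⁻¹ : GL (Idx n) ℝ) : Mat n) *ᵥ x = x := by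
      intro x
      rw [Matrix.mulVec_mulVec, ← Units.val_mul, mul_inv_cancel, Units.val_one, Matrix.one_mulVec]
    refine ⟨fun x => ?_, fun x => ?_, ?_⟩
    · rw [← h1, e]
    · rw [← h2, e]
    · have h4 : (A : Mat n).det * ((A⁻¹ : GL (Idx n) ℝ) : Mat n).det = 1 := by
        rw [← Matrix.det_mul, ← Units.val_mul, mul_inv_cancel, Units.val_one, Matrix.det_one]
      rwa [h3, one_mul] at h4

/-- Hyperbolic `n`-space `Hⁿ`, with the topology induced from `ℝⁿ⁺¹`. -/
abbrev Hyp (n : ℕ) : Type := hyperboloid n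

instance (n : ℕ) : MulAction (SOPlus n) (Hyp n) where
  smul A x := ⟨((A : GL (Idx n) ℝ) : Mat n) *ᵥ x.1, (A.property.2.1 _).2 x.2⟩
  one_smul x := Subtype.ext (Matrix.one_mulVec _)
  mul_smul A B x := Subtype.ext (Matrix.mulVec_mulVec x.1 ((A : GL (Idx n) ℝ) : Mat n) ((B : GL (Idx n) ℝ) : Mat n)).symm

/-- The base point `e_{n+1}` of `Hⁿ`. -/
def basePoint (n : ℕ) : Hyp n :=
  ⟨Sum.elim 0 1, by simp [hyperboloid, lorentzForm_apply]⟩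

/-- The standard positive definite form `x₁² + ⋯ + x_n²`. -/
def euclideanForm (n : ℕ) : QuadraticForm ℝ (Fin n → ℝ) :=
  QuadraticMap.weightedSumSquares ℝ (fun _ : Fin n => (1 : ℝ))

lemma euclideanForm_apply (n : ℕ) (x : Fin n → ℝ) : euclideanForm n x = ∑ i, x i ^ 2 := by
  simp [euclideanForm, pow_two]

/-- The spin group `Spin(n)`, inside the Clifford algebra with relations `v² = -|v|²`. -/
abbrev SpinN (n : ℕ) : Type := spinGroup (-euclideanForm n)

/-- The group `Spin⁺(n,1)`, inside the Clifford algebra with relations `v² = -f_n(v)`: the even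
elements `x` of the group generated by the non-isotropic vectors with `x * star x = 1`, where
`x * star x` is the spinor norm. For `n ≥ 2` it is the identity component of the group `Spin(n,1)`
of the products of an even number of vectors `v` with `f_n(v) = ±1`. -/
abbrev SpinPlus (n : ℕ) : Type := spinGroup (-lorentzForm n)

/-- A Clifford algebra over `ℝ` carries the canonical topology of a (finite-dimensional) real vector
space; the spin groups carry the subspace topology. -/
instance cliffordTopology {M : Type*} [AddCommGroup M] [Module ℝ M] (Q : QuadraticForm ℝ M) :
    TopologicalSpace (CliffordAlgebra Q) := moduleTopology ℝ (CliffordAlgebra Q)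

lemma time_adGL (n : ℕ) (x : SpinPlus n) {u : Idx n → ℝ} (hu : lorentzForm n u < 0) :
    0 < ((adGL (-lorentzForm n) x : Mat n) *ᵥ u) (.inr ()) * u (.inr ()) := by
  obtain ⟨g, c, hc, hg, hgt⟩ := lipschitz_time n
    (spinGroup.units_mem_lipschitzGroup (x := spinGroup.toUnits x) x.2)
  have hinv : involute (x : CliffordAlgebra (-lorentzForm n)) = x := spinGroup.involute_eq x.2
  have hc1 : c = 1 := by
    have h1 : star (x : CliffordAlgebra (-lorentzForm n)) * x = 1 :=
      spinGroup.star_mul_self_of_mem x.2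
    have h2 : algebraMap ℝ (CliffordAlgebra (-lorentzForm n)) c = algebraMap ℝ _ 1 := by
      rw [map_one, ← h1]; exact hc.symm
    exact (algebraMap ℝ (CliffordAlgebra (-lorentzForm n))).injective h2
  have hEq : (adGL (-lorentzForm n) x : Mat n) *ᵥ u = g *ᵥ u := by
    apply ι_inj (-lorentzForm n)
    rw [adGL_mulVec, ι_adEnd]
    refine Eq.trans ?_ (hg u)
    conv_lhs => rw [← hinv]
    rfl
  rw [hEq]
  have := (hgt u hu).2
  rwa [hc1, one_mul] at this

lemma adGL_mem_SOPlus (n : ℕ) (x : SpinPlus n) : adGL (-lorentzForm n) x ∈ SOPlus n := by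
  have hform : ∀ v, lorentzForm n ((adGL (-lorentzForm n) x : Mat n) *ᵥ v) =
      lorentzForm n v := by
    intro v
    have := adEnd_form (-lorentzForm n) x v
    rw [adGL_mulVec]
    simpa using this
  refine ⟨hform, fun v => ?_, det_adGL (lorentzWeight n) x⟩
  simp only [hyperboloid, Set.mem_ofPred_eq, hform]
  refine and_congr_right fun hv => ?_
  have h := time_adGL n x (u := v) (by rw [hv]; norm_num)
  exact ⟨fun h1 => (mul_pos_iff_of_pos_left h1).1 h, fun h1 => (mul_pos_iff_of_pos_right h1).1 h⟩

/-- The homomorphism `η : Spin⁺(n,1) → SO⁺(n,1)`, given by `η(x)(v) = x v x⁻¹`. -/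
def eta (n : ℕ) : SpinPlus n →* SOPlus n :=
  (adGL (-lorentzForm n)).codRestrict (SOPlus n) (adGL_mem_SOPlus n)

/-- The matrix group `SO(n)`. -/
abbrev SON (n : ℕ) : Type := Matrix.specialOrthogonalGroup (Fin n) ℝ

lemma mem_orthogonal_of_form (n : ℕ) (A : Matrix (Fin n) (Fin n) ℝ)
    (h : ∀ v, euclideanForm n (A *ᵥ v) = euclideanForm n v) : Aᵀ * A = 1 := by
  have h2 : ∀ v w : Fin n → ℝ, (A *ᵥ v) ⬝ᵥ (A *ᵥ w) = v ⬝ᵥ w := by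
    have hq : ∀ v, (A *ᵥ v) ⬝ᵥ (A *ᵥ v) = v ⬝ᵥ v := by
      intro v
      have := h v
      simpa [euclideanForm, dotProduct] using this
    intro v w
    have h1 := hq (v + w)
    rw [Matrix.mulVec_add] at h1
    simp only [add_dotProduct, dotProduct_add] at h1
    rw [hq, hq, dotProduct_comm w v, dotProduct_comm (A *ᵥ w)] at h1
    linarith
  ext i j
  have := h2 (Pi.single i 1) (Pi.single j 1)
  simpa [Matrix.mul_apply, dotProduct, Matrix.one_apply, Pi.single_apply, eq_comm] using this

lemma adGL_mem_SON (n : ℕ) (x : SpinN n) :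
    (adGL (-euclideanForm n) x : Matrix (Fin n) (Fin n) ℝ) ∈
      Matrix.specialOrthogonalGroup (Fin n) ℝ := by
  rw [Matrix.mem_specialOrthogonalGroup_iff, Matrix.mem_orthogonalGroup_iff']
  refine ⟨mem_orthogonal_of_form n _ fun v => ?_, det_adGL (fun _ : Fin n => (1 : ℝ)) x⟩
  have := adEnd_form (-euclideanForm n) x v
  rw [adGL_mulVec]
  simpa using this

/-- The homomorphism `σ : Spin(n) → SO(n)`, given by `σ(s)(v) = s v s⁻¹`. -/
def sigma (n : ℕ) : SpinN n →* SON n :=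
  ((Units.coeHom (Matrix (Fin n) (Fin n) ℝ)).comp (adGL (-euclideanForm n))).codRestrict
    (Matrix.specialOrthogonalGroup (Fin n) ℝ) (adGL_mem_SON n)

/-- The isometric inclusion `ℝⁿ → ℝⁿ,¹`, `v ↦ (v, 0)`, for the negated forms. -/
def inclIsometry (n : ℕ) : (-euclideanForm n) →qᵢ (-lorentzForm n) where
  toFun v := Sum.elim v 0
  map_add' v w := by ext (i | i) <;> simp
  map_smul' c v := by ext (i | i) <;> simp
  map_app' v := by simp [lorentzForm_apply, euclideanForm_apply]

lemma map_star {M N : Type*} [AddCommGroup M] [Module ℝ M] [AddCommGroup N] [Module ℝ N]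
    {Q : QuadraticForm ℝ M} {Q' : QuadraticForm ℝ N} (f : Q →qᵢ Q') (x : CliffordAlgebra Q) :
    CliffordAlgebra.map f (star x) = star (CliffordAlgebra.map f x) := by
  induction x using CliffordAlgebra.induction with
  | algebraMap r => simp
  | ι v => simp
  | mul a b ha hb => simp [ha, hb]
  | add a b ha hb => simp [ha, hb]

lemma map_involute {M N : Type*} [AddCommGroup M] [Module ℝ M] [AddCommGroup N] [Module ℝ N]
    {Q : QuadraticForm ℝ M} {Q' : QuadraticForm ℝ N} (f : Q →qᵢ Q') (x : CliffordAlgebra Q) :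
    CliffordAlgebra.map f (involute x) = involute (CliffordAlgebra.map f x) := by
  induction x using CliffordAlgebra.induction with
  | algebraMap r => simp
  | ι v => simp
  | mul a b ha hb => simp [ha, hb]
  | add a b ha hb => simp [ha, hb]

lemma map_mem_even {M N : Type*} [AddCommGroup M] [Module ℝ M] [AddCommGroup N] [Module ℝ N]
    {Q : QuadraticForm ℝ M} {Q' : QuadraticForm ℝ N} (f : Q →qᵢ Q') (x : CliffordAlgebra Q)
    (hx : x ∈ evenOdd Q 0) : CliffordAlgebra.map f x ∈ evenOdd Q' 0 := by
  induction x, hx using CliffordAlgebra.even_induction with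
  | algebraMap r =>
    rw [AlgHom.commutes]; exact SetLike.algebraMap_mem_graded (evenOdd Q') r
  | add x y hx hy h1 h2 => rw [map_add]; exact Submodule.add_mem _ h1 h2
  | ι_mul_ι_mul a b x hx h =>
    rw [map_mul, map_mul, map_apply_ι, map_apply_ι]
    have := SetLike.mul_mem_graded (ι_mul_ι_mem_evenOdd_zero Q' (f a) (f b)) h
    rwa [zero_add] at this

lemma map_mem_spinGroup {M N : Type*} [AddCommGroup M] [Module ℝ M] [AddCommGroup N] [Module ℝ N]
    {Q : QuadraticForm ℝ M} {Q' : QuadraticForm ℝ N} (f : Q →qᵢ Q') {x : CliffordAlgebra Q}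
    (hx : x ∈ spinGroup Q) : CliffordAlgebra.map f x ∈ spinGroup Q' := by
  obtain ⟨⟨⟨y, hy, rfl⟩, h1, h2⟩, h3⟩ := hx
  refine ⟨⟨⟨Units.map (CliffordAlgebra.map f : CliffordAlgebra Q →* CliffordAlgebra Q') y, ?_, rfl⟩,
    ?_, ?_⟩, map_mem_even f _ h3⟩
  · have h4 : lipschitzGroup Q ≤ (lipschitzGroup Q').comap
        (Units.map (CliffordAlgebra.map f : CliffordAlgebra Q →* CliffordAlgebra Q')) := by
      refine (Subgroup.closure_le _).2 ?_
      rintro z ⟨a, ha⟩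
      refine Subgroup.subset_closure ⟨f a, ?_⟩
      rw [← map_apply_ι, ha]
      rfl
    exact h4 hy
  · rw [← map_star, ← map_mul, h1, map_one]
  · rw [← map_star, ← map_mul, h2, map_one]

/-- The embedding `s ↦ ŝ` of `Spin(n)` into `Spin⁺(n,1)`, induced by the inclusion of `Cl(n)` in
`Cl(n,1)`. -/
def spinHat (n : ℕ) : SpinN n →* SpinPlus n where
  toFun s := ⟨CliffordAlgebra.map (inclIsometry n) s, map_mem_spinGroup _ s.2⟩
  map_one' := Subtype.ext (map_one _)
  map_mul' s t := Subtype.ext (map_mul _ _ _)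

/-- The block diagonal matrix with blocks `B` and `(1)`. -/
def hatMat (n : ℕ) (B : Matrix (Fin n) (Fin n) ℝ) : Mat n := Matrix.fromBlocks B 0 0 1

lemma hatMat_mulVec_inl (n : ℕ) (B : Matrix (Fin n) (Fin n) ℝ) (x : Idx n → ℝ) (i : Fin n) :
    (hatMat n B *ᵥ x) (.inl i) = (B *ᵥ fun j => x (.inl j)) i := by
  simp [hatMat, Matrix.mulVec, dotProduct]

lemma hatMat_mulVec_inr (n : ℕ) (B : Matrix (Fin n) (Fin n) ℝ) (x : Idx n → ℝ) :
    (hatMat n B *ᵥ x) (.inr ()) = x (.inr ()) := by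
  simp [hatMat, Matrix.mulVec, dotProduct]

lemma hatMat_mul (n : ℕ) (A B : Matrix (Fin n) (Fin n) ℝ) :
    hatMat n (A * B) = hatMat n A * hatMat n B := by
  simp [hatMat, Matrix.fromBlocks_multiply]

/-- `B ↦ B̂` as a homomorphism `SO(n) → GL(n+1,ℝ)`. -/
def hatGL (n : ℕ) : SON n →* GL (Idx n) ℝ :=
  MonoidHom.toHomUnits
    { toFun := fun B => hatMat n B
      map_one' := by simp [hatMat]
      map_mul' := fun A B => hatMat_mul n A B }

lemma hatGL_mem (n : ℕ) (B : SON n) : hatGL n B ∈ SOPlus n := by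
  obtain ⟨h1, h2⟩ := Matrix.mem_specialOrthogonalGroup_iff.1 B.2
  rw [Matrix.mem_orthogonalGroup_iff'] at h1
  have hc : ((hatGL n B : GL (Idx n) ℝ) : Mat n) = hatMat n B := rfl
  have hform : ∀ x, lorentzForm n (((hatGL n B : GL (Idx n) ℝ) : Mat n) *ᵥ x) =
      lorentzForm n x := by
    intro x
    rw [hc, lorentzForm_apply, lorentzForm_apply, hatMat_mulVec_inr]
    congr 1
    simp only [hatMat_mulVec_inl]
    have h3 : ((B : Matrix (Fin n) (Fin n) ℝ) *ᵥ fun j => x (.inl j)) ⬝ᵥ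
        ((B : Matrix (Fin n) (Fin n) ℝ) *ᵥ fun j => x (.inl j)) =
        (fun j => x (.inl j)) ⬝ᵥ fun j => x (.inl j) := by
      rw [Matrix.dotProduct_mulVec, Matrix.vecMul_mulVec, h1, Matrix.vecMul_one]
    simpa [dotProduct, pow_two] using h3
  refine ⟨hform, fun x => ?_, ?_⟩
  · simp only [hyperboloid, Set.mem_ofPred_eq, hform]
    rw [hc, hatMat_mulVec_inr]
  · rw [hc, hatMat, Matrix.det_fromBlocks_zero₂₁, h2, Matrix.det_one, one_mul]

/-- The embedding `B ↦ B̂` of `SO(n)` into `SO⁺(n,1)`. -/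
def soHat (n : ℕ) : SON n →* SOPlus n := (hatGL n).codRestrict (SOPlus n) (hatGL_mem n)

end Lorentz

section Cayley

/-- The diagonal matrix of the Lorentzian inner product. -/
def lorentzJ (n : ℕ) : Mat n := Matrix.diagonal (lorentzWeight n)

/-- The Lie algebra `so(n,1)` as a linear space of matrices; its dimension is `n(n+1)/2`. -/
def soSubmodule (n : ℕ) : Submodule ℝ (Mat n) where
  carrier := {X | Xᵀ * lorentzJ n + lorentzJ n * X = 0}
  zero_mem' := by simp
  add_mem' := by
    intro X Y hX hY
    have : (X + Y)ᵀ * lorentzJ n + lorentzJ n * (X + Y) =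
        (Xᵀ * lorentzJ n + lorentzJ n * X) + (Yᵀ * lorentzJ n + lorentzJ n * Y) := by
      rw [Matrix.transpose_add]; noncomm_ring
    exact this.trans (by rw [hX, hY, add_zero])
  smul_mem' := by
    intro c X hX
    have : (c • X)ᵀ * lorentzJ n + lorentzJ n * (c • X) =
        c • (Xᵀ * lorentzJ n + lorentzJ n * X) := by
      rw [Matrix.transpose_smul, smul_add, smul_mul_assoc, mul_smul_comm]
    exact this.trans (by rw [hX, smul_zero])

/-- The Lie algebra `so(n,1)` as a finite-dimensional normed space. It is the model space of the
manifolds below. -/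
def soLie (n : ℕ) : Type := soSubmodule n

instance (n : ℕ) : NormedAddCommGroup (soLie n) :=
  letI : NormedAddCommGroup (Mat n) := Matrix.normedAddCommGroup
  inferInstanceAs (NormedAddCommGroup (soSubmodule n))

instance (n : ℕ) : NormedSpace ℝ (soLie n) :=
  letI : NormedAddCommGroup (Mat n) := Matrix.normedAddCommGroup
  letI : NormedSpace ℝ (Mat n) := Matrix.normedSpace
  inferInstanceAs (NormedSpace ℝ (soSubmodule n))

instance (n : ℕ) : FiniteDimensional ℝ (soLie n) :=
  inferInstanceAs (FiniteDimensional ℝ (soSubmodule n))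

/-- The matrix of an element of `so(n,1)`. -/
def soLie.mat {n : ℕ} (X : soLie n) : Mat n := Subtype.val (p := (· ∈ soSubmodule n)) X

lemma soLie.mat_mem {n : ℕ} (X : soLie n) : X.mat ∈ soSubmodule n :=
  Subtype.property (p := (· ∈ soSubmodule n)) X

/-- The element of `so(n,1)` with a given matrix. -/
def soLie.mk {n : ℕ} (X : Mat n) (h : X ∈ soSubmodule n) : soLie n := ⟨X, h⟩

lemma soLie.ext {n : ℕ} {X Y : soLie n} (h : X.mat = Y.mat) : X = Y := Subtype.ext h

lemma soLie.isInducing_mat (n : ℕ) : Topology.IsInducing (soLie.mat (n := n)) := ⟨rfl⟩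

/-- The Cayley transform. -/
def cay {n : ℕ} (B : Mat n) : Mat n := (1 - B) * (1 + B)⁻¹

lemma cay_spec {n : ℕ} {B : Mat n} (h : (1 + B).det ≠ 0) :
    (1 + B) * (1 + B)⁻¹ = 1 ∧ (1 + B)⁻¹ * (1 + B) = 1 :=
  ⟨Matrix.mul_nonsing_inv _ (isUnit_iff_ne_zero.2 h),
    Matrix.nonsing_inv_mul _ (isUnit_iff_ne_zero.2 h)⟩

lemma cay_cay {n : ℕ} {B : Mat n} (h : (1 + B).det ≠ 0) :
    (1 + cay B).det ≠ 0 ∧ cay (cay B) = B := by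
  obtain ⟨h1, h2⟩ := cay_spec h
  have e : (1 + cay B) * ((1 / 2 : ℝ) • (1 + B)) = 1 := by
    have : (1 + cay B) * (1 + B) = (2 : ℝ) • 1 := by
      rw [cay, add_mul, one_mul, mul_assoc, h2, mul_one, two_smul]
      abel
    rw [mul_smul_comm, this, smul_smul]
    norm_num
  have hd : (1 + cay B).det ≠ 0 := by
    intro h0
    have := congrArg Matrix.det e
    rw [Matrix.det_mul, h0, zero_mul, Matrix.det_one] at this
    exact zero_ne_one this
  refine ⟨hd, ?_⟩
  have hinv : (1 + cay B)⁻¹ = (1 / 2 : ℝ) • (1 + B) := Matrix.inv_eq_right_inv e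
  have h3 : (1 - cay B) * (1 + B) = (2 : ℝ) • B := by
    rw [cay, sub_mul, one_mul, mul_assoc, h2, mul_one, two_smul]
    abel
  conv_lhs => rw [cay]
  rw [hinv, mul_smul_comm, h3, smul_smul]
  norm_num

lemma cay_mem_soLie {n : ℕ} {A : Mat n} (hA : Aᵀ * lorentzJ n * A = lorentzJ n) :
    cay A ∈ soSubmodule n := by
  change (cay A)ᵀ * lorentzJ n + lorentzJ n * cay A = 0
  by_cases h : (1 + A).det = 0
  · have : (1 + A)⁻¹ = 0 := Matrix.nonsing_inv_apply_not_isUnit _ (by simp [h])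
    simp [cay, this]
  · obtain ⟨h1, h2⟩ := cay_spec h
    have h1' : ((1 + A)⁻¹)ᵀ * (1 + A)ᵀ = 1 := by
      rw [← Matrix.transpose_mul, h1, Matrix.transpose_one]
    have e : (1 - A)ᵀ * lorentzJ n * (1 + A) + (1 + A)ᵀ * lorentzJ n * (1 - A) = 0 := by
      have : (1 - A)ᵀ * lorentzJ n * (1 + A) + (1 + A)ᵀ * lorentzJ n * (1 - A) =
          (2 : ℤ) • (lorentzJ n - Aᵀ * lorentzJ n * A) := by
        rw [Matrix.transpose_sub, Matrix.transpose_add, Matrix.transpose_one]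
        noncomm_ring
      rw [this, hA, sub_self, smul_zero]
    calc (cay A)ᵀ * lorentzJ n + lorentzJ n * cay A
        = ((1 + A)⁻¹)ᵀ * ((1 - A)ᵀ * lorentzJ n * (1 + A) +
            (1 + A)ᵀ * lorentzJ n * (1 - A)) * (1 + A)⁻¹ := by
          rw [cay, Matrix.transpose_mul, mul_add, add_mul]
          congr 1
          · simp only [mul_assoc]; rw [h1, mul_one]
          · simp only [← mul_assoc]; rw [h1', one_mul]
      _ = 0 := by rw [e]; simp

lemma det_lorentzJ_ne (n : ℕ) : (lorentzJ n).det ≠ 0 := by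
  simp [lorentzJ, lorentzWeight, Matrix.det_diagonal]

lemma cay_orth {n : ℕ} {X : Mat n} (hX : X ∈ soSubmodule n) (h : (1 + X).det ≠ 0) :
    (cay X)ᵀ * lorentzJ n * cay X = lorentzJ n ∧ (cay X).det = 1 := by
  have hX' : Xᵀ * lorentzJ n = -(lorentzJ n * X) := eq_neg_of_add_eq_zero_left hX
  obtain ⟨h1, h2⟩ := cay_spec h
  have h1' : ((1 + X)⁻¹)ᵀ * (1 + X)ᵀ = 1 := by
    rw [← Matrix.transpose_mul, h1, Matrix.transpose_one]
  have e1 : (1 - X)ᵀ * lorentzJ n = lorentzJ n * (1 + X) := by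
    rw [Matrix.transpose_sub, Matrix.transpose_one, sub_mul, hX']; noncomm_ring
  have e2 : (1 + X)ᵀ * lorentzJ n = lorentzJ n * (1 - X) := by
    rw [Matrix.transpose_add, Matrix.transpose_one, add_mul, hX']; noncomm_ring
  constructor
  · calc (cay X)ᵀ * lorentzJ n * cay X
        = ((1 + X)⁻¹)ᵀ * ((1 - X)ᵀ * lorentzJ n) * (1 - X) * (1 + X)⁻¹ := by
          rw [cay, Matrix.transpose_mul]; simp only [mul_assoc]
      _ = ((1 + X)⁻¹)ᵀ * (lorentzJ n * (1 - X)) * ((1 + X) * (1 + X)⁻¹) := by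
          rw [e1]; noncomm_ring
      _ = lorentzJ n := by
          rw [← e2, h1, mul_one, ← mul_assoc, h1', one_mul]
  · have e3 : (1 + X).det = (1 - X).det := by
      have := congrArg Matrix.det e2
      rw [Matrix.det_mul, Matrix.det_mul, Matrix.det_transpose, mul_comm] at this
      exact mul_left_cancel₀ (det_lorentzJ_ne n) this
    have h4 := congrArg Matrix.det h1
    rw [Matrix.det_mul, Matrix.det_one, e3] at h4
    rw [cay, Matrix.det_mul, h4]

lemma lorentzForm_eq (n : ℕ) (x : Idx n → ℝ) : lorentzForm n x = x ⬝ᵥ (lorentzJ n *ᵥ x) := by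
  simp [lorentzForm, lorentzJ, dotProduct, Matrix.mulVec_diagonal, mul_left_comm]

lemma SOPlus_orth {n : ℕ} (A : SOPlus n) :
    ((A : GL (Idx n) ℝ) : Mat n)ᵀ * lorentzJ n * ((A : GL (Idx n) ℝ) : Mat n) = lorentzJ n := by
  obtain ⟨hf, -, -⟩ := A.2
  generalize ((A : GL (Idx n) ℝ) : Mat n) = B at *
  have hsymm : ∀ v w : Idx n → ℝ, v ⬝ᵥ (lorentzJ n *ᵥ w) = w ⬝ᵥ (lorentzJ n *ᵥ v) := by
    intro v w
    simp [lorentzJ, dotProduct, Matrix.mulVec_diagonal, mul_left_comm, mul_comm]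
  have hq : ∀ v, (B *ᵥ v) ⬝ᵥ (lorentzJ n *ᵥ (B *ᵥ v)) = v ⬝ᵥ (lorentzJ n *ᵥ v) := by
    intro v
    rw [← lorentzForm_eq, ← lorentzForm_eq, hf]
  have h2 : ∀ v w : Idx n → ℝ,
      (B *ᵥ v) ⬝ᵥ (lorentzJ n *ᵥ (B *ᵥ w)) = v ⬝ᵥ (lorentzJ n *ᵥ w) := by
    intro v w
    have h1 := hq (v + w)
    simp only [Matrix.mulVec_add, add_dotProduct, dotProduct_add] at h1
    rw [hq, hq, hsymm w v, hsymm (B *ᵥ w)] at h1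
    linarith
  ext i j
  have := h2 (Pi.single i 1) (Pi.single j 1)
  rw [Matrix.mulVec_mulVec, Matrix.dotProduct_mulVec, Matrix.vecMul_mulVec] at this
  simpa [Matrix.mul_assoc] using this

lemma orth_time_pos {n : ℕ} {A : Mat n} (hA : Aᵀ * lorentzJ n * A = lorentzJ n)
    (h0 : 0 < A (.inr ()) (.inr ())) {x : Idx n → ℝ} (hx : x ∈ hyperboloid n) :
    0 < (A *ᵥ x) (.inr ()) := by
  have hJJ : lorentzJ n * lorentzJ n = 1 := by
    rw [lorentzJ, Matrix.diagonal_mul_diagonal, ← Matrix.diagonal_one]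
    congr 1
    ext (i | i) <;> simp [lorentzWeight]
  have h1 : (lorentzJ n * Aᵀ * lorentzJ n) * A = 1 := by
    rw [mul_assoc, mul_assoc, ← mul_assoc Aᵀ, hA, hJJ]
  have h2 : A * lorentzJ n * Aᵀ = lorentzJ n := by
    have h3 := mul_eq_one_comm.1 h1
    calc A * lorentzJ n * Aᵀ = A * (lorentzJ n * Aᵀ * lorentzJ n) * lorentzJ n := by
          simp only [mul_assoc]; rw [hJJ, mul_one]
      _ = lorentzJ n := by rw [h3, one_mul]
  have h3 := congrFun (congrFun h2 (.inr ())) (.inr ())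
  simp only [lorentzJ, Matrix.mul_apply, Matrix.diagonal_apply, Matrix.transpose_apply] at h3
  simp [lorentzWeight] at h3
  have hx1 := hx.1
  rw [lorentzForm_apply] at hx1
  have hx2 := hx.2
  have cs := Finset.sum_mul_sq_le_sq_mul_sq Finset.univ (fun i : Fin n => A (.inr ()) (.inl i))
    (fun i : Fin n => x (.inl i))
  have e : (A *ᵥ x) (.inr ()) = ∑ i : Fin n, A (.inr ()) (.inl i) * x (.inl i) +
      A (.inr ()) (.inr ()) * x (.inr ()) := by
    simp [Matrix.mulVec, dotProduct]
  rw [e]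
  have e4 : ∑ i : Fin n, A (.inr ()) (.inl i) ^ 2 = A (.inr ()) (.inr ()) ^ 2 - 1 := by
    simp only [pow_two]; linarith
  have e5 : ∑ i : Fin n, x (.inl i) ^ 2 = x (.inr ()) ^ 2 - 1 := by linarith
  rw [e4, e5] at cs
  have hU : 0 ≤ ∑ i : Fin n, x (.inl i) ^ 2 := Finset.sum_nonneg fun i _ => sq_nonneg _
  have hU' : 0 ≤ ∑ i : Fin n, A (.inr ()) (.inl i) ^ 2 := Finset.sum_nonneg fun i _ => sq_nonneg _
  rw [e5] at hU
  rw [e4] at hU'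
  generalize ∑ i : Fin n, A (.inr ()) (.inl i) * x (.inl i) = D at *
  generalize A (.inr ()) (.inr ()) = a at *
  generalize x (.inr ()) = s at *
  have h6 : D ^ 2 < (a * s) ^ 2 := by nlinarith
  have h7 := abs_lt_of_sq_lt_sq h6 (by positivity)
  linarith [(abs_lt.1 h7).1]

lemma mem_SOPlus_of_orth {n : ℕ} (A : GL (Idx n) ℝ)
    (hA : (A : Mat n)ᵀ * lorentzJ n * (A : Mat n) = lorentzJ n) (hd : (A : Mat n).det = 1)
    (h0 : 0 < (A : Mat n) (.inr ()) (.inr ())) : A ∈ SOPlus n := by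
  have hform : ∀ x, lorentzForm n ((A : Mat n) *ᵥ x) = lorentzForm n x := by
    intro x
    rw [lorentzForm_eq, lorentzForm_eq, Matrix.mulVec_mulVec, Matrix.dotProduct_mulVec,
      Matrix.vecMul_mulVec, ← mul_assoc, hA, ← Matrix.dotProduct_mulVec]
  refine ⟨hform, fun x => ⟨fun hx => ?_, fun hx => ⟨(hform x).trans hx.1, orth_time_pos hA h0 hx⟩⟩,
    hd⟩
  have hf : lorentzForm n x = -1 := (hform x).symm.trans hx.1
  refine ⟨hf, ?_⟩
  by_contra hneg
  have hs : x (.inr ()) ≠ 0 := by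
    intro h
    rw [lorentzForm_apply, h] at hf
    have hU : 0 ≤ ∑ i : Fin n, x (.inl i) ^ 2 := Finset.sum_nonneg fun i _ => sq_nonneg _
    linarith
  have hx' : -x ∈ hyperboloid n := by
    refine ⟨by rw [QuadraticMap.map_neg]; exact hf, ?_⟩
    rw [Pi.neg_apply]
    exact neg_pos.2 (lt_of_le_of_ne (not_lt.1 hneg) hs)
  have h1 := orth_time_pos hA h0 hx'
  rw [Matrix.mulVec_neg, Pi.neg_apply] at h1
  linarith [hx.2]

lemma SOPlus_time_pos {n : ℕ} (A : SOPlus n) :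
    0 < ((A : GL (Idx n) ℝ) : Mat n) (.inr ()) (.inr ()) := by
  have h := ((A.2.2.1 _).2 (basePoint n).2).2
  simpa [basePoint, Matrix.mulVec, dotProduct] using h

/-- The inverse Cayley chart, as an element of `SO⁺(n,1)`. -/
def cayInv {n : ℕ} (X : soLie n) (h : (1 + X.mat).det ≠ 0)
    (h0 : 0 < cay X.mat (.inr ()) (.inr ())) : SOPlus n :=
  ⟨Matrix.GeneralLinearGroup.mkOfDetNeZero (cay X.mat)
    (by have := (cay_orth X.mat_mem h).2; exact this ▸ one_ne_zero),
    mem_SOPlus_of_orth _ (cay_orth X.mat_mem h).1 (cay_orth X.mat_mem h).2 h0⟩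

lemma continuousOn_cay (n : ℕ) : ContinuousOn (cay (n := n)) {B | (1 + B).det ≠ 0} := by
  intro B hB
  refine ContinuousAt.continuousWithinAt ?_
  have h1 : ContinuousAt (fun B : Mat n => (1 + B)⁻¹) B := by
    refine ContinuousAt.comp (g := fun A : Mat n => A⁻¹) (f := fun B : Mat n => 1 + B) ?_
      (by fun_prop)
    refine continuousAt_matrix_inv _ ?_
    simpa using continuousAt_inv₀ hB
  exact ContinuousAt.mul (by fun_prop) h1

lemma isEmbedding_GL (n : ℕ) :
    Topology.IsEmbedding (fun A : GL (Idx n) ℝ => (A : Mat n)) := by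
  refine Units.isEmbedding_val_mk' (f := fun A : Mat n => A⁻¹) ?_ ?_
  · intro A hA
    refine ContinuousAt.continuousWithinAt (continuousAt_matrix_inv _ ?_)
    have : A.det ≠ 0 := ((Matrix.isUnit_iff_isUnit_det A).1 hA).ne_zero
    simpa using continuousAt_inv₀ this
  · intro A; exact (Matrix.coe_units_inv A).symm

lemma isEmbedding_SOPlus (n : ℕ) :
    Topology.IsEmbedding (fun A : SOPlus n => ((A : GL (Idx n) ℝ) : Mat n)) :=
  (isEmbedding_GL n).comp Topology.IsEmbedding.subtypeVal

open Classical in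
/-- The Cayley chart `A ↦ (1 - A)(1 + A)⁻¹` of `SO⁺(n,1)` around the identity. -/
def cayChart (n : ℕ) : OpenPartialHomeomorph (SOPlus n) (soLie n) where
  toFun A := soLie.mk (cay ((A : GL (Idx n) ℝ) : Mat n)) (cay_mem_soLie (SOPlus_orth A))
  invFun X := if h : (1 + X.mat).det ≠ 0 ∧ 0 < cay X.mat (.inr ()) (.inr ()) then
    cayInv X h.1 h.2 else 1
  source := {A | (1 + ((A : GL (Idx n) ℝ) : Mat n)).det ≠ 0}
  target := {X | (1 + X.mat).det ≠ 0 ∧ 0 < cay X.mat (.inr ()) (.inr ())}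
  map_source' := by
    intro A hA
    refine ⟨(cay_cay hA).1, ?_⟩
    change 0 < cay (cay ((A : GL (Idx n) ℝ) : Mat n)) _ _
    rw [(cay_cay hA).2]
    exact SOPlus_time_pos A
  map_target' := by
    intro X hX
    simp only [Set.mem_ofPred_eq] at hX ⊢
    rw [dif_pos hX]
    exact (cay_cay hX.1).1
  left_inv' := by
    intro A hA
    have h : (1 + cay ((A : GL (Idx n) ℝ) : Mat n)).det ≠ 0 ∧
        0 < cay (cay ((A : GL (Idx n) ℝ) : Mat n)) (.inr ()) (.inr ()) := by
      rw [(cay_cay hA).2]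
      exact ⟨(cay_cay hA).1, SOPlus_time_pos A⟩
    refine (dif_pos h).trans ?_
    exact Subtype.ext (Units.ext (cay_cay hA).2)
  right_inv' := by
    intro X hX
    simp only [Set.mem_ofPred_eq] at hX
    apply soLie.ext
    rw [dif_pos hX]
    exact (cay_cay hX.1).2
  open_source := by
    have h := (isEmbedding_SOPlus n).continuous
    exact isOpen_ne.preimage (f := fun A : SOPlus n => (1 + ((A : GL (Idx n) ℝ) : Mat n)).det)
      (by fun_prop)
  open_target := by
    have h1 : IsOpen {B : Mat n | (1 + B).det ≠ 0} :=
      isOpen_ne.preimage (f := fun B : Mat n => (1 + B).det) (by fun_prop)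
    have h2 : IsOpen ({B : Mat n | (1 + B).det ≠ 0} ∩
        (fun B => cay B (.inr ()) (.inr ())) ⁻¹' Set.Ioi 0) := by
      refine ContinuousOn.isOpen_inter_preimage ?_ h1 isOpen_Ioi
      exact (Continuous.comp_continuousOn (g := fun B : Mat n => B (.inr ()) (.inr ()))
        (by fun_prop) (continuousOn_cay n))
    exact h2.preimage (soLie.isInducing_mat n).continuous
  continuousOn_toFun := by
    rw [(soLie.isInducing_mat n).continuousOn_iff]
    exact (continuousOn_cay n).comp (isEmbedding_SOPlus n).continuous.continuousOn fun A hA => hA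
  continuousOn_invFun := by
    rw [(isEmbedding_SOPlus n).isInducing.continuousOn_iff]
    refine ContinuousOn.congr (f := fun X : soLie n => cay X.mat) ?_ ?_
    · exact (continuousOn_cay n).comp (soLie.isInducing_mat n).continuous.continuousOn fun X hX => hX.1
    · intro X hX
      simp only [Set.mem_ofPred_eq] at hX
      simp only [Function.comp_apply]
      rw [dif_pos hX]
      rfl

/-- The smooth structure of the Lie group `SO⁺(n,1)`: the charts are the left translates of the
Cayley chart. -/
instance (n : ℕ) : ChartedSpace (soLie n) (SOPlus n) where
  atlas := Set.range fun g : SOPlus n =>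
    (Homeomorph.mulLeft g⁻¹).transOpenPartialHomeomorph (cayChart n)
  chartAt g := (Homeomorph.mulLeft g⁻¹).transOpenPartialHomeomorph (cayChart n)
  mem_chart_source g := by
    simp only [Homeomorph.transOpenPartialHomeomorph_source, Set.mem_preimage]
    simp only [cayChart, Set.mem_ofPred_eq, Homeomorph.coe_mulLeft, inv_mul_cancel]
    have : (1 + (((1 : SOPlus n) : GL (Idx n) ℝ) : Mat n)) = (2 : ℝ) • 1 := by
      rw [two_smul]; rfl
    rw [this, Matrix.det_smul, Matrix.det_one, mul_one]
    positivity
  chart_mem_atlas g := ⟨g, rfl⟩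

end Cayley


section Bundles

open MulOpposite

instance (n : ℕ) : LocallyCompactSpace (SOPlus n) :=
  haveI : ProperSpace (soLie n) := FiniteDimensional.proper_real (soLie n)
  ChartedSpace.locallyCompactSpace (soLie n) (SOPlus n)

instance {n : ℕ} (Γ : Subgroup (SOPlus n)) [DiscreteTopology Γ] :
    ProperlyDiscontinuousSMul Γ (SOPlus n) :=
  Γ.properlyDiscontinuousSMul_of_tendsto_cofinite
    (Γ.tendsto_coe_cofinite_of_discrete (isDiscrete_iff_discreteTopology.2 inferInstance))

instance {n : ℕ} (Γ : Subgroup (SOPlus n)) : IsCancelSMul Γ (SOPlus n) where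
  right_cancel' _ _ _ h := Subtype.ext (mul_right_cancel h)

/-- The space-form `Γ\Hⁿ`, with the quotient topology. -/
abbrev SpaceForm {n : ℕ} (Γ : Subgroup (SOPlus n)) : Type := MulAction.orbitRel.Quotient Γ (Hyp n)

/-- The oriented orthonormal frame bundle of `Γ\Hⁿ`, identified with the orbit space
`Γ\SO⁺(n,1)`. If `Γ` is discrete then it is a smooth manifold, with the smooth structure induced
from that of `SO⁺(n,1)` by the covering projection `A ↦ Γ A`. -/
abbrev FrameBundle {n : ℕ} (Γ : Subgroup (SOPlus n)) : Type :=
  MulAction.orbitRel.Quotient Γ (SOPlus n)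

/-- The projection `ε : Γ\SO⁺(n,1) → Γ\Hⁿ`, `Γ A ↦ Γ (A e_{n+1})`. -/
def frameProj {n : ℕ} (Γ : Subgroup (SOPlus n)) : FrameBundle Γ → SpaceForm Γ :=
  Quotient.map' (fun A => A • basePoint n) (by
    rintro A B ⟨γ, rfl⟩
    exact ⟨γ, (mul_smul (γ : SOPlus n) B (basePoint n)).symm⟩)

/-- The right action of `SO(n)` on `Γ\SO⁺(n,1)`, `(Γ A) B = Γ (A B̂)`. Right actions of a group `G`
are expressed as actions of `Gᵐᵒᵖ`, so that `x g` is `op g • x`. -/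
instance {n : ℕ} (Γ : Subgroup (SOPlus n)) : MulAction (SON n)ᵐᵒᵖ (FrameBundle Γ) where
  smul B := Quotient.map' (fun A => A * soHat n B.unop) (by
    rintro A A' ⟨γ, rfl⟩
    exact ⟨γ, (mul_assoc (γ : SOPlus n) A' (soHat n B.unop)).symm⟩)
  one_smul := by
    rintro ⟨A⟩
    exact congrArg (Quotient.mk _) (by simp only [unop_one, map_one, mul_one])
  mul_smul := by
    rintro B C ⟨A⟩
    exact congrArg (Quotient.mk _) (by
      simp only [unop_mul, map_mul, mul_assoc])

/-- The space of orbits `Δ\Spin⁺(n,1)` of a subgroup `Δ`, with the quotient topology. -/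
abbrev SpinQuotient {n : ℕ} (Δ : Subgroup (SpinPlus n)) : Type :=
  MulAction.orbitRel.Quotient Δ (SpinPlus n)

/-- The right action of `Spin(n)` on `Δ\Spin⁺(n,1)`, `(Δ g) s = Δ (g ŝ)`. -/
instance {n : ℕ} (Δ : Subgroup (SpinPlus n)) : MulAction (SpinN n)ᵐᵒᵖ (SpinQuotient Δ) where
  smul s := Quotient.map' (fun g => g * spinHat n s.unop) (by
    rintro g g' ⟨δ, rfl⟩
    exact ⟨δ, (mul_assoc (δ : SpinPlus n) g' (spinHat n s.unop)).symm⟩)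
  one_smul := by
    rintro ⟨g⟩
    exact congrArg (Quotient.mk _) (by simp only [unop_one, map_one, mul_one])
  mul_smul := by
    rintro s t ⟨g⟩
    exact congrArg (Quotient.mk _) (by
      simp only [unop_mul, map_mul, mul_assoc])

/-- `η` maps the subgroup `Δ` of `Spin⁺(n,1)` isomorphically onto `Γ`. -/
def MapsIsomorphicallyOnto {n : ℕ} (Δ : Subgroup (SpinPlus n)) (Γ : Subgroup (SOPlus n)) : Prop :=
  Set.InjOn (eta n) Δ ∧ Δ.map (eta n) = Γ

/-- The map `Δ\Spin⁺(n,1) → Γ\SO⁺(n,1)`, `Δ g ↦ Γ η(g)`, induced by `η` if `η(Δ) = Γ`. -/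
def inducedMap {n : ℕ} {Δ : Subgroup (SpinPlus n)} {Γ : Subgroup (SOPlus n)}
    (h : MapsIsomorphicallyOnto Δ Γ) : SpinQuotient Δ → FrameBundle Γ :=
  Quotient.map' (eta n) (by
    rintro g g' ⟨δ, rfl⟩
    refine ⟨⟨eta n δ, h.2 ▸ Subgroup.mem_map_of_mem (eta n) δ.2⟩, ?_⟩
    exact (map_mul (eta n) (δ : SpinPlus n) g').symm)

/-- `π : P → B` is a principal `G`-bundle, for a continuous right action of the topological group
`G` on `P`: the action preserves the fibres, and `π` has equivariant local trivializations around
every point of `B`. -/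
structure IsPrincipalBundle (G : Type) [Group G] [TopologicalSpace G] {P B : Type}
    [TopologicalSpace P] [TopologicalSpace B] [MulAction Gᵐᵒᵖ P] (π : P → B) : Prop where
  continuous_action : Continuous fun z : P × G => op z.2 • z.1
  proj_smul : ∀ (x : P) (g : G), π (op g • x) = π x
  locally_trivial : ∀ b : B, ∃ e : Bundle.Trivialization G π, b ∈ e.baseSet ∧
    ∀ x : P, π x ∈ e.baseSet → ∀ g : G, (e (op g • x)).2 = (e x).2 * g

/-- `ρ : P → Γ\SO⁺(n,1)` is a spin structure on `Γ\Hⁿ`: `P` is a smooth manifold with a right action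
of `Spin(n)` by diffeomorphisms that makes it a principal bundle over `Γ\Hⁿ` with projection `ερ`,
and `ρ` is a smooth double covering projection with `ρ(x s) = ρ(x) σ(s)`.

As `ρ` is a local diffeomorphism, the smooth structure of `P` is the one lifted from
`Γ\SO⁺(n,1)`, and the smoothness of the bundle data (of the action as a map `P × Spin(n) → P`, of the
projection, and of suitable local trivializations) follows from these conditions. -/
structure IsSpinStructure {n : ℕ} (Γ : Subgroup (SOPlus n)) [DiscreteTopology Γ] {P : Type}
    [TopologicalSpace P] [ChartedSpace (soLie n) P] [MulAction (SpinN n)ᵐᵒᵖ P]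
    (ρ : P → FrameBundle Γ) : Prop where
  isManifold : IsManifold 𝓘(ℝ, soLie n) ∞ P
  isCoveringMap : IsCoveringMap ρ
  two_sheeted : ∀ y, (ρ ⁻¹' {y}).ncard = 2
  isLocalDiffeomorph : IsLocalDiffeomorph 𝓘(ℝ, soLie n) 𝓘(ℝ, soLie n) ∞ ρ
  isPrincipalBundle : IsPrincipalBundle (SpinN n) (frameProj Γ ∘ ρ)
  contMDiff_smul : ∀ s : SpinN n, ContMDiff 𝓘(ℝ, soLie n) 𝓘(ℝ, soLie n) ∞ fun x : P => op s • x
  equivariant : ∀ (x : P) (s : SpinN n), ρ (op s • x) = op (sigma n s) • ρ x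

/-- A spin structure on `Γ\Hⁿ`. -/
structure SpinStructure {n : ℕ} (Γ : Subgroup (SOPlus n)) [DiscreteTopology Γ] : Type 1 where
  P : Type
  [topologicalSpace : TopologicalSpace P]
  [chartedSpace : ChartedSpace (soLie n) P]
  [mulAction : MulAction (SpinN n)ᵐᵒᵖ P]
  ρ : P → FrameBundle Γ
  isSpinStructure : IsSpinStructure Γ ρ

attribute [instance] SpinStructure.topologicalSpace SpinStructure.chartedSpace
  SpinStructure.mulAction

/-- Two spin structures are equivalent if there is a `Spin(n)`-equivariant diffeomorphism between
them over `Γ\SO⁺(n,1)`. -/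
def SpinStructure.Equivalent {n : ℕ} {Γ : Subgroup (SOPlus n)} [DiscreteTopology Γ]
    (S T : SpinStructure Γ) : Prop :=
  ∃ ξ : Diffeomorph 𝓘(ℝ, soLie n) 𝓘(ℝ, soLie n) S.P T.P ∞,
    (∀ x, T.ρ (ξ x) = S.ρ x) ∧ ∀ (x : S.P) (s : SpinN n), ξ (op s • x) = op s • ξ x

/-- Equivalence of spin structures is an equivalence relation. -/
instance SpinStructure.setoid {n : ℕ} (Γ : Subgroup (SOPlus n)) [DiscreteTopology Γ] :
    Setoid (SpinStructure Γ) where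
  r := SpinStructure.Equivalent
  iseqv := by
    refine ⟨fun S => ⟨Diffeomorph.refl _ _ _, fun _ => rfl, fun _ _ => rfl⟩, ?_, ?_⟩
    · rintro S T ⟨ξ, h1, h2⟩
      refine ⟨ξ.symm, fun x => ?_, fun x s => ?_⟩
      · rw [← h1, ξ.apply_symm_apply]
      · apply ξ.injective
        exact (ξ.apply_symm_apply _).trans
          ((h2 _ s).trans (congrArg (op s • ·) (ξ.apply_symm_apply x))).symm
    · rintro S T U ⟨ξ, h1, h2⟩ ⟨ζ, k1, k2⟩
      refine ⟨ξ.trans ζ, fun x => ?_, fun x s => ?_⟩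
      · rw [Diffeomorph.coe_trans, Function.comp_apply, k1, h1]
      · rw [Diffeomorph.coe_trans, Function.comp_apply, Function.comp_apply, h2, k2]

/-- The set of equivalence classes of spin structures on `Γ\Hⁿ`. -/
def SpinStructureClass {n : ℕ} (Γ : Subgroup (SOPlus n)) [DiscreteTopology Γ] : Type 1 :=
  Quotient (SpinStructure.setoid Γ)

/-- The equivalence class of a spin structure `ρ : P → Γ\SO⁺(n,1)`. -/
def spinClass {n : ℕ} {Γ : Subgroup (SOPlus n)} [DiscreteTopology Γ] {P : Type}
    [TopologicalSpace P] [ChartedSpace (soLie n) P] [MulAction (SpinN n)ᵐᵒᵖ P]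
    {ρ : P → FrameBundle Γ} (h : IsSpinStructure Γ ρ) : SpinStructureClass Γ :=
  Quotient.mk (SpinStructure.setoid Γ) ⟨P, ρ, h⟩

end Bundles

end
end HypSpin

/-! The theorem is covering space theory, with `Spin(n)`-equivariance standing in for simple
connectivity. `Spin⁺(n,1)` need not be simply connected (for `n = 2` it is `SL(2,ℝ)`), but it splits
as `Hⁿ × Spin(n)` by `polarHomeo`: every `g` is uniquely a boost that carries the base point to
`η(g)e_{n+1}`, times some `ŝ`. The factor `Hⁿ` is contractible.

Given a spin structure `ρ : P → Γ\SO⁺(n,1)`, the map `p ↦ Γ η(boost p)` on `Hⁿ` lifts through the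
covering `ρ`, and the lift extends by equivariance to a developing map `Ψ : Spin⁺(n,1) → P` over
`η`. It is determined by its value at one point, so any two developing maps agree up to the action
of `-1`. If `η(δ) ∈ Γ` then `g ↦ Ψ(δg)` is again a developing map, so it is `Ψ` or `-Ψ`; replacing
`δ` by `-δ` exchanges the two cases. Exactly one lift of each `γ ∈ Γ` therefore stabilizes `Ψ`. The
stabilizer `Γ̂` maps isomorphically onto `Γ`, does not depend on the choice of `Ψ`, and `Ψ`
identifies `P` with `Γ̂\Spin⁺(n,1)`. Hence `Γ̂` determines the spin structure up to equivalence
(`SpinStructure.lift_eq_iff`).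

Conversely, the quotient by a lift `Δ` of `Γ` is a spin structure
(`MapsIsomorphicallyOnto.exists_isSpinStructure`). Torsion-freeness makes `Γ` act freely on `Hⁿ`, so
that `Hⁿ → Γ\Hⁿ` is a covering and the polar decomposition descends to local trivializations. The
quotient map `Spin⁺(n,1) → Δ\Spin⁺(n,1)` is a developing map with stabilizer `Δ`, which gives
surjectivity and identifies the correspondence.

The groundwork is that `η` is a double covering: its kernel is `±1` (`eta_eq_one_iff`), it is onto
(`eta_surjective`), and it is open (`isOpenMap_eta`). Smoothness is carried along the local
homeomorphisms from the Cayley charts of `SO⁺(n,1)`. -/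

namespace HypSpin

noncomputable section

open CliffordAlgebra
open scoped Matrix MatrixGroups ContDiff Manifold Topology

/-! ### Clifford algebras of nondegenerate forms: twisted centre, topology, kernel of `Ad` -/

section CliffordGeneral

variable {M : Type*} [AddCommGroup M] [Module ℝ M]

/-- The number operator `x ↦ ∑ eᵢ ∧ (eᵢ* ⌋ x)` of the exterior algebra. -/
def numberOp {ι' : Type*} [Fintype ι'] (b : Module.Basis ι' ℝ M) :
    ExteriorAlgebra ℝ M →ₗ[ℝ] ExteriorAlgebra ℝ M :=
  ∑ i, LinearMap.mulLeft ℝ (ExteriorAlgebra.ι ℝ (b i)) ∘ₗ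
    contractLeft (Q := (0 : QuadraticForm ℝ M)) (b.coord i)

lemma numberOp_apply {ι' : Type*} [Fintype ι'] (b : Module.Basis ι' ℝ M)
    (x : ExteriorAlgebra ℝ M) : numberOp b x = ∑ i, ExteriorAlgebra.ι ℝ (b i) *
      contractLeft (Q := (0 : QuadraticForm ℝ M)) (b.coord i) x := by
  simp [numberOp]

/-- Contraction is an antiderivation: contracting `m ∧ x` with `eᵢ*` gives `mᵢ x` minus `m ∧` the
contraction of `x`. After multiplication by `eᵢ`, the first terms sum to `m ∧ x`, and moving `eᵢ`
past `m` restores the sign of the second. Each vector factor thus raises the eigenvalue by one. -/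
lemma numberOp_ι_mul {ι' : Type*} [Fintype ι'] (b : Module.Basis ι' ℝ M) (m : M)
    (x : ExteriorAlgebra ℝ M) : numberOp b (ExteriorAlgebra.ι ℝ m * x) =
      ExteriorAlgebra.ι ℝ m * x + ExteriorAlgebra.ι ℝ m * numberOp b x := by
  rw [numberOp_apply, numberOp_apply, Finset.mul_sum]
  have h : ∀ i, ExteriorAlgebra.ι ℝ (b i) * contractLeft (Q := (0 : QuadraticForm ℝ M))
      (b.coord i) (ExteriorAlgebra.ι ℝ m * x) =
      (ExteriorAlgebra.ι ℝ (b.repr m i • b i)) * x + ExteriorAlgebra.ι ℝ m *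
        (ExteriorAlgebra.ι ℝ (b i) * contractLeft (Q := (0 : QuadraticForm ℝ M))
          (b.coord i) x) := by
    intro i
    have h1 : ExteriorAlgebra.ι ℝ (b i) * ExteriorAlgebra.ι ℝ m =
        -(ExteriorAlgebra.ι ℝ m * ExteriorAlgebra.ι ℝ (b i)) :=
      eq_neg_of_add_eq_zero_left (ExteriorAlgebra.ι_add_mul_swap (b i) m)
    have h2 : contractLeft (Q := (0 : QuadraticForm ℝ M)) (b.coord i)
        (ExteriorAlgebra.ι ℝ m * x) = b.coord i m • x - ExteriorAlgebra.ι ℝ m *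
          contractLeft (Q := (0 : QuadraticForm ℝ M)) (b.coord i) x :=
      contractLeft_ι_mul _ _ _
    rw [h2, mul_sub, ← mul_assoc, h1, map_smul, smul_mul_assoc, mul_smul_comm, neg_mul,
      sub_neg_eq_add, mul_assoc, Module.Basis.coord_apply]
  rw [Finset.sum_congr rfl fun i _ => h i, Finset.sum_add_distrib, ← Finset.sum_mul, ← map_sum,
    b.sum_repr]

lemma numberOp_eq_smul {ι' : Type*} [Fintype ι'] (b : Module.Basis ι' ℝ M) (k : ℕ)
    {x : ExteriorAlgebra ℝ M} (hx : x ∈ LinearMap.range (ExteriorAlgebra.ι ℝ (M := M)) ^ k) :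
    numberOp b x = (k : ℝ) • x := by
  induction k generalizing x with
  | zero =>
    rw [pow_zero, Submodule.mem_one] at hx
    obtain ⟨r, rfl⟩ := hx
    rw [numberOp_apply]
    simp only [Nat.cast_zero, zero_smul]
    refine Finset.sum_eq_zero fun i _ => ?_
    have : contractLeft (Q := (0 : QuadraticForm ℝ M)) (b.coord i)
      (algebraMap ℝ (ExteriorAlgebra ℝ M) r) = 0 := contractLeft_algebraMap _ _ _
    rw [this, mul_zero]
  | succ k ih =>
    rw [pow_succ'] at hx
    refine Submodule.mul_induction_on hx ?_ ?_
    · rintro _ ⟨m, rfl⟩ y hy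
      rw [numberOp_ι_mul, ih hy, mul_smul_comm, Nat.cast_succ, add_smul, one_smul, add_comm]
    · intro y z hy hz
      rw [map_add, hy, hz, smul_add]

/-- An element of the exterior algebra that is annihilated by all contractions is a scalar. -/
lemma exterior_scalar_of_contract [FiniteDimensional ℝ M] (x : ExteriorAlgebra ℝ M)
    (hx : ∀ d, contractLeft (Q := (0 : QuadraticForm ℝ M)) d x = 0) :
    ∃ r : ℝ, x = algebraMap ℝ _ r := by
  classical
  let b := Module.finBasis ℝ M
  have hE : numberOp b x = 0 := by
    rw [numberOp_apply]
    exact Finset.sum_eq_zero fun i _ => by rw [hx, mul_zero]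
  let 𝒜 : ℕ → Submodule ℝ (ExteriorAlgebra ℝ M) := fun i => ⋀[ℝ]^i M
  -- The number operator multiplies the degree `k` component by `k`. As it annihilates `x`, every
  -- component of positive degree vanishes.
  have key : ∀ y : ExteriorAlgebra ℝ M, ∀ k : ℕ,
      (DirectSum.decompose 𝒜 (numberOp b y) k : ExteriorAlgebra ℝ M) =
        (k : ℝ) • (DirectSum.decompose 𝒜 y k : ExteriorAlgebra ℝ M) := by
    intro y
    induction y using DirectSum.Decomposition.inductionOn 𝒜 with
    | zero => simp
    | @homogeneous i m =>
      intro k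
      rw [numberOp_eq_smul b i m.2, DirectSum.decompose_smul, DirectSum.smul_apply,
        Submodule.coe_smul, DirectSum.decompose_coe]
      by_cases h : i = k
      · subst h; rfl
      · rw [DirectSum.of_eq_of_ne _ _ _ (Ne.symm h)]; simp
    | add y z hy hz =>
      intro k
      rw [map_add, DirectSum.decompose_add, DirectSum.add_apply, Submodule.coe_add, hy, hz,
        DirectSum.decompose_add, DirectSum.add_apply, Submodule.coe_add, smul_add]
  have h0 : ∀ k, k ≠ 0 → (DirectSum.decompose 𝒜 x k : ExteriorAlgebra ℝ M) = 0 := by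
    intro k hk
    have := key x k
    rw [hE, DirectSum.decompose_zero, DirectSum.zero_apply, Submodule.coe_zero] at this
    exact (smul_eq_zero.1 this.symm).resolve_left (Nat.cast_ne_zero.2 hk)
  have hsum := DirectSum.sum_support_decompose 𝒜 x
  have hx0 : x = (DirectSum.decompose 𝒜 x 0 : ExteriorAlgebra ℝ M) := by
    conv_lhs => rw [← hsum]
    by_cases hm : 0 ∈ (DirectSum.decompose 𝒜 x).support
    · exact Finset.sum_eq_single_of_mem 0 hm fun k _ hk => h0 k hk
    · rw [DFinsupp.notMem_support_iff.1 hm]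
      exact Finset.sum_eq_zero fun k hk => h0 k (by rintro rfl; exact hm hk)
  have hmem : x ∈ LinearMap.range (ExteriorAlgebra.ι ℝ (M := M)) ^ 0 :=
    hx0 ▸ (DirectSum.decompose 𝒜 x 0).2
  rw [pow_zero, Submodule.mem_one] at hmem
  obtain ⟨r, hr⟩ := hmem
  exact ⟨r, hr.symm⟩

/-- The twisted commutator with a vector is a contraction. -/
lemma ι_mul_sub_involute_mul_ι (Q : QuadraticForm ℝ M) (v : M) (x : CliffordAlgebra Q) :
    ι Q v * x - involute x * ι Q v = contractLeft (Q.polarBilin v) x := by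
  induction x using CliffordAlgebra.left_induction with
  | algebraMap r =>
    rw [contractLeft_algebraMap, AlgHom.commutes, Algebra.commutes, sub_self]
  | add x y hx hy => rw [map_add, map_add, ← hx, ← hy]; noncomm_ring
  | ι_mul x m hx =>
    rw [contractLeft_ι_mul, ← hx, map_mul, involute_ι]
    have h := ι_mul_ι_add_swap (Q := Q) v m
    have h' : ι Q v * ι Q m = algebraMap ℝ _ (QuadraticMap.polar Q v m) - ι Q m * ι Q v := by
      rw [← h]; abel
    rw [← mul_assoc, h', sub_mul, ← Algebra.smul_def, QuadraticMap.polarBilin_apply_apply]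
    noncomm_ring

/-- For a nondegenerate form, a Clifford element that commutes with all vectors up to the grading
involution is a scalar. -/
lemma scalar_of_twisted_commute [FiniteDimensional ℝ M] (Q : QuadraticForm ℝ M)
    (hQ : Function.Surjective Q.polarBilin) (x : CliffordAlgebra Q)
    (hx : ∀ v, ι Q v * x = involute x * ι Q v) : ∃ r : ℝ, x = algebraMap ℝ _ r := by
  -- The hypothesis says that contraction with the polar form of each `v` kills `x`. By
  -- nondegeneracy these are all the functionals, and `equivExterior` intertwines contractions.
  obtain ⟨r, hr⟩ := exterior_scalar_of_contract (equivExterior Q x) fun d => by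
    obtain ⟨v, rfl⟩ := hQ d
    have h : contractLeft (Q.polarBilin v) x = 0 := by
      rw [← ι_mul_sub_involute_mul_ι, hx, sub_self]
    have h2 : equivExterior Q (contractLeft (Q.polarBilin v) x) =
        contractLeft (Q := (0 : QuadraticForm ℝ M)) (Q.polarBilin v) (equivExterior Q x) :=
      changeForm_contractLeft changeForm.associated_neg_proof _ _
    rw [← h2, h, map_zero]
  refine ⟨r, (equivExterior Q).injective (hr.trans ?_)⟩
  exact (changeForm_algebraMap changeForm.associated_neg_proof r).symm

instance finite_cliffordAlgebra [FiniteDimensional ℝ M] (Q : QuadraticForm ℝ M) :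
    FiniteDimensional ℝ (CliffordAlgebra Q) :=
  haveI : FiniteDimensional ℝ (ExteriorAlgebra ℝ M) :=
    Module.Finite.of_basis (Module.finBasis ℝ M).ExteriorAlgebra
  Module.Finite.equiv (equivExterior Q).symm

instance isModuleTopology_cliffordAlgebra (Q : QuadraticForm ℝ M) :
    IsModuleTopology ℝ (CliffordAlgebra Q) := ⟨rfl⟩

instance isTopologicalRing_cliffordAlgebra [FiniteDimensional ℝ M] (Q : QuadraticForm ℝ M) :
    IsTopologicalRing (CliffordAlgebra Q) := IsModuleTopology.isTopologicalRing ℝ _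

/-- Coordinates on the Clifford algebra. -/
def cliffordCoord [FiniteDimensional ℝ M] (Q : QuadraticForm ℝ M) :
    CliffordAlgebra Q ≃L[ℝ] (Fin (Module.finrank ℝ (CliffordAlgebra Q)) → ℝ) :=
  let e := (Module.finBasis ℝ (CliffordAlgebra Q)).equivFun
  { e with
    continuous_toFun := IsModuleTopology.continuous_of_linearMap e.toLinearMap
    continuous_invFun := IsModuleTopology.continuous_of_linearMap e.symm.toLinearMap }

instance t2Space_cliffordAlgebra [FiniteDimensional ℝ M] (Q : QuadraticForm ℝ M) :
    T2Space (CliffordAlgebra Q) := (cliffordCoord Q).toHomeomorph.symm.t2Space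

lemma continuous_star_clifford (Q : QuadraticForm ℝ M) :
    Continuous (star : CliffordAlgebra Q → CliffordAlgebra Q) := by
  have : (star : CliffordAlgebra Q → CliffordAlgebra Q) =
      (reverse (Q := Q) ∘ₗ (involute (Q := Q)).toLinearMap) := by
    ext x; simp [star_def]
  rw [this]
  have := IsModuleTopology.toContinuousAdd ℝ (CliffordAlgebra Q)
  exact IsModuleTopology.continuous_of_linearMap _

instance isTopologicalGroup_spinGroup [FiniteDimensional ℝ M] (Q : QuadraticForm ℝ M) :
    IsTopologicalGroup (spinGroup Q) where
  continuous_inv := by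
    rw [Topology.IsInducing.subtypeVal.continuous_iff]
    exact (continuous_star_clifford Q).comp continuous_subtype_val

/-- The scalar part of a Clifford element. -/
def scalarPart (Q : QuadraticForm ℝ M) : CliffordAlgebra Q →ₗ[ℝ] ℝ :=
  ExteriorAlgebra.algebraMapInv.toLinearMap ∘ₗ (equivExterior Q).toLinearMap

lemma scalarPart_algebraMap (Q : QuadraticForm ℝ M) (r : ℝ) :
    scalarPart Q (algebraMap ℝ _ r) = r := by
  have h : equivExterior Q (algebraMap ℝ _ r) = algebraMap ℝ _ r :=
    changeForm_algebraMap changeForm.associated_neg_proof r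
  rw [scalarPart, LinearMap.comp_apply, LinearEquiv.coe_coe, h]
  exact ExteriorAlgebra.algebraMap_leftInverse M r

/-- As `star (vw) = wv`, the spinor norm of `vw` is `Q v * Q w`. The element `-1` and the boosts are
obtained in this way. -/
lemma ι_mul_ι_mem_spinGroup (Q : QuadraticForm ℝ M) {v w : M} (h : Q v * Q w = 1) :
    ι Q v * ι Q w ∈ spinGroup Q := by
  have unit : ∀ a b : M, Q a * Q b = 1 → ∃ y : (CliffordAlgebra Q)ˣ, ι Q a = y := by
    intro a b hab
    have h0 : Q a ≠ 0 := left_ne_zero_of_mul_eq_one hab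
    have e : ι Q a * ι Q ((Q a)⁻¹ • a) = 1 := by
      rw [map_smul, mul_smul_comm, ι_sq_scalar, Algebra.algebraMap_eq_smul_one, smul_smul,
        inv_mul_cancel₀ h0, one_smul]
    have e' : ι Q ((Q a)⁻¹ • a) * ι Q a = 1 := by
      rw [map_smul, smul_mul_assoc, ι_sq_scalar, Algebra.algebraMap_eq_smul_one, smul_smul,
        inv_mul_cancel₀ h0, one_smul]
    exact ⟨⟨_, _, e, e'⟩, rfl⟩
  obtain ⟨y, hy⟩ := unit v w h
  obtain ⟨z, hz⟩ := unit w v (by rwa [mul_comm])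
  have key : ∀ a b : M, Q a * Q b = 1 → ι Q a * ι Q b * (ι Q b * ι Q a) = 1 := by
    intro a b hab
    rw [mul_assoc, ← mul_assoc (ι Q b), ι_sq_scalar, Algebra.commutes, ← mul_assoc, ι_sq_scalar,
      ← map_mul, hab, map_one]
  have hs : star (ι Q v * ι Q w) = ι Q w * ι Q v := by
    rw [star_mul, star_ι, star_ι, neg_mul_neg]
  refine ⟨⟨⟨y * z, ?_, by simp [hy, hz]⟩, ?_, ?_⟩, ι_mul_ι_mem_evenOdd_zero Q v w⟩
  · exact mul_mem (Subgroup.subset_closure ⟨v, hy⟩) (Subgroup.subset_closure ⟨w, hz⟩)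
  · rw [hs]; exact key w v (by rwa [mul_comm])
  · rw [hs]; exact key v w h

lemma neg_one_mem_spinGroup (Q : QuadraticForm ℝ M) {v : M} (h : Q v = -1) :
    (-1 : CliffordAlgebra Q) ∈ spinGroup Q := by
  have := ι_mul_ι_mem_spinGroup Q (v := v) (w := v) (by rw [h]; norm_num)
  rwa [ι_sq_scalar, h, map_neg, map_one] at this

lemma coe_mul_ι (Q : QuadraticForm ℝ M) (x : spinGroup Q) (v : M) :
    (x : CliffordAlgebra Q) * ι Q v = ι Q (adEnd Q x v) * x := by
  rw [ι_adEnd, mul_assoc _ _ (x : CliffordAlgebra Q), coe_inv_mul, mul_one]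

/-- Since `x` is even, twisted and plain commutation with vectors coincide, so an `x` that acts
trivially is a scalar `r`; then `star x * x = 1` reads `r² = 1`. -/
lemma eq_one_or_neg_one_of_adEnd [FiniteDimensional ℝ M] (Q : QuadraticForm ℝ M)
    (hQ : Function.Surjective Q.polarBilin) (x : spinGroup Q) (hx : ∀ v, adEnd Q x v = v) :
    (x : CliffordAlgebra Q) = 1 ∨ (x : CliffordAlgebra Q) = -1 := by
  obtain ⟨r, hr⟩ := scalar_of_twisted_commute Q hQ x fun v => by
    rw [spinGroup.involute_eq x.2, coe_mul_ι, hx]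
  have h : star (x : CliffordAlgebra Q) * x = 1 := spinGroup.star_mul_self_of_mem x.2
  rw [hr, star_algebraMap, ← map_mul] at h
  have h2 : r * r = 1 := by
    rw [← scalarPart_algebraMap Q (r * r), h, ← map_one (algebraMap ℝ (CliffordAlgebra Q)),
      scalarPart_algebraMap]
  rcases mul_self_eq_one_iff.1 h2 with rfl | rfl
  · left; rw [hr, map_one]
  · right; rw [hr, map_neg, map_one]

end CliffordGeneral

/-! ### Continuity of `Ad`, and control of its inverse near the identity -/

section CliffordCoordinates

variable {κ : Type} [Fintype κ] [DecidableEq κ]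

lemma negForm_polarBilin_surjective {w : κ → ℝ} (hw : ∀ i, w i ≠ 0) :
    Function.Surjective (negForm w).polarBilin := by
  intro d
  -- The polar form of `negForm w` is `-2 ∑ wᵢ aᵢ uᵢ`, so this vector represents `d`.
  refine ⟨fun i => -(d (Pi.single i 1)) / (2 * w i), ?_⟩
  refine LinearMap.pi_ext' fun i => LinearMap.ext_ring ?_
  simp only [LinearMap.comp_apply, LinearMap.coe_single, QuadraticMap.polarBilin_apply_apply,
    polar_negForm]
  rw [Finset.sum_eq_single i]
  · have := hw i
    simp
    field_simp
  · intro j _ hj; simp [hj]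
  · simp

/-- If `Ad x` tends to the identity then `x` accumulates only at `±1`. -/
lemma comap_adGL_nhds_one_le (Q : QuadraticForm ℝ (κ → ℝ))
    (hQ : Function.Surjective Q.polarBilin) (m : spinGroup Q)
    (hm : (m : CliffordAlgebra Q) = -1) :
    Filter.comap (fun x : spinGroup Q => (adGL Q x : Matrix κ κ ℝ)) (𝓝 1) ≤ 𝓝 1 ⊔ 𝓝 m := by
  rw [Filter.le_iff_ultrafilter]
  intro F hF
  let L := cliffordCoord Q
  have hL0 : ∀ x : spinGroup Q, ‖L x‖ ≠ 0 := by
    intro x h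
    have h1 : (x : CliffordAlgebra Q) = 0 := by
      have := norm_eq_zero.1 h
      simpa using this
    have h2 := coe_mul_inv Q x
    rw [h1, zero_mul] at h2
    exact zero_ne_one h2
  -- The spin group of an indefinite form is not bounded, so compactness is applied to the
  -- normalized elements `x / ‖x‖` on the unit sphere of the Clifford algebra.
  let c : spinGroup Q → ℝ := fun x => ‖L x‖⁻¹
  have hc0 : ∀ x, c x ≠ 0 := fun x => inv_ne_zero (hL0 x)
  let u : spinGroup Q → CliffordAlgebra Q := fun x => c x • (x : CliffordAlgebra Q)
  have hu : ∀ x, L (u x) ∈ Metric.sphere (0 : Fin _ → ℝ) 1 := by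
    intro x
    rw [mem_sphere_zero_iff_norm, map_smul, norm_smul, norm_inv, norm_norm,
      inv_mul_cancel₀ (hL0 x)]
  obtain ⟨t', ht', hlim⟩ := (isCompact_sphere (0 : Fin _ → ℝ) 1).ultrafilter_le_nhds
    (F.map fun x => L (u x)) (by
      rw [Filter.le_principal_iff]
      exact Filter.mem_map.2 (Filter.univ_mem' hu))
  have hlim : Filter.Tendsto (fun x => L (u x)) F (𝓝 t') := hlim
  have hu_lim : Filter.Tendsto u F (𝓝 (L.symm t')) := by
    have := (L.symm.continuous.tendsto t').comp hlim
    refine this.congr fun x => ?_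
    simp
  generalize ht : L.symm t' = t at hu_lim
  have ht0 : t ≠ 0 := by
    rintro rfl
    have : t' = 0 := by simpa using ht
    rw [this] at ht'
    simp at ht'
  have hF' : Filter.Tendsto (fun x : spinGroup Q => (adGL Q x : Matrix κ κ ℝ)) F (𝓝 1) :=
    Filter.tendsto_iff_comap.2 hF
  have hcι : Continuous (ι Q) := IsModuleTopology.continuous_of_linearMap _
  have hcinv : Continuous (involute (Q := Q)) :=
    IsModuleTopology.continuous_of_linearMap (involute (Q := Q)).toLinearMap
  have hinvt : involute t = t := by
    refine tendsto_nhds_unique ((hcinv.tendsto t).comp hu_lim) (hu_lim.congr fun x => ?_)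
    simp only [Function.comp_apply, u, map_smul, spinGroup.involute_eq x.2]
  -- The identity `x v = Ad(x)(v) x` scales with `x`, and `Ad(x)` tends to `1`, so in the limit
  -- direction `t` commutes with every vector. Being fixed by the involution as well, `t` is a
  -- scalar.
  have hcomm : ∀ v, ι Q v * t = t * ι Q v := by
    intro v
    have h1 : Filter.Tendsto (fun x : spinGroup Q => ι Q ((adGL Q x : Matrix κ κ ℝ) *ᵥ v) * u x)
        F (𝓝 (ι Q v * t)) := by
      refine Filter.Tendsto.mul ?_ hu_lim
      have h2 : Continuous fun A : Matrix κ κ ℝ => ι Q (A *ᵥ v) := hcι.comp (by fun_prop)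
      have h3 := (h2.tendsto 1).comp hF'
      rwa [Matrix.one_mulVec] at h3
    refine tendsto_nhds_unique h1 ((hu_lim.mul_const (ι Q v)).congr fun x => ?_)
    simp only [u]
    rw [smul_mul_assoc, mul_smul_comm, coe_mul_ι, adGL_mulVec]
  obtain ⟨r, hr⟩ := scalar_of_twisted_commute Q hQ t fun v => by rw [hinvt, hcomm]
  have hr0 : r ≠ 0 := by
    rintro rfl
    exact ht0 (by rw [hr, map_zero])
  have hsc : Continuous (scalarPart Q) := IsModuleTopology.continuous_of_linearMap _
  -- The normalization can be undone: `star (c x) * (c x) = c²` because `x` is unitary, so `c` tends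
  -- to `|r|` and `x` itself to `r / |r| = ±1`.
  have hcsq : Filter.Tendsto (fun x => c x * c x) F (𝓝 (r * r)) := by
    have h1 := (hsc.tendsto _).comp
      ((((continuous_star_clifford Q).tendsto t).comp hu_lim).mul hu_lim)
    rw [hr, star_algebraMap, ← map_mul, scalarPart_algebraMap] at h1
    refine h1.congr fun x => ?_
    have h2 : star (x : CliffordAlgebra Q) * x = 1 := spinGroup.star_mul_self_of_mem x.2
    simp only [Function.comp_apply, u]
    rw [CliffordAlgebra.star_smul, smul_mul_smul_comm, h2, ← Algebra.algebraMap_eq_smul_one,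
      scalarPart_algebraMap]
  have hc : Filter.Tendsto c F (𝓝 |r|) := by
    have h1 := (Real.continuous_sqrt.tendsto _).comp hcsq
    rw [Real.sqrt_mul_self_eq_abs] at h1
    refine h1.congr fun x => ?_
    rw [Function.comp_apply, Real.sqrt_mul_self (inv_nonneg.2 (norm_nonneg _))]
  have hx : Filter.Tendsto (fun x : spinGroup Q => (x : CliffordAlgebra Q)) F
      (𝓝 (|r|⁻¹ • algebraMap ℝ (CliffordAlgebra Q) r)) := by
    have h1 := (hc.inv₀ (abs_ne_zero.2 hr0)).smul hu_lim
    rw [hr] at h1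
    refine h1.congr fun x => ?_
    simp only [u]
    rw [smul_smul, inv_mul_cancel₀ (hc0 x), one_smul]
  have hone : ((1 : spinGroup Q) : CliffordAlgebra Q) = 1 := rfl
  rcases lt_or_gt_of_ne hr0 with h | h
  · refine le_trans ?_ le_sup_right
    rw [Topology.IsInducing.subtypeVal.nhds_eq_comap, ← Filter.tendsto_iff_comap, hm]
    rwa [abs_of_neg h, Algebra.algebraMap_eq_smul_one, smul_smul, inv_neg,
      neg_mul, inv_mul_cancel₀ hr0, neg_smul, one_smul] at hx
  · refine le_trans ?_ le_sup_left
    rw [Topology.IsInducing.subtypeVal.nhds_eq_comap, ← Filter.tendsto_iff_comap, hone]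
    rwa [abs_of_pos h, Algebra.algebraMap_eq_smul_one, smul_smul,
      inv_mul_cancel₀ hr0, one_smul] at hx

lemma continuous_adGL (Q : QuadraticForm ℝ (κ → ℝ)) :
    Continuous fun x : spinGroup Q => (adGL Q x : Matrix κ κ ℝ) := by
  have hv : Continuous (vecPart Q) := IsModuleTopology.continuous_of_linearMap _
  refine continuous_matrix fun i j => ?_
  have h : ∀ x : spinGroup Q, (adGL Q x : Matrix κ κ ℝ) i j =
      vecPart Q ((x : CliffordAlgebra Q) * ι Q (Pi.single j 1) *
        ((x⁻¹ : spinGroup Q) : CliffordAlgebra Q)) i := by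
    intro x
    rw [← ι_adEnd, vecPart_ι, ← adGL_mulVec]
    simp
  simp only [h]
  have h1 : Continuous fun x : spinGroup Q => ((x⁻¹ : spinGroup Q) : CliffordAlgebra Q) :=
    continuous_subtype_val.comp continuous_inv
  exact (continuous_apply i).comp (hv.comp ((continuous_subtype_val.mul continuous_const).mul h1))

end CliffordCoordinates

/-! ### Surjectivity of `σ : Spin(n) → SO(n)` -/

section SpinN

lemma mem_evenOdd_zero_of_involute_eq {M : Type*} [AddCommGroup M] [Module ℝ M]
    (Q : QuadraticForm ℝ M) {x : CliffordAlgebra Q} (hx : involute x = x) :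
    x ∈ evenOdd Q 0 := by
  have h : x ∈ evenOdd Q 0 ⊔ evenOdd Q 1 := by
    rw [(evenOdd_isCompl Q).sup_eq_top]; exact Submodule.mem_top
  obtain ⟨a, ha, b, hb, rfl⟩ := Submodule.mem_sup.1 h
  rw [map_add, involute_eq_of_mem_even ha, involute_eq_of_mem_odd hb] at hx
  have hb0 : b = 0 := by
    have h1 : (2 : ℝ) • b = 0 := by
      rw [two_smul]
      have := sub_eq_zero.2 hx
      rw [← neg_eq_zero, ← this]; abel
    exact (smul_eq_zero.1 h1).resolve_left two_ne_zero
  rw [hb0, add_zero]; exact ha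

/-- Every product of reflections of Euclidean space is the twisted conjugation by a unitary
element of the Lipschitz group. -/
lemma exists_lipschitz_of_reflections (n : ℕ) (l : List (EuclideanSpace ℝ (Fin n))) :
    ∃ x : (CliffordAlgebra (negForm fun _ : Fin n => (1 : ℝ)))ˣ,
      x ∈ lipschitzGroup (negForm fun _ : Fin n => (1 : ℝ)) ∧
      star (x : CliffordAlgebra (negForm fun _ : Fin n => (1 : ℝ))) * x = 1 ∧
      ∀ u : EuclideanSpace ℝ (Fin n),
        involute (x : CliffordAlgebra (negForm fun _ : Fin n => (1 : ℝ))) * ι _ u.ofLp *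
          ((x⁻¹ : (CliffordAlgebra (negForm fun _ : Fin n => (1 : ℝ)))ˣ) :
            CliffordAlgebra (negForm fun _ : Fin n => (1 : ℝ))) =
        ι _ ((l.map fun v => (Submodule.span ℝ {v})ᗮ.reflection).prod u).ofLp := by
  induction l with
  | nil => exact ⟨1, one_mem _, by simp, by simp⟩
  | cons v l ih =>
    obtain ⟨x, hx, hs, hl⟩ := ih
    -- The list may contain zero vectors, for which the reflection is the identity and no Clifford
    -- factor is needed.
    by_cases hv : v = 0
    · refine ⟨x, hx, hs, fun u => ?_⟩
      rw [hl, List.map_cons, List.prod_cons, LinearIsometryEquiv.coe_mul, Function.comp_apply,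
        Submodule.reflection_orthogonal_apply, Submodule.reflection_singleton_apply]
      simp [hv]
    · have hn : ‖v‖ ≠ 0 := norm_ne_zero_iff.2 hv
      -- Rescaling leaves the reflection unchanged and makes the factor unitary: `a² = -1`, so `star
      -- a = -a` is the inverse of `a`.
      let a : Fin n → ℝ := fun i => ‖v‖⁻¹ * v i
      have hvv : ∑ i, v i * v i = ‖v‖ ^ 2 := by
        rw [EuclideanSpace.real_norm_sq_eq]; simp only [pow_two]
      have ha : ∑ i, (1 : ℝ) * (a i * a i) = 1 := by
        have : ∀ i, (1 : ℝ) * (a i * a i) = (‖v‖ ^ 2)⁻¹ * (v i * v i) := by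
          intro i; simp only [a]; ring
        simp only [this]
        rw [← Finset.mul_sum, hvv, inv_mul_cancel₀ (pow_ne_zero 2 hn)]
      have hqa : negForm (fun _ : Fin n => (1 : ℝ)) a = -1 := by rw [negForm_apply, ha]
      have e : ι (negForm fun _ : Fin n => (1 : ℝ)) a * -ι _ a = 1 := by
        rw [mul_neg, ι_sq_scalar, hqa, map_neg, map_one, neg_neg]
      have e' : -ι (negForm fun _ : Fin n => (1 : ℝ)) a * ι _ a = 1 := by
        rw [neg_mul, ι_sq_scalar, hqa, map_neg, map_one, neg_neg]
      let y : (CliffordAlgebra (negForm fun _ : Fin n => (1 : ℝ)))ˣ := ⟨_, _, e, e'⟩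
      refine ⟨y * x, mul_mem (Subgroup.subset_closure ⟨a, rfl⟩) hx, ?_, fun u => ?_⟩
      · have hy : star (y : CliffordAlgebra (negForm fun _ : Fin n => (1 : ℝ))) * y = 1 := by
          rw [show (y : CliffordAlgebra (negForm fun _ : Fin n => (1 : ℝ))) = ι _ a from rfl,
            star_ι, e']
        rw [Units.val_mul, star_mul, mul_assoc, ← mul_assoc (star (y : CliffordAlgebra
          (negForm fun _ : Fin n => (1 : ℝ)))), hy, one_mul, hs]
      · rw [Units.val_mul, map_mul, _root_.mul_inv_rev, Units.val_mul]
        have h1 := hl u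
        obtain ⟨r, hr⟩ : ∃ r, r = (l.map fun v => (Submodule.span ℝ {v})ᗮ.reflection).prod u :=
          ⟨_, rfl⟩
        rw [← hr] at h1
        have h2 := twisted_vector (fun _ : Fin n => (1 : ℝ)) y a rfl r.ofLp
        rw [← h1] at h2
        have h3 : reflMat (fun _ : Fin n => (1 : ℝ)) a *ᵥ r.ofLp =
            ((Submodule.span ℝ {v})ᗮ.reflection r).ofLp := by
          rw [reflMat_mulVec, ha, Submodule.reflection_orthogonal_apply,
            Submodule.reflection_singleton_apply]
          ext i
          have hi : inner ℝ v r = ∑ i, v i * r i := by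
            rw [PiLp.inner_apply]
            exact Finset.sum_congr rfl fun i _ => by simp [mul_comm]
          have h4 : ∑ i, (1 : ℝ) * (a i * r i) = ‖v‖⁻¹ * inner ℝ v r := by
            rw [hi, Finset.mul_sum]
            exact Finset.sum_congr rfl fun i _ => by simp only [a]; ring
          rw [h4]
          simp [a]
          field_simp
        rw [List.map_cons, List.prod_cons, LinearIsometryEquiv.coe_mul, Function.comp_apply, ← hr,
          ← h3, ← h2]
        simp only [mul_assoc]

lemma sigma_mulVec (n : ℕ) (s : SpinN n) (v : Fin n → ℝ) :
    (sigma n s : Matrix (Fin n) (Fin n) ℝ) *ᵥ v = adEnd (-euclideanForm n) s v :=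
  adGL_mulVec _ _ _

/-- By Cartan–Dieudonné, `B` is a product of reflections, hence the twisted conjugation by a unitary
product of vectors `x`. By `lipschitz_det` the involution multiplies `x` by `det B = 1`, so `x` is
even and its twisted conjugation is plain conjugation. -/
lemma sigma_surjective (n : ℕ) : Function.Surjective (sigma n) := by
  intro B
  obtain ⟨h1, h2⟩ := Matrix.mem_specialOrthogonalGroup_iff.1 B.2
  rw [Matrix.mem_orthogonalGroup_iff'] at h1
  let f : EuclideanSpace ℝ (Fin n) →ₗ[ℝ] EuclideanSpace ℝ (Fin n) :=
    Matrix.toEuclideanLin (B : Matrix (Fin n) (Fin n) ℝ)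
  have hf : ∀ v, (f v).ofLp = (B : Matrix (Fin n) (Fin n) ℝ) *ᵥ v.ofLp := fun v => rfl
  have hnorm : ∀ v, ‖f v‖ = ‖v‖ := by
    intro v
    have : ‖f v‖ ^ 2 = ‖v‖ ^ 2 := by
      have h3 : ((B : Matrix (Fin n) (Fin n) ℝ) *ᵥ v.ofLp) ⬝ᵥ
          ((B : Matrix (Fin n) (Fin n) ℝ) *ᵥ v.ofLp) = v.ofLp ⬝ᵥ v.ofLp := by
        rw [Matrix.dotProduct_mulVec, Matrix.vecMul_mulVec]
        rw [show (B : Matrix (Fin n) (Fin n) ℝ)ᵀ * B = 1 from h1, Matrix.vecMul_one]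
      rw [EuclideanSpace.real_norm_sq_eq, EuclideanSpace.real_norm_sq_eq]
      simpa [dotProduct, pow_two, ← hf] using h3
    exact (sq_eq_sq₀ (norm_nonneg _) (norm_nonneg _)).1 this
  let φ : EuclideanSpace ℝ (Fin n) ≃ₗᵢ[ℝ] EuclideanSpace ℝ (Fin n) :=
    LinearIsometry.toLinearIsometryEquiv ⟨f, hnorm⟩ rfl
  obtain ⟨l, -, hl⟩ := LinearIsometryEquiv.reflections_generate_dim φ
  obtain ⟨x, hx, hs, hxl⟩ := exists_lipschitz_of_reflections n l
  rw [← hl] at hxl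
  obtain ⟨g, hg, hgu⟩ := lipschitz_det (fun _ : Fin n => (1 : ℝ)) hx
  have hgB : g = B := by
    apply Matrix.ext_of_mulVec_single
    intro i
    apply ι_inj (negForm fun _ : Fin n => (1 : ℝ))
    rw [← hgu]
    exact hxl (WithLp.toLp 2 (Pi.single i 1))
  rw [hgB, h2, one_smul] at hg
  have hs' : (x : CliffordAlgebra (negForm fun _ : Fin n => (1 : ℝ))) * star
      (x : CliffordAlgebra (negForm fun _ : Fin n => (1 : ℝ))) = 1 := by
    rw [← x.inv_eq_of_mul_eq_one_left hs, x.mul_inv]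
  let s : SpinN n := ⟨(x : CliffordAlgebra (negForm fun _ : Fin n => (1 : ℝ))), ⟨⟨⟨x, hx, rfl⟩, hs, hs'⟩, mem_evenOdd_zero_of_involute_eq _ hg⟩⟩
  refine ⟨s, Subtype.ext ?_⟩
  apply Matrix.ext_of_mulVec_single
  intro i
  rw [sigma_mulVec]
  apply ι_inj (-euclideanForm n)
  rw [ι_adEnd, ← hgB]
  refine Eq.trans ?_ (hgu _)
  have h3 : ((s⁻¹ : SpinN n) : CliffordAlgebra (-euclideanForm n)) =
      ((x⁻¹ : (CliffordAlgebra (negForm fun _ : Fin n => (1 : ℝ)))ˣ) :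
        CliffordAlgebra (negForm fun _ : Fin n => (1 : ℝ))) :=
    (x.inv_eq_of_mul_eq_one_left hs).symm
  have h4 : (s : CliffordAlgebra (-euclideanForm n)) = involute
      (x : CliffordAlgebra (negForm fun _ : Fin n => (1 : ℝ))) := hg.symm
  rw [h3, h4]
  rfl

end SpinN

/-! ### The kernel of `η`, its compatibility with `σ`, and the stabilizer of the base point -/

section SpinPlus

lemma eta_mulVec (n : ℕ) (g : SpinPlus n) (v : Idx n → ℝ) :
    ((eta n g : GL (Idx n) ℝ) : Mat n) *ᵥ v = adEnd (-lorentzForm n) g v :=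
  adGL_mulVec _ _ _

lemma neg_lorentzForm_polarBilin_surjective (n : ℕ) :
    Function.Surjective (-lorentzForm n).polarBilin :=
  negForm_polarBilin_surjective (w := lorentzWeight n) (by rintro (i | i) <;> simp [lorentzWeight])

lemma neg_euclideanForm_polarBilin_surjective (n : ℕ) :
    Function.Surjective (-euclideanForm n).polarBilin :=
  negForm_polarBilin_surjective (w := fun _ => 1) (by simp)

/-- The element `-1` of `Spin(n)`. -/
def negOne (n : ℕ) [NeZero n] : SpinN n :=
  ⟨-1, neg_one_mem_spinGroup (-euclideanForm n) (v := Pi.single 0 1)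
    (by rw [neg_apply, euclideanForm_apply]; simp [Pi.single_apply])⟩

/-- The element `-1` of `Spin⁺(n,1)`. -/
abbrev negOnePlus (n : ℕ) [NeZero n] : SpinPlus n := spinHat n (negOne n)

lemma coe_negOne (n : ℕ) [NeZero n] : (negOne n : CliffordAlgebra (-euclideanForm n)) = -1 := rfl

lemma coe_negOnePlus (n : ℕ) [NeZero n] :
    (negOnePlus n : CliffordAlgebra (-lorentzForm n)) = -1 := by
  change CliffordAlgebra.map (inclIsometry n) (-1) = -1
  rw [map_neg, map_one]

lemma one_ne_neg_one_clifford {M : Type*} [AddCommGroup M] [Module ℝ M] (Q : QuadraticForm ℝ M) :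
    (1 : CliffordAlgebra Q) ≠ -1 := by
  intro h
  have h1 := congrArg (scalarPart Q) h
  rw [map_neg, ← map_one (algebraMap ℝ (CliffordAlgebra Q)), scalarPart_algebraMap] at h1
  norm_num at h1

lemma negOne_ne_one (n : ℕ) [NeZero n] : negOne n ≠ 1 := fun h =>
  one_ne_neg_one_clifford _ (congrArg Subtype.val h).symm

lemma negOnePlus_ne_one (n : ℕ) [NeZero n] : negOnePlus n ≠ 1 := fun h =>
  one_ne_neg_one_clifford (-lorentzForm n) (by
    rw [← coe_negOnePlus, h]; rfl)

lemma negOnePlus_mul_comm (n : ℕ) [NeZero n] (g : SpinPlus n) :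
    negOnePlus n * g = g * negOnePlus n := Subtype.ext (by
  rw [Submonoid.coe_mul, Submonoid.coe_mul, coe_negOnePlus, neg_one_mul, mul_neg_one])

lemma negOnePlus_mul_self (n : ℕ) [NeZero n] : negOnePlus n * negOnePlus n = 1 := Subtype.ext (by
  rw [Submonoid.coe_mul, coe_negOnePlus, neg_mul_neg, one_mul]; rfl)

lemma negOne_mul_self (n : ℕ) [NeZero n] : negOne n * negOne n = 1 := Subtype.ext (by
  rw [Submonoid.coe_mul, coe_negOne, neg_mul_neg, one_mul]; rfl)

lemma eta_eq_one_iff (n : ℕ) [NeZero n] {g : SpinPlus n} :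
    eta n g = 1 ↔ g = 1 ∨ g = negOnePlus n := by
  constructor
  · intro h
    refine (eq_one_or_neg_one_of_adEnd _ (neg_lorentzForm_polarBilin_surjective n) g
      fun v => ?_).imp Subtype.ext fun h => Subtype.ext (h.trans (coe_negOnePlus n).symm)
    rw [← eta_mulVec, h]
    exact Matrix.one_mulVec v
  · rintro (rfl | rfl)
    · exact map_one _
    · refine Subtype.ext (Units.ext ?_)
      apply Matrix.ext_of_mulVec_single
      intro i
      rw [eta_mulVec]
      apply ι_inj (-lorentzForm n)
      rw [ι_adEnd]
      have h := coe_mul_inv (-lorentzForm n) (negOnePlus n)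
      rw [coe_negOnePlus, neg_one_mul] at h
      rw [coe_negOnePlus, neg_one_mul, neg_mul, ← mul_neg, h, mul_one]
      congr 1
      exact (Matrix.one_mulVec _).symm

lemma eta_negOnePlus (n : ℕ) [NeZero n] : eta n (negOnePlus n) = 1 :=
  (eta_eq_one_iff n).2 (.inr rfl)

lemma eta_eq_iff (n : ℕ) [NeZero n] {g h : SpinPlus n} :
    eta n g = eta n h ↔ g = h ∨ g = h * negOnePlus n := by
  rw [eq_comm, ← inv_mul_eq_one, ← map_inv, ← map_mul, eta_eq_one_iff, inv_mul_eq_one,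
    inv_mul_eq_iff_eq_mul, eq_comm (a := h)]

lemma inclIsometry_inl (n : ℕ) (v : Fin n → ℝ) (i : Fin n) : inclIsometry n v (.inl i) = v i := rfl

lemma inclIsometry_inr (n : ℕ) (v : Fin n → ℝ) (i : Unit) : inclIsometry n v (.inr i) = 0 := rfl

/-- The vector `e_{n+1}` is orthogonal to `ℝⁿ` and so anticommutes with each vector of `ℝⁿ`. For
even `x` the involution disappears, which is why `η(ŝ)` fixes `e_{n+1}`. -/
lemma commute_spinHat_time (n : ℕ) (x : CliffordAlgebra (-euclideanForm n)) :
    ι (-lorentzForm n) (basePoint n).1 * CliffordAlgebra.map (inclIsometry n) x =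
      CliffordAlgebra.map (inclIsometry n) (involute x) *
        ι (-lorentzForm n) (basePoint n).1 := by
  induction x using CliffordAlgebra.induction with
  | algebraMap r => simp only [AlgHom.commutes, Algebra.commutes]
  | ι v =>
    have h : (-lorentzForm n).polarBilin (basePoint n).1 (inclIsometry n v) = 0 := by
      rw [QuadraticMap.polarBilin_apply_apply]
      refine (polar_negForm (lorentzWeight n) _ _).trans ?_
      simp [inclIsometry_inl, inclIsometry_inr, basePoint]
    have h2 := ι_mul_ι_add_swap (Q := -lorentzForm n) (basePoint n).1 (inclIsometry n v)
    rw [QuadraticMap.polarBilin_apply_apply] at h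
    rw [h, map_zero] at h2
    rw [involute_ι, map_neg, map_apply_ι, neg_mul]
    exact eq_neg_of_add_eq_zero_left h2
  | mul a b ha hb => rw [map_mul, map_mul, map_mul, ← mul_assoc, ha, mul_assoc, hb, mul_assoc]
  | add a b ha hb => rw [map_add, map_add, map_add, mul_add, add_mul, ha, hb]

lemma coe_spinHat (n : ℕ) (s : SpinN n) : (spinHat n s : CliffordAlgebra (-lorentzForm n)) =
    CliffordAlgebra.map (inclIsometry n) s := rfl

lemma soHat_mulVec (n : ℕ) (B : SON n) (v : Idx n → ℝ) :
    ((soHat n B : GL (Idx n) ℝ) : Mat n) *ᵥ v = hatMat n B *ᵥ v := rfl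

/-- `η(ŝ)` is the block diagonal matrix of `σ(s)`. -/
lemma eta_spinHat (n : ℕ) (s : SpinN n) : eta n (spinHat n s) = soHat n (sigma n s) := by
  refine Subtype.ext (Units.ext ?_)
  -- Vectors are compared after right multiplication by `ŝ`, which turns `ŝ v ŝ⁻¹` into `ŝ v` and
  -- removes the inverse.
  have hcan : ∀ a b : Idx n → ℝ, ι (-lorentzForm n) a * (spinHat n s :
      CliffordAlgebra (-lorentzForm n)) = ι (-lorentzForm n) b * (spinHat n s :
      CliffordAlgebra (-lorentzForm n)) → a = b := by
    intro a b hab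
    have h := congrArg (· * (((spinHat n s)⁻¹ : SpinPlus n) :
      CliffordAlgebra (-lorentzForm n))) hab
    simp only [mul_assoc] at h
    rw [coe_mul_inv, mul_one, mul_one] at h
    exact ι_inj _ h
  apply Matrix.ext_of_mulVec_single
  rintro (i | i)
  · rw [eta_mulVec, soHat_mulVec]
    apply hcan
    rw [← coe_mul_ι]
    have h1 : (Pi.single (.inl i) 1 : Idx n → ℝ) = inclIsometry n (Pi.single i 1) := by
      ext (j | j) <;> simp [inclIsometry_inl, inclIsometry_inr, Pi.single_apply]
    have h2 : hatMat n (sigma n s) *ᵥ inclIsometry n (Pi.single i 1) =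
        inclIsometry n (adEnd (-euclideanForm n) s (Pi.single i 1)) := by
      rw [← sigma_mulVec]
      ext (j | j)
      · rw [hatMat_mulVec_inl]; rfl
      · rw [hatMat_mulVec_inr]; rfl
    rw [h1, h2, coe_spinHat, ← map_apply_ι, ← map_apply_ι, ← map_mul, ← map_mul, coe_mul_ι]
  · rw [eta_mulVec, soHat_mulVec]
    apply hcan
    rw [← coe_mul_ι]
    have h1 : (Pi.single (.inr i) 1 : Idx n → ℝ) = (basePoint n).1 := by
      ext (j | j) <;> simp [basePoint]
    have h2 : hatMat n (sigma n s) *ᵥ (basePoint n).1 = (basePoint n).1 := by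
      ext (j | j)
      · rw [hatMat_mulVec_inl]; simp [basePoint, Matrix.mulVec, dotProduct]
      · rw [hatMat_mulVec_inr]
    rw [h1, h2, coe_spinHat, commute_spinHat_time, spinGroup.involute_eq s.2]

lemma coe_smul_hyp (n : ℕ) (A : SOPlus n) (p : Hyp n) :
    (A • p).1 = ((A : GL (Idx n) ℝ) : Mat n) *ᵥ p.1 := rfl

lemma soHat_smul_basePoint (n : ℕ) (B : SON n) : soHat n B • basePoint n = basePoint n := by
  refine Subtype.ext ?_
  rw [coe_smul_hyp, soHat_mulVec]
  ext (j | j)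
  · rw [hatMat_mulVec_inl]; simp [basePoint, Matrix.mulVec, dotProduct]
  · rw [hatMat_mulVec_inr]

/-- The stabilizer of the base point is `SO(n)`. -/
lemma exists_soHat_of_smul_basePoint (n : ℕ) {A : SOPlus n} (hA : A • basePoint n = basePoint n) :
    ∃ B, soHat n B = A := by
  have h := SOPlus_orth A
  have hcol : ((A : GL (Idx n) ℝ) : Mat n) *ᵥ (basePoint n).1 = (basePoint n).1 :=
    congrArg Subtype.val hA
  have hdet := A.2.2.2
  obtain ⟨M, hM⟩ : ∃ M, M = ((A : GL (Idx n) ℝ) : Mat n) := ⟨_, rfl⟩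
  rw [← hM] at h hcol hdet
  -- From `MᵀJM = J` and `M e = e` follows `eᵀJM = eᵀJ`: since the last column of `M` is that of the
  -- identity, so is the last row.
  have hrow : (basePoint n).1 ᵥ* (lorentzJ n * M) = (basePoint n).1 ᵥ* lorentzJ n := by
    conv_rhs => rw [← h]
    rw [mul_assoc, ← Matrix.vecMul_vecMul _ Mᵀ, Matrix.vecMul_transpose, hcol]
  have c1 : ∀ i, M (.inl i) (.inr ()) = 0 := by
    intro i
    have := congrFun hcol (.inl i)
    simpa [Matrix.mulVec, dotProduct, basePoint] using this
  have c2 : M (.inr ()) (.inr ()) = 1 := by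
    have := congrFun hcol (.inr ())
    simpa [Matrix.mulVec, dotProduct, basePoint] using this
  have c3 : ∀ i, M (.inr ()) (.inl i) = 0 := by
    intro i
    have := congrFun hrow (.inl i)
    simpa [Matrix.vecMul, dotProduct, basePoint, lorentzJ, lorentzWeight, Matrix.diagonal_mul]
      using this
  have hblock : M = hatMat n M.toBlocks₁₁ := by
    ext (i | i) (j | j)
    · rfl
    · exact c1 i
    · exact c3 j
    · exact c2
  have horth : (M.toBlocks₁₁)ᵀ * M.toBlocks₁₁ = 1 := by
    ext i j
    have := congrFun (congrFun h (.inl i)) (.inl j)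
    simpa [Matrix.mul_apply, lorentzJ, Matrix.mul_diagonal, lorentzWeight, c3,
      Matrix.diagonal_apply, Matrix.one_apply, Matrix.toBlocks₁₁] using this
  refine ⟨⟨M.toBlocks₁₁, Matrix.mem_specialOrthogonalGroup_iff.2
    ⟨(Matrix.mem_orthogonalGroup_iff' _ _).2 horth, ?_⟩⟩, Subtype.ext (Units.ext ?_)⟩
  · rw [hblock, hatMat, Matrix.det_fromBlocks_zero₂₁, Matrix.det_one, mul_one] at hdet
    exact hdet
  · exact hblock.symm.trans hM

end SpinPlus

/-! ### Continuity of the homomorphisms, and `Spin(n)` as a topological subgroup -/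

section SpinTopology

lemma continuous_eta (n : ℕ) : Continuous (eta n) :=
  (isEmbedding_SOPlus n).continuous_iff.2 (continuous_adGL (-lorentzForm n))

lemma continuous_spinHat (n : ℕ) : Continuous (spinHat n) := by
  have := IsModuleTopology.toContinuousAdd ℝ (CliffordAlgebra (-lorentzForm n))
  rw [Topology.IsInducing.subtypeVal.continuous_iff]
  exact (IsModuleTopology.continuous_of_linearMap
    (CliffordAlgebra.map (inclIsometry n)).toLinearMap).comp continuous_subtype_val

lemma continuous_soHat (n : ℕ) : Continuous (soHat n) := by
  rw [(isEmbedding_SOPlus n).continuous_iff]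
  change Continuous fun B : SON n => hatMat n B
  exact Continuous.matrix_fromBlocks continuous_subtype_val continuous_const continuous_const
    continuous_const

lemma comap_eta_nhds_one_le (n : ℕ) [NeZero n] :
    Filter.comap (eta n) (𝓝 1) ≤ 𝓝 1 ⊔ 𝓝 (negOnePlus n) := by
  refine le_trans ?_ (comap_adGL_nhds_one_le (-lorentzForm n)
    (neg_lorentzForm_polarBilin_surjective n) (negOnePlus n) (coe_negOnePlus n))
  rw [(isEmbedding_SOPlus n).isInducing.nhds_eq_comap, Filter.comap_comap]
  rfl

lemma comap_sigma_nhds_one_le (n : ℕ) [NeZero n] :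
    Filter.comap (sigma n) (𝓝 1) ≤ 𝓝 1 ⊔ 𝓝 (negOne n) := by
  refine le_trans ?_ (comap_adGL_nhds_one_le (-euclideanForm n)
    (neg_euclideanForm_polarBilin_surjective n) (negOne n) rfl)
  rw [Topology.IsInducing.subtypeVal.nhds_eq_comap, Filter.comap_comap]
  rfl

lemma isEmbedding_soHat (n : ℕ) : Topology.IsEmbedding (soHat n) := by
  refine Topology.IsEmbedding.of_comp (continuous_soHat n)
    (g := fun A : SOPlus n => ((A : GL (Idx n) ℝ) : Mat n).toBlocks₁₁)
    ?_ Topology.IsEmbedding.subtypeVal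
  have h := (isEmbedding_SOPlus n).continuous
  exact continuous_matrix fun i j => h.matrix_elem _ _

/-- The embedding of `Spin(n)` in `Spin⁺(n,1)` is a topological embedding. -/
lemma isEmbedding_spinHat (n : ℕ) [NeZero n] : Topology.IsEmbedding (spinHat n) := by
  have key : Filter.comap (spinHat n) (𝓝 1) ≤ 𝓝 1 := by
    -- If `ŝ` tends to `1` then so does `σ(s)`, so `s` accumulates only at `±1`. The point `-1` is
    -- excluded afterwards, because its image differs from `1` in a Hausdorff space.
    have h1 : Filter.comap (spinHat n) (𝓝 1) ≤ 𝓝 1 ⊔ 𝓝 (negOne n) := by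
      refine le_trans ?_ (comap_sigma_nhds_one_le n)
      have h2 : 𝓝 (1 : SON n) = Filter.comap (soHat n) (𝓝 1) := by
        rw [(isEmbedding_soHat n).isInducing.nhds_eq_comap, map_one]
      have h3 : soHat n ∘ sigma n = eta n ∘ spinHat n := by
        ext s : 1; exact (eta_spinHat n s).symm
      rw [h2, Filter.comap_comap, h3, ← Filter.comap_comap]
      refine Filter.comap_mono ?_
      have := (continuous_eta n).tendsto 1
      rw [map_one] at this
      exact this.le_comap
    have h4 : Disjoint (Filter.comap (spinHat n) (𝓝 1)) (𝓝 (negOne n)) := by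
      refine Disjoint.mono_right ((continuous_spinHat n).tendsto _).le_comap ?_
      exact Filter.disjoint_comap (disjoint_nhds_nhds.2 (negOnePlus_ne_one n).symm)
    exact h4.left_le_of_le_sup_right h1
  refine ⟨IsTopologicalGroup.isInducing_iff_nhds_one.2 (le_antisymm ?_ key), ?_⟩
  · have := (continuous_spinHat n).tendsto 1
    rw [map_one] at this
    exact this.le_comap
  · rw [injective_iff_map_eq_one]
    intro s hs
    by_contra hne
    -- Injectivity comes from the same inclusion of filters: the principal filter at a kernel
    -- element `s` converges to `1`, which forces `s = 1`.
    have h5 : pure s ≤ 𝓝 (1 : SpinN n) := by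
      refine le_trans ?_ key
      rw [← Filter.tendsto_iff_comap, Filter.tendsto_pure_left, hs]
      exact fun _ h => mem_of_mem_nhds h
    exact hne (pure_le_nhds_iff.1 h5)

instance (n : ℕ) : ContinuousSMul (SOPlus n) (Hyp n) where
  continuous_smul := by
    rw [Topology.IsInducing.subtypeVal.continuous_iff]
    have h := (isEmbedding_SOPlus n).continuous
    exact (h.comp continuous_fst).matrix_mulVec (continuous_subtype_val.comp continuous_snd)

end SpinTopology

/-! ### Boosts, surjectivity of `η`, and the polar decomposition -/

section Boost

/-- This value is negative because `p_{n+1} > 0`, so `p + e` can be normalized to a unit timelike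
vector. -/
lemma polar_basePoint (n : ℕ) (p : Hyp n) :
    lorentzForm n (p.1 + (basePoint n).1) = -(2 + 2 * p.1 (.inr ())) := by
  have h := p.2.1
  rw [lorentzForm_apply] at h ⊢
  simp only [Pi.add_apply, basePoint, Sum.elim_inl, Sum.elim_inr, Pi.zero_apply, Pi.one_apply,
    add_zero]
  linarith

/-- The vector `(p + e) / √(2 + 2 p_{n+1})` of the Lorentzian midpoint of `p` and `e = e_{n+1}`. -/
def midVec (n : ℕ) (p : Hyp n) : Idx n → ℝ :=
  (√(2 + 2 * p.1 (.inr ())))⁻¹ • (p.1 + (basePoint n).1)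

lemma neg_lorentzForm_basePoint (n : ℕ) : (-lorentzForm n) (basePoint n).1 = 1 := by
  rw [neg_apply, (basePoint n).2.1, neg_neg]

lemma neg_lorentzForm_midVec (n : ℕ) (p : Hyp n) : (-lorentzForm n) (midVec n p) = 1 := by
  have h : 0 < 2 + 2 * p.1 (.inr ()) := by linarith [p.2.2]
  rw [neg_apply, midVec, QuadraticMap.map_smul, polar_basePoint, smul_eq_mul, mul_neg, neg_neg,
    ← mul_inv, Real.mul_self_sqrt h.le, inv_mul_cancel₀ h.ne']

/-- The lift to `Spin⁺(n,1)` of the boost that carries the base point to `p`. -/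
def boost (n : ℕ) (p : Hyp n) : SpinPlus n :=
  ⟨ι _ (midVec n p) * ι _ (basePoint n).1, ι_mul_ι_mem_spinGroup _ (by
    rw [neg_lorentzForm_basePoint, neg_lorentzForm_midVec, one_mul])⟩

lemma continuous_boost (n : ℕ) : Continuous (boost n) := by
  have := IsModuleTopology.toContinuousAdd ℝ (CliffordAlgebra (-lorentzForm n))
  rw [Topology.IsInducing.subtypeVal.continuous_iff]
  have hι : Continuous (ι (-lorentzForm n)) := IsModuleTopology.continuous_of_linearMap _
  have hm : Continuous (midVec n) := by
    have h0 : Continuous fun p : Hyp n => √(2 + 2 * p.1 (.inr ())) :=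
      Real.continuous_sqrt.comp (continuous_const.add (continuous_const.mul
        ((continuous_apply _).comp continuous_subtype_val)))
    refine Continuous.smul (h0.inv₀ fun p => ?_) (by fun_prop)
    have : 0 < 2 + 2 * p.1 (.inr ()) := by linarith [p.2.2]
    exact (Real.sqrt_pos.2 this).ne'
  exact (hι.comp hm).mul continuous_const

/-- In the Clifford algebra `p² = e² = 1`, so `(p + e)e · e = p + e = p · (p + e)e`. Up to the
normalizing factor this says that the boost `b` satisfies `b e = p b`. -/
lemma eta_boost_smul (n : ℕ) (p : Hyp n) : eta n (boost n p) • basePoint n = p := by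
  refine Subtype.ext ?_
  rw [coe_smul_hyp, eta_mulVec]
  have hB : ι (-lorentzForm n) (basePoint n).1 * ι (-lorentzForm n) (basePoint n).1 = 1 := by
    rw [ι_sq_scalar, neg_lorentzForm_basePoint, map_one]
  have hP : ι (-lorentzForm n) p.1 * ι (-lorentzForm n) p.1 = 1 := by
    rw [ι_sq_scalar, neg_apply, p.2.1, neg_neg, map_one]
  have h : ι (-lorentzForm n) (adEnd (-lorentzForm n) (boost n p) (basePoint n).1) *
      (boost n p : CliffordAlgebra (-lorentzForm n)) = ι (-lorentzForm n) p.1 *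
      (boost n p : CliffordAlgebra (-lorentzForm n)) := by
    rw [← coe_mul_ι]
    change ι _ (midVec n p) * ι _ (basePoint n).1 * ι _ (basePoint n).1 =
      ι _ p.1 * (ι _ (midVec n p) * ι _ (basePoint n).1)
    rw [mul_assoc, hB, mul_one, midVec, map_smul, map_add, smul_mul_assoc, mul_smul_comm, add_mul,
      hB, mul_add, ← mul_assoc, hP, one_mul, mul_one,
      add_comm (ι (-lorentzForm n) p.1)]
  have h2 := congrArg (· * (((boost n p)⁻¹ : SpinPlus n) : CliffordAlgebra (-lorentzForm n))) h
  simp only [mul_assoc] at h2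
  rw [coe_mul_inv, mul_one, mul_one] at h2
  exact ι_inj _ h2

/-- Dividing `A` by the boost to `A e_{n+1}` leaves an element of the stabilizer `SO(n)`, which `σ`
covers. -/
lemma eta_surjective (n : ℕ) : Function.Surjective (eta n) := by
  intro A
  obtain ⟨B, hB⟩ := exists_soHat_of_smul_basePoint n
    (A := (eta n (boost n (A • basePoint n)))⁻¹ * A) (by
      rw [mul_smul, inv_smul_eq_iff, eta_boost_smul])
  obtain ⟨s, rfl⟩ := sigma_surjective n B
  refine ⟨boost n (A • basePoint n) * spinHat n s, ?_⟩
  rw [map_mul, eta_spinHat, hB, mul_inv_cancel_left]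

lemma exists_rot (n : ℕ) [NeZero n] (g : SpinPlus n) :
    ∃ s, boost n (eta n g • basePoint n) * spinHat n s = g := by
  obtain ⟨B, hB⟩ := exists_soHat_of_smul_basePoint n
    (A := (eta n (boost n (eta n g • basePoint n)))⁻¹ * eta n g) (by
      rw [mul_smul, inv_smul_eq_iff, eta_boost_smul])
  obtain ⟨s, rfl⟩ := sigma_surjective n B
  have h : eta n g = eta n (boost n (eta n g • basePoint n) * spinHat n s) := by
    rw [map_mul, eta_spinHat, hB, mul_inv_cancel_left]
  rcases (eta_eq_iff n).1 h with h | h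
  · exact ⟨s, h.symm⟩
  -- The kernel element `-1` of `η` comes from `Spin(n)`, so a wrong sign is absorbed in `s`.
  · exact ⟨s * negOne n, by rw [map_mul, ← mul_assoc, ← h]⟩

/-- The `Spin(n)` component of an element of `Spin⁺(n,1)` in the polar decomposition. -/
def rot (n : ℕ) [NeZero n] (g : SpinPlus n) : SpinN n := (exists_rot n g).choose

lemma boost_mul_rot (n : ℕ) [NeZero n] (g : SpinPlus n) :
    boost n (eta n g • basePoint n) * spinHat n (rot n g) = g := (exists_rot n g).choose_spec

lemma eta_mul_spinHat_smul (n : ℕ) (g : SpinPlus n) (s : SpinN n) :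
    eta n (g * spinHat n s) • basePoint n = eta n g • basePoint n := by
  rw [map_mul, eta_spinHat, mul_smul, soHat_smul_basePoint]

/-- Right multiplication by `ŝ` does not move the point of `Hⁿ`, hence leaves the boost factor
alone. This equivariance allows maps on `Hⁿ` to be extended to `Spin⁺(n,1)`. -/
lemma rot_mul_spinHat (n : ℕ) [NeZero n] (g : SpinPlus n) (s : SpinN n) :
    rot n (g * spinHat n s) = rot n g * s := by
  apply (isEmbedding_spinHat n).injective
  have h1 := boost_mul_rot n (g * spinHat n s)
  rw [eta_mul_spinHat_smul] at h1
  rw [map_mul, ← mul_right_inj (boost n (eta n g • basePoint n)), h1, ← mul_assoc, boost_mul_rot]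

lemma rot_boost_mul (n : ℕ) [NeZero n] (p : Hyp n) (s : SpinN n) :
    rot n (boost n p * spinHat n s) = s := by
  apply (isEmbedding_spinHat n).injective
  have h1 := boost_mul_rot n (boost n p * spinHat n s)
  rwa [eta_mul_spinHat_smul, eta_boost_smul, mul_right_inj] at h1

/-- Although `rot` is chosen pointwise, its image under the embedding `spinHat` is the boost inverse
times `g`, which is continuous in `g`. -/
lemma continuous_rot (n : ℕ) [NeZero n] : Continuous (rot n) := by
  rw [(isEmbedding_spinHat n).continuous_iff]
  have h : ∀ g, spinHat n (rot n g) = (boost n (eta n g • basePoint n))⁻¹ * g := fun g => by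
    rw [eq_inv_mul_iff_mul_eq, boost_mul_rot]
  have h1 : Continuous fun g => eta n g • basePoint n := (continuous_eta n).smul continuous_const
  exact ((((continuous_boost n).comp h1).inv).mul continuous_id).congr fun g => (h g).symm

/-- The polar decomposition of `Spin⁺(n,1)`. -/
def polarHomeo (n : ℕ) [NeZero n] : SpinPlus n ≃ₜ Hyp n × SpinN n where
  toFun g := (eta n g • basePoint n, rot n g)
  invFun z := boost n z.1 * spinHat n z.2
  left_inv g := boost_mul_rot n g
  right_inv z := Prod.ext (by
    change eta n (boost n z.1 * spinHat n z.2) • basePoint n = z.1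
    rw [eta_mul_spinHat_smul, eta_boost_smul]) (rot_boost_mul n z.1 z.2)
  continuous_toFun := ((continuous_eta n).smul continuous_const).prodMk (continuous_rot n)
  continuous_invFun := ((continuous_boost n).comp continuous_fst).mul
    ((continuous_spinHat n).comp continuous_snd)

end Boost

/-! ### `η` is a covering map -/

section Covering

/-- A full preimage under `η` is invariant under `-1`, so if it is a neighbourhood of `1` it is also
one of `-1`. By `comap_eta_nhds_one_le` it then contains the preimage of a neighbourhood of the
identity, and `η` is onto. -/
lemma isOpenMap_eta (n : ℕ) [NeZero n] : IsOpenMap (eta n) := by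
  rw [IsTopologicalGroup.isOpenMap_iff_nhds_one]
  intro U hU
  rw [Filter.mem_map] at hU
  have hU' : eta n ⁻¹' U ∈ 𝓝 (negOnePlus n) := by
    have h := (continuous_const_mul (negOnePlus n)).tendsto (negOnePlus n)
    rw [negOnePlus_mul_self] at h
    filter_upwards [h hU] with g hg
    simpa [eta_negOnePlus] using hg
  obtain ⟨V, hV, hVU⟩ := Filter.mem_comap.1 (comap_eta_nhds_one_le n ⟨hU, hU'⟩)
  filter_upwards [hV] with A hA
  obtain ⟨g, rfl⟩ := eta_surjective n A
  exact hVU hA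

lemma isOpenQuotientMap_eta (n : ℕ) [NeZero n] : IsOpenQuotientMap (eta n) :=
  ⟨eta_surjective n, continuous_eta n, isOpenMap_eta n⟩

lemma isCoveringMap_eta (n : ℕ) [NeZero n] : IsCoveringMap (eta n) := by
  refine ((isOpenQuotientMap_eta n).isQuotientMap.isQuotientCoveringMap_of_isDiscrete_ker_monoidHom
    (f := eta n) ?_).isCoveringMap
  have : (↑(eta n).ker : Set (SpinPlus n)) = {1, negOnePlus n} := by
    ext g
    simp only [SetLike.mem_coe, MonoidHom.mem_ker, eta_eq_one_iff]
    rfl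
  rw [this]
  exact (Set.toFinite _).isDiscrete

end Covering

/-! ### Topology of `Hⁿ`, and the action of `Γ` on it -/

section HypTopology

/-- Hyperbolic space is homeomorphic to `ℝⁿ`, by vertical projection. -/
def hypHomeo (n : ℕ) : Hyp n ≃ₜ (Fin n → ℝ) where
  toFun p i := p.1 (.inl i)
  invFun y := ⟨Sum.elim y fun _ => √(1 + ∑ i, y i ^ 2), by
    have h : 0 ≤ ∑ i, y i ^ 2 := Finset.sum_nonneg fun i _ => sq_nonneg _
    refine ⟨?_, Real.sqrt_pos.2 (by linarith)⟩
    rw [lorentzForm_apply]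
    simp only [Sum.elim_inl, Sum.elim_inr]
    rw [Real.sq_sqrt (by linarith)]
    ring⟩
  left_inv p := by
    refine Subtype.ext (funext ?_)
    rintro (i | i)
    · rfl
    · have h := p.2.1
      rw [lorentzForm_apply] at h
      change √(1 + ∑ i, p.1 (.inl i) ^ 2) = p.1 (.inr i)
      rw [show 1 + ∑ i, p.1 (.inl i) ^ 2 = p.1 (.inr ()) ^ 2 by linarith, Real.sqrt_sq p.2.2.le]
  right_inv y := rfl
  continuous_toFun := continuous_pi fun i => (continuous_apply _).comp continuous_subtype_val
  continuous_invFun := by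
    refine Continuous.subtype_mk (continuous_pi ?_) _
    rintro (i | i)
    · exact continuous_apply i
    · exact Real.continuous_sqrt.comp (by fun_prop)

instance (n : ℕ) : ContractibleSpace (Hyp n) := (hypHomeo n).contractibleSpace

instance (n : ℕ) : LocallyPathConnectedSpace (Hyp n) :=
  (hypHomeo n).isOpenEmbedding.locallyPathConnectedSpace

instance (n : ℕ) : LocallyCompactSpace (Hyp n) :=
  (hypHomeo n).isOpenEmbedding.locallyCompactSpace

instance (n : ℕ) : CompactSpace (SON n) := by
  have hbox : IsCompact (Set.univ.pi fun _ : Fin n => Set.univ.pi fun _ : Fin n =>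
      Set.Icc (-1 : ℝ) 1) := isCompact_univ_pi fun _ => isCompact_univ_pi fun _ => isCompact_Icc
  have hclosed : IsClosed {A : Matrix (Fin n) (Fin n) ℝ | Aᵀ * A = 1 ∧ A.det = 1} :=
    (isClosed_eq (by fun_prop) continuous_const).inter (isClosed_eq (by fun_prop) continuous_const)
  have heq : ((Matrix.specialOrthogonalGroup (Fin n) ℝ : Submonoid _) :
      Set (Matrix (Fin n) (Fin n) ℝ)) = {A | Aᵀ * A = 1 ∧ A.det = 1} := by
    ext A
    rw [SetLike.mem_coe, Matrix.mem_specialOrthogonalGroup_iff, Matrix.mem_orthogonalGroup_iff']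
    rfl
  have hc : IsCompact {A : Matrix (Fin n) (Fin n) ℝ | Aᵀ * A = 1 ∧ A.det = 1} := by
    refine hbox.of_isClosed_subset hclosed ?_
    intro A hA i _ j _
    have hA' : Matrix.of A ∈ Matrix.orthogonalGroup (Fin n) ℝ :=
      (Matrix.mem_orthogonalGroup_iff' _ _).2 hA.1
    have := entry_norm_bound_of_unitary (𝕜 := ℝ) hA' i j
    rw [Real.norm_eq_abs] at this
    exact abs_le.1 this
  rw [← heq] at hc
  exact isCompact_iff_compactSpace.1 hc

/-- The map `A ↦ A e_{n+1}` from `SO⁺(n,1)` to `Hⁿ` is proper. -/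
lemma isCompact_preimage_smul_basePoint (n : ℕ) {K : Set (Hyp n)} (hK : IsCompact K) :
    IsCompact {A : SOPlus n | A • basePoint n ∈ K} := by
  have h1 : Continuous fun z : Hyp n × SON n => eta n (boost n z.1) * soHat n z.2 :=
    ((continuous_eta n).comp ((continuous_boost n).comp continuous_fst)).mul
      ((continuous_soHat n).comp continuous_snd)
  convert! (hK.prod (isCompact_univ (X := SON n))).image h1 using 1
  ext A
  constructor
  · intro hA
    obtain ⟨B, hB⟩ := exists_soHat_of_smul_basePoint n
      (A := (eta n (boost n (A • basePoint n)))⁻¹ * A) (by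
        rw [mul_smul, inv_smul_eq_iff, eta_boost_smul])
    exact ⟨(A • basePoint n, B), ⟨hA, trivial⟩, by
      change eta n (boost n (A • basePoint n)) * soHat n B = A
      rw [hB, mul_inv_cancel_left]⟩
  · rintro ⟨⟨p, B⟩, ⟨hp, -⟩, rfl⟩
    change (eta n (boost n p) * soHat n B) • basePoint n ∈ K
    rwa [mul_smul, soHat_smul_basePoint, eta_boost_smul]

/-- Proper discontinuity descends from `SO⁺(n,1)` because the orbit map `A ↦ A e_{n+1}` is proper
and equivariant: if `γ` carries a point of `K` into `L`, it carries a group element over `K` to one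
over `L`, and these preimages are compact. -/
instance {n : ℕ} (Γ : Subgroup (SOPlus n)) [DiscreteTopology Γ] :
    ProperlyDiscontinuousSMul Γ (Hyp n) where
  finite_disjoint_inter_image {K L} hK hL := by
    refine (ProperlyDiscontinuousSMul.finite_disjoint_inter_image (Γ := Γ) (T := SOPlus n)
      (isCompact_preimage_smul_basePoint n hK) (isCompact_preimage_smul_basePoint n hL)).subset ?_
    rintro γ ⟨_, ⟨p, hp, rfl⟩, hp'⟩
    refine ⟨γ • eta n (boost n p), ⟨_, ?_, rfl⟩, ?_⟩
    · change eta n (boost n p) • basePoint n ∈ K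
      rwa [eta_boost_smul]
    · change ((γ : SOPlus n) * eta n (boost n p)) • basePoint n ∈ L
      rw [mul_smul, eta_boost_smul]
      exact hp'

/-- A torsion-free discrete group of isometries acts freely on hyperbolic space. -/
lemma isCancelSMul_hyp {n : ℕ} (Γ : Subgroup (SOPlus n)) [DiscreteTopology Γ]
    (hΓ : ∀ γ ∈ Γ, IsOfFinOrder γ → γ = 1) : IsCancelSMul Γ (Hyp n) := by
  rw [isCancelSMul_iff_eq_one_of_smul_eq]
  intro γ p hp
  -- Proper discontinuity for the compact set `{p}` makes the stabilizer of `p` finite, so `γ` has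
  -- finitely many powers.
  have hfin := ProperlyDiscontinuousSMul.finite_disjoint_inter_image (Γ := Γ)
    (isCompact_singleton (x := p)) (isCompact_singleton (x := p))
  have h1 : IsOfFinOrder γ := by
    rw [← finite_powers]
    refine hfin.subset ?_
    rintro _ ⟨k, rfl⟩
    refine ⟨p, ⟨p, rfl, ?_⟩, rfl⟩
    have : ∀ k : ℕ, γ ^ k • p = p := by
      intro k
      induction k with
      | zero => rw [pow_zero, one_smul]
      | succ k ih => rw [pow_succ, mul_smul, hp, ih]
    exact this k
  exact Subtype.ext (hΓ γ γ.2 (Submonoid.isOfFinOrder_coe.2 h1))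

end HypTopology

/-! ### Smooth structures transported along local homeomorphisms -/

section LocalHomeomorphManifold

variable {E : Type*} [NormedAddCommGroup E] [NormedSpace ℝ E]
  {X Y Z : Type*} [TopologicalSpace X] [TopologicalSpace Y] [TopologicalSpace Z]
  [ChartedSpace E X] [ChartedSpace E Y] [ChartedSpace E Z]

lemma isManifold_of_contDiffAt (h : ∀ e ∈ atlas E X, ∀ e' ∈ atlas E X, ∀ z ∈ (e.symm.trans e').source,
    ContDiffAt ℝ ∞ (e.symm.trans e') z) : IsManifold 𝓘(ℝ, E) ∞ X := by
  refine isManifold_of_contDiffOn _ _ _ fun e e' he he' => ?_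
  intro z hz
  simp only [modelWithCornersSelf_coe, modelWithCornersSelf_coe_symm, Function.comp_id,
    Function.id_comp]
  exact (h e he e' he' z hz.1).contDiffWithinAt

lemma isLocalDiffeomorphAt_of_partialHomeomorph {f : X → Y} {x : X}
    (φ : OpenPartialHomeomorph X Y) (hx : x ∈ φ.source) (hφ : ∀ z ∈ φ.source, f z = φ z)
    (h1 : ContMDiffOn 𝓘(ℝ, E) 𝓘(ℝ, E) ∞ φ φ.source)
    (h2 : ContMDiffOn 𝓘(ℝ, E) 𝓘(ℝ, E) ∞ φ.symm φ.target) :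
    IsLocalDiffeomorphAt 𝓘(ℝ, E) 𝓘(ℝ, E) ∞ f x :=
  ⟨⟨φ.toPartialEquiv, φ.open_source, φ.open_target, h1, h2⟩, hx, hφ⟩

/-- The charts of a space `X` are lifted from `Y` along a local homeomorphism `p`. -/
def HasLiftedCharts (E : Type*) [NormedAddCommGroup E] [NormedSpace ℝ E]
    {X Y : Type*} [TopologicalSpace X] [TopologicalSpace Y]
    [ChartedSpace E X] [ChartedSpace E Y] (p : X → Y) : Prop :=
  ∀ e ∈ atlas E X, ∃ (φ : OpenPartialHomeomorph X Y) (c : OpenPartialHomeomorph Y E),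
    c ∈ atlas E Y ∧ p = φ ∧ e = φ.trans c

omit [ChartedSpace E X] in
lemma exists_hasLiftedCharts {p : X → Y} (hp : IsLocalHomeomorph p) :
    ∃ _ : ChartedSpace E X, HasLiftedCharts E p := by
  choose φ hφ hφp using hp
  refine ⟨{ atlas := Set.range fun x => (φ x).trans (chartAt E (p x))
            chartAt := fun x => (φ x).trans (chartAt E (p x))
            mem_chart_source := fun x => ⟨hφ x, ?_⟩
            chart_mem_atlas := fun x => ⟨x, rfl⟩ }, ?_⟩
  · have h : φ x x ∈ (chartAt E (p x)).source := by
      rw [← hφp x]; exact mem_chart_source E (p x)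
    exact h
  · rintro _ ⟨x, rfl⟩
    exact ⟨φ x, chartAt E (p x), chart_mem_atlas E _, hφp x, rfl⟩

/-- The local inverse of `p` in one chart cancels against `p` in the other, so a transition map of
lifted charts is a restriction of a transition map of `Y`. -/
lemma HasLiftedCharts.isManifold [IsManifold 𝓘(ℝ, E) ∞ Y] {p : X → Y}
    (h : HasLiftedCharts E p) : IsManifold 𝓘(ℝ, E) ∞ X := by
  refine isManifold_of_contDiffAt fun e he e' he' z hz => ?_
  obtain ⟨φ, c, hc, hφ, rfl⟩ := h e he
  obtain ⟨φ', c', hc', hφ', rfl⟩ := h e' he'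
  have hc := IsManifold.subset_maximalAtlas (I := 𝓘(ℝ, E)) (n := ∞) hc
  have hc' := IsManifold.subset_maximalAtlas (I := 𝓘(ℝ, E)) (n := ∞) hc'
  have key : ∀ z ∈ ((φ.trans c).symm.trans (φ'.trans c')).source,
      z ∈ c.target ∧ c.symm z ∈ c'.source ∧
        (φ.trans c).symm.trans (φ'.trans c') z = c' (c.symm z) := by
    intro z hz
    simp only [OpenPartialHomeomorph.trans_source, OpenPartialHomeomorph.symm_source,
      OpenPartialHomeomorph.trans_target, Set.mem_inter_iff, Set.mem_preimage,
      OpenPartialHomeomorph.coe_trans_symm, Function.comp_apply] at hz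
    have h1 : φ' (φ.symm (c.symm z)) = c.symm z := by
      rw [← hφ', hφ]; exact φ.right_inv hz.1.2
    rw [h1] at hz
    refine ⟨hz.1.1, hz.2.2, ?_⟩
    simp only [OpenPartialHomeomorph.coe_trans, OpenPartialHomeomorph.coe_trans_symm,
      Function.comp_apply, h1]
  obtain ⟨hz1, hz2, -⟩ := key z hz
  have h2 : ContMDiffAt 𝓘(ℝ, E) 𝓘(ℝ, E) ∞ (c' ∘ c.symm) z :=
    (contMDiffAt_of_mem_maximalAtlas hc' hz2).comp z (contMDiffAt_symm_of_mem_maximalAtlas hc hz1)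
  refine h2.contDiffAt.congr_of_eventuallyEq ?_
  filter_upwards [((φ.trans c).symm.trans (φ'.trans c')).open_source.mem_nhds hz] with w hw
  exact (key w hw).2.2

lemma HasLiftedCharts.isLocalDiffeomorph [IsManifold 𝓘(ℝ, E) ∞ Y] {p : X → Y}
    (h : HasLiftedCharts E p) : IsLocalDiffeomorph 𝓘(ℝ, E) 𝓘(ℝ, E) ∞ p := by
  have := h.isManifold
  intro x
  obtain ⟨φ, c, hc, hφ, he⟩ := h (chartAt E x) (chart_mem_atlas E x)
  have hc := IsManifold.subset_maximalAtlas (I := 𝓘(ℝ, E)) (n := ∞) hc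
  have hx := mem_chart_source E x
  have h1 := contMDiffOn_chart (I := 𝓘(ℝ, E)) (n := ∞) (x := x)
  have h2 := contMDiffOn_chart_symm (I := 𝓘(ℝ, E)) (n := ∞) (x := x)
  rw [he] at hx h1 h2
  have e1 : ∀ z ∈ (φ.trans c).source, c.symm (φ.trans c z) = p z := by
    intro z hz
    rw [OpenPartialHomeomorph.trans_source] at hz
    rw [hφ]
    exact c.left_inv hz.2
  -- On its source this is `p`, written as a lifted chart of `X` followed by the inverse of a chart
  -- of `Y`; both factors are smooth by definition of the structures.
  refine isLocalDiffeomorphAt_of_partialHomeomorph ((φ.trans c).trans c.symm) ?_ ?_ ?_ ?_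
  · refine ⟨hx, ?_⟩
    rw [OpenPartialHomeomorph.trans_source] at hx
    exact c.map_source hx.2
  · intro z hz
    exact (e1 z hz.1).symm
  · exact (contMDiffOn_symm_of_mem_maximalAtlas hc).comp (h1.mono fun z hz => hz.1)
      fun z hz => hz.2
  · rw [OpenPartialHomeomorph.trans_symm_eq_symm_trans_symm]
    exact h2.comp ((contMDiffOn_of_mem_maximalAtlas hc).mono fun z hz => hz.1) fun z hz => hz.2

/-- The charts of a space `Y` are pushed forward from `X` along a local homeomorphism `p`. -/
def HasPushedCharts (E : Type*) [NormedAddCommGroup E] [NormedSpace ℝ E]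
    {X Y : Type*} [TopologicalSpace X] [TopologicalSpace Y]
    [ChartedSpace E X] [ChartedSpace E Y] (p : X → Y) : Prop :=
  ∀ e ∈ atlas E Y, ∃ (φ : OpenPartialHomeomorph X Y) (c : OpenPartialHomeomorph X E),
    c ∈ atlas E X ∧ p = φ ∧ e = φ.symm.trans c

/-- Points in the same fibre of `p` are related by smooth deck transformations. -/
def HasSmoothDeck (E : Type*) [NormedAddCommGroup E] [NormedSpace ℝ E]
    {X Y : Type*} [TopologicalSpace X] [ChartedSpace E X] (p : X → Y) : Prop :=
  ∀ x y, p x = p y → ∃ d : X → X, ContMDiff 𝓘(ℝ, E) 𝓘(ℝ, E) ∞ d ∧ d x = y ∧ ∀ z, p (d z) = p z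

omit [ChartedSpace E Y] in
/-- A local inverse of `p` composed with `p` is smooth. -/
lemma HasSmoothDeck.contMDiffAt {p : X → Y} (hd : HasSmoothDeck E p)
    (φ : OpenPartialHomeomorph X Y) (hφ : p = φ) {x : X}
    (hx : p x ∈ φ.target) : ContMDiffAt 𝓘(ℝ, E) 𝓘(ℝ, E) ∞ (fun z => φ.symm (p z)) x := by
  -- The map `φ⁻¹ ∘ p` sends `x` to a point of the same fibre. Near `x` it coincides with the deck
  -- transformation that does so, because `φ` is injective on its source.
  obtain ⟨d, hd1, hd2, hd3⟩ := hd x (φ.symm (p x)) (by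
    exact (φ.right_inv hx).symm.trans (congrFun hφ _).symm)
  refine hd1.contMDiffAt.congr_of_eventuallyEq ?_
  have h1 : ∀ᶠ z in 𝓝 x, d z ∈ φ.source := by
    refine hd1.continuous.continuousAt.eventually (φ.open_source.mem_nhds ?_)
    rw [hd2]; exact φ.map_target hx
  filter_upwards [h1] with z hz
  rw [← hd3 z, hφ, φ.left_inv hz]

/-- Between two pushed charts the transition map is `φ'⁻¹ ∘ p` read in charts of `X`, and this is
locally a deck transformation. -/
lemma HasPushedCharts.isManifold [IsManifold 𝓘(ℝ, E) ∞ X] {p : X → Y}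
    (h : HasPushedCharts E p) (hd : HasSmoothDeck E p) : IsManifold 𝓘(ℝ, E) ∞ Y := by
  refine isManifold_of_contDiffAt fun e he e' he' z hz => ?_
  obtain ⟨φ, c, hc, hφ, rfl⟩ := h e he
  obtain ⟨φ', c', hc', hφ', rfl⟩ := h e' he'
  have hc := IsManifold.subset_maximalAtlas (I := 𝓘(ℝ, E)) (n := ∞) hc
  have hc' := IsManifold.subset_maximalAtlas (I := 𝓘(ℝ, E)) (n := ∞) hc'
  simp only [OpenPartialHomeomorph.trans_source, OpenPartialHomeomorph.symm_source,
    OpenPartialHomeomorph.trans_target, Set.mem_inter_iff, Set.mem_preimage,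
    OpenPartialHomeomorph.coe_trans_symm, Function.comp_apply,
    OpenPartialHomeomorph.symm_symm] at hz
  rw [← hφ] at hz
  refine ContMDiffAt.contDiffAt ?_
  have e1 : ((φ.symm.trans c).symm.trans (φ'.symm.trans c') : E → E) =
      c' ∘ (fun x => φ'.symm (p x)) ∘ c.symm := by
    rw [hφ]; rfl
  rw [e1]
  exact (contMDiffAt_of_mem_maximalAtlas hc' hz.2.2).comp z
    ((hd.contMDiffAt φ' hφ' hz.2.1).comp z (contMDiffAt_symm_of_mem_maximalAtlas hc hz.1.1))

/-- In a pushed chart, `p` becomes a chart of `X` after `φ⁻¹ ∘ p`, and a local inverse `ψ⁻¹` of `p`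
is `ψ⁻¹ ∘ p ∘ φ⁻¹`. Both directions reduce to `HasSmoothDeck.contMDiffAt`. -/
lemma HasPushedCharts.isLocalDiffeomorph [IsManifold 𝓘(ℝ, E) ∞ X] {p : X → Y}
    (hp : IsLocalHomeomorph p) (h : HasPushedCharts E p) (hd : HasSmoothDeck E p) :
    IsLocalDiffeomorph 𝓘(ℝ, E) 𝓘(ℝ, E) ∞ p := by
  have := h.isManifold hd
  have hsmooth : ContMDiff 𝓘(ℝ, E) 𝓘(ℝ, E) ∞ p := by
    intro x
    obtain ⟨φ, c, hc, hφ, he⟩ := h (chartAt E (p x)) (chart_mem_atlas E (p x))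
    have hc := IsManifold.subset_maximalAtlas (I := 𝓘(ℝ, E)) (n := ∞) hc
    have hx := mem_chart_source E (p x)
    have h2 := contMDiffOn_chart_symm (I := 𝓘(ℝ, E)) (n := ∞) (x := p x)
    rw [he] at hx h2
    have h3 : ContMDiffAt 𝓘(ℝ, E) 𝓘(ℝ, E) ∞
        ((φ.symm.trans c).symm ∘ c ∘ fun z => φ.symm (p z)) x := by
      have h4 := (φ.symm.trans c).map_source hx
      exact (h2.contMDiffAt ((φ.symm.trans c).open_target.mem_nhds h4)).comp x
        ((contMDiffAt_of_mem_maximalAtlas hc hx.2).comp x (hd.contMDiffAt φ hφ hx.1))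
    refine h3.congr_of_eventuallyEq ?_
    filter_upwards [hp.continuous.continuousAt.eventually
      ((φ.symm.trans c).open_source.mem_nhds hx)] with z hz
    exact ((φ.symm.trans c).left_inv hz).symm
  intro x
  obtain ⟨ψ, hxψ, hψ⟩ := hp x
  refine isLocalDiffeomorphAt_of_partialHomeomorph ψ hxψ (fun z _ => congrFun hψ z)
    (hψ ▸ hsmooth.contMDiffOn) fun y hy => ContMDiffAt.contMDiffWithinAt ?_
  obtain ⟨φ, c, hc, hφ, he⟩ := h (chartAt E y) (chart_mem_atlas E y)
  have hc := IsManifold.subset_maximalAtlas (I := 𝓘(ℝ, E)) (n := ∞) hc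
  have hx := mem_chart_source E y
  have h2 := contMDiffOn_chart (I := 𝓘(ℝ, E)) (n := ∞) (x := y)
  rw [he] at hx h2
  have h3 : p (φ.symm y) = y := by rw [hφ]; exact φ.right_inv hx.1
  have h4 : ContMDiffAt 𝓘(ℝ, E) 𝓘(ℝ, E) ∞
      ((fun z => ψ.symm (p z)) ∘ c.symm ∘ (φ.symm.trans c)) y := by
    have h5 := (φ.symm.trans c).map_source hx
    have h6 : c.symm ((φ.symm.trans c) y) = φ.symm y := c.left_inv hx.2
    refine ContMDiffAt.comp y ?_ ((contMDiffAt_symm_of_mem_maximalAtlas hc (c.map_source hx.2)).comp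
      y (h2.contMDiffAt ((φ.symm.trans c).open_source.mem_nhds hx)))
    rw [Function.comp_apply, h6]
    exact hd.contMDiffAt ψ hψ (by rwa [h3])
  refine h4.congr_of_eventuallyEq ?_
  filter_upwards [(φ.symm.trans c).open_source.mem_nhds hx] with z hz
  have h6 : c.symm ((φ.symm.trans c) z) = φ.symm z := c.left_inv hz.2
  simp only [Function.comp_apply]
  rw [h6, hφ, φ.right_inv hz.1]

/-- A continuous map is smooth if its composition with a local diffeomorphism is. -/
lemma contMDiff_of_comp_isLocalDiffeomorph {f : X → Y} {q : Y → Z} (hf : Continuous f)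
    (hq : IsLocalDiffeomorph 𝓘(ℝ, E) 𝓘(ℝ, E) ∞ q)
    (hqf : ContMDiff 𝓘(ℝ, E) 𝓘(ℝ, E) ∞ (q ∘ f)) : ContMDiff 𝓘(ℝ, E) 𝓘(ℝ, E) ∞ f := by
  intro x
  obtain ⟨Φ, hx, hΦ⟩ := hq (f x)
  have h1 : ContMDiffAt 𝓘(ℝ, E) 𝓘(ℝ, E) ∞ (Φ.symm ∘ q ∘ f) x := by
    refine ContMDiffAt.comp x ?_ hqf.contMDiffAt
    refine Φ.symm.contMDiffOn.contMDiffAt (Φ.open_target.mem_nhds ?_)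
    rw [Function.comp_apply, hΦ hx]
    exact Φ.map_source hx
  refine h1.congr_of_eventuallyEq ?_
  filter_upwards [hf.continuousAt.eventually (Φ.open_source.mem_nhds hx)] with z hz
  rw [Function.comp_apply, Function.comp_apply, hΦ hz]
  exact (Φ.left_inv hz).symm

/-- A map is smooth if its composition with a surjective local diffeomorphism is. -/
lemma contMDiff_of_isLocalDiffeomorph_comp {p : X → Y} {f : Y → Z}
    (hp : IsLocalDiffeomorph 𝓘(ℝ, E) 𝓘(ℝ, E) ∞ p) (hs : Function.Surjective p)
    (hfp : ContMDiff 𝓘(ℝ, E) 𝓘(ℝ, E) ∞ (f ∘ p)) : ContMDiff 𝓘(ℝ, E) 𝓘(ℝ, E) ∞ f := by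
  intro y
  obtain ⟨x, rfl⟩ := hs y
  obtain ⟨Φ, hx, hΦ⟩ := hp x
  have hy : p x ∈ Φ.target := by rw [hΦ hx]; exact Φ.map_source hx
  have h1 : ContMDiffAt 𝓘(ℝ, E) 𝓘(ℝ, E) ∞ ((f ∘ p) ∘ Φ.symm) (p x) :=
    hfp.contMDiffAt.comp _ (Φ.symm.contMDiffOn.contMDiffAt (Φ.open_target.mem_nhds hy))
  refine h1.congr_of_eventuallyEq ?_
  filter_upwards [Φ.open_target.mem_nhds hy] with z hz
  have h2 : p (Φ.symm z) = z := by
    refine (hΦ (Φ.map_target hz)).trans ?_; exact Φ.right_inv hz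
  rw [Function.comp_apply, Function.comp_apply, h2]

end LocalHomeomorphManifold

/-! ### Entrywise smoothness of matrix-valued functions -/

section SmoothMatrices

variable {E : Type*} [NormedAddCommGroup E] [NormedSpace ℝ E] {n : ℕ}

/-- A matrix-valued function is smooth at a point if its entries are. -/
def SmoothMatAt (f : E → Mat n) (x : E) : Prop := ∀ i j, ContDiffAt ℝ ∞ (fun y => f y i j) x

lemma SmoothMatAt.const (A : Mat n) (x : E) : SmoothMatAt (fun _ => A) x :=
  fun _ _ => contDiffAt_const

lemma SmoothMatAt.add {f g : E → Mat n} {x : E} (hf : SmoothMatAt f x) (hg : SmoothMatAt g x) :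
    SmoothMatAt (fun y => f y + g y) x := fun i j => (hf i j).add (hg i j)

lemma SmoothMatAt.sub {f g : E → Mat n} {x : E} (hf : SmoothMatAt f x) (hg : SmoothMatAt g x) :
    SmoothMatAt (fun y => f y - g y) x := fun i j => (hf i j).sub (hg i j)

lemma SmoothMatAt.mul {f g : E → Mat n} {x : E} (hf : SmoothMatAt f x) (hg : SmoothMatAt g x) :
    SmoothMatAt (fun y => f y * g y) x := fun i j => by
  simp only [Matrix.mul_apply]
  exact ContDiffAt.sum fun k _ => (hf i k).mul (hg k j)

lemma SmoothMatAt.det {f : E → Mat n} {x : E} (hf : SmoothMatAt f x) :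
    ContDiffAt ℝ ∞ (fun y => (f y).det) x := by
  simp only [Matrix.det_apply']
  exact ContDiffAt.sum fun σ _ => contDiffAt_const.mul (contDiffAt_prod fun i _ => hf _ _)

/-- By Cramer's rule, each entry of the inverse is a determinant, with one row of the matrix
replaced by a constant vector, divided by the determinant. -/
lemma SmoothMatAt.inv {f : E → Mat n} {x : E} (hf : SmoothMatAt f x) (h : (f x).det ≠ 0) :
    SmoothMatAt (fun y => (f y)⁻¹) x := by
  intro i j
  simp only [Matrix.inv_def, Matrix.smul_apply, Ring.inverse_eq_inv', smul_eq_mul,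
    Matrix.adjugate_apply]
  refine (hf.det.inv h).mul (SmoothMatAt.det fun k l => ?_)
  by_cases hk : k = j
  · subst hk; simp only [Matrix.updateRow_self]; exact contDiffAt_const
  · simp only [Matrix.updateRow_ne hk]; exact hf k l

lemma SmoothMatAt.cay {f : E → Mat n} {x : E} (hf : SmoothMatAt f x) (h : (1 + f x).det ≠ 0) :
    SmoothMatAt (fun y => HypSpin.cay (f y)) x :=
  ((SmoothMatAt.const 1 x).sub hf).mul (((SmoothMatAt.const 1 x).add hf).inv h)

lemma SmoothMatAt.congr {f g : E → Mat n} {x : E} (hf : SmoothMatAt f x)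
    (h : ∀ᶠ y in 𝓝 x, g y = f y) : SmoothMatAt g x := fun i j =>
  (hf i j).congr_of_eventuallyEq (by filter_upwards [h] with y hy; rw [hy])

/-- The inclusion of `so(n,1)` in the space of matrices. -/
def soLie.matLin (n : ℕ) : soLie n →ₗ[ℝ] Mat n where
  toFun := soLie.mat
  map_add' _ _ := rfl
  map_smul' _ _ := rfl

lemma smoothMatAt_mat (X : soLie n) : SmoothMatAt (fun Y : soLie n => Y.mat) X := by
  intro i j
  let L : soLie n →ₗ[ℝ] ℝ := (LinearMap.proj j ∘ₗ LinearMap.proj i) ∘ₗ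
    (Matrix.ofLinearEquiv ℝ).symm.toLinearMap ∘ₗ soLie.matLin n
  exact (LinearMap.toContinuousLinearMap L).contDiff.contDiffAt

/-- A linear left inverse of the inclusion of `so(n,1)` in the matrices writes `f` as a combination
of its matrix entries with constant vector coefficients. -/
lemma contDiffAt_of_mat {f : E → soLie n} {x : E} (hf : SmoothMatAt (fun y => (f y).mat) x) :
    ContDiffAt ℝ ∞ f x := by
  obtain ⟨L, hL⟩ := (soLie.matLin n).exists_leftInverse_of_injective
    (LinearMap.ker_eq_bot.2 fun _ _ h => soLie.ext h)
  have h : f = fun y => ∑ i, ∑ j, (f y).mat i j • L (Matrix.single i j 1) := by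
    ext y : 1
    have h1 : L (soLie.matLin n (f y)) = f y := LinearMap.congr_fun hL (f y)
    conv_lhs => rw [← h1, Matrix.matrix_eq_sum_single (soLie.matLin n (f y))]
    simp only [map_sum]
    refine Finset.sum_congr rfl fun i _ => Finset.sum_congr rfl fun j _ => ?_
    rw [← map_smul, Matrix.smul_single, smul_eq_mul, mul_one]
    rfl
  rw [h]
  exact ContDiffAt.sum fun i _ => ContDiffAt.sum fun j _ => (hf i j).smul contDiffAt_const

end SmoothMatrices

/-! ### `SO⁺(n,1)` as a manifold with smooth translations -/

section SOPlusManifold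

variable {n : ℕ}

lemma mat_cayChart_symm {X : soLie n} (hX : X ∈ (cayChart n).target) :
    (((cayChart n).symm X : GL (Idx n) ℝ) : Mat n) = cay X.mat := by
  have h : (cayChart n).symm X = cayInv X hX.1 hX.2 := dif_pos hX
  rw [h]; rfl

/-- Two-sided translations are smooth in the Cayley charts. -/
lemma contDiffAt_cayChart_translate (a b : SOPlus n) {X : soLie n}
    (hX : X ∈ (cayChart n).target) (hX' : a * (cayChart n).symm X * b ∈ (cayChart n).source) :
    ContDiffAt ℝ ∞ (fun Y => cayChart n (a * (cayChart n).symm Y * b)) X := by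
  have h0 : SmoothMatAt (fun Y : soLie n =>
      (((a * (cayChart n).symm Y * b : SOPlus n) : GL (Idx n) ℝ) : Mat n)) X := by
    have h1 : SmoothMatAt (fun Y : soLie n => ((a : GL (Idx n) ℝ) : Mat n) * cay Y.mat *
        ((b : GL (Idx n) ℝ) : Mat n)) X :=
      ((SmoothMatAt.const _ X).mul ((smoothMatAt_mat X).cay hX.1)).mul (SmoothMatAt.const _ X)
    refine h1.congr ?_
    filter_upwards [(cayChart n).open_target.mem_nhds hX] with Y hY
    rw [← mat_cayChart_symm hY]
    rfl
  exact contDiffAt_of_mat (h0.cay hX')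

/-- The left translate of the Cayley chart centred at `g`. -/
def leftChart (g : SOPlus n) : OpenPartialHomeomorph (SOPlus n) (soLie n) :=
  (Homeomorph.mulLeft g⁻¹).transOpenPartialHomeomorph (cayChart n)

lemma leftChart_apply (g A : SOPlus n) : leftChart g A = cayChart n (g⁻¹ * A) := rfl

lemma leftChart_symm_apply (g : SOPlus n) (X : soLie n) :
    (leftChart g).symm X = g * (cayChart n).symm X :=
  congrArg (· * (cayChart n).symm X) (inv_inv g)

lemma mem_leftChart_source {g A : SOPlus n} :
    A ∈ (leftChart g).source ↔ g⁻¹ * A ∈ (cayChart n).source := Iff.rfl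

lemma leftChart_target (g : SOPlus n) : (leftChart g).target = (cayChart n).target := by
  rw [leftChart, Homeomorph.transOpenPartialHomeomorph_target]

lemma chartAt_SOPlus (A : SOPlus n) : chartAt (soLie n) A = leftChart A := rfl

lemma exists_leftChart {e : OpenPartialHomeomorph (SOPlus n) (soLie n)}
    (he : e ∈ atlas (soLie n) (SOPlus n)) : ∃ g, e = leftChart g := by
  obtain ⟨g, rfl⟩ := he
  exact ⟨g, rfl⟩

/-- The centres `g` and `h` of the charts are absorbed into the left factor, as `h⁻¹ a g`, which
reduces the claim to the Cayley chart at the identity. -/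
lemma contDiffAt_leftChart_translate (a b g h : SOPlus n) {X : soLie n}
    (hX : X ∈ (leftChart g).target) (hX' : a * (leftChart g).symm X * b ∈ (leftChart h).source) :
    ContDiffAt ℝ ∞ (fun Y => leftChart h (a * (leftChart g).symm Y * b)) X := by
  have e : ∀ Y, h⁻¹ * (a * (leftChart g).symm Y * b) =
      (h⁻¹ * a * g) * (cayChart n).symm Y * b := by
    intro Y
    rw [leftChart_symm_apply]
    simp only [mul_assoc]
  rw [mem_leftChart_source, e] at hX'
  rw [leftChart_target] at hX
  refine (contDiffAt_cayChart_translate (h⁻¹ * a * g) b hX hX').congr_of_eventuallyEq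
    (Filter.Eventually.of_forall fun Y => ?_)
  simp only
  rw [leftChart_apply, e]

instance isManifold_SOPlus : IsManifold 𝓘(ℝ, soLie n) ∞ (SOPlus n) := by
  refine isManifold_of_contDiffAt fun e he e' he' X hX => ?_
  obtain ⟨g, rfl⟩ := exists_leftChart he
  obtain ⟨h, rfl⟩ := exists_leftChart he'
  rw [OpenPartialHomeomorph.trans_source, OpenPartialHomeomorph.symm_source] at hX
  -- Chart transitions are the trivial translation.
  have e : ∀ Y, 1 * (leftChart g).symm Y * 1 = (leftChart g).symm Y := fun Y => by
    rw [one_mul, mul_one]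
  refine (contDiffAt_leftChart_translate 1 1 g h hX.1
    (by rw [e]; exact hX.2)).congr_of_eventuallyEq (Filter.Eventually.of_forall fun Y => ?_)
  simp only
  rw [e, OpenPartialHomeomorph.coe_trans, Function.comp_apply]

/-- Left factors serve for the deck transformations by `Γ`, right factors for the action of `SO(n)`.
-/
lemma contMDiff_translate (a b : SOPlus n) :
    ContMDiff 𝓘(ℝ, soLie n) 𝓘(ℝ, soLie n) ∞ (fun A : SOPlus n => a * A * b) := by
  intro A
  have hc := IsManifold.chart_mem_maximalAtlas (I := 𝓘(ℝ, soLie n)) (n := ∞) A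
  have hc' := IsManifold.chart_mem_maximalAtlas (I := 𝓘(ℝ, soLie n)) (n := ∞) (a * A * b)
  have hA := mem_chart_source (soLie n) A
  have hA' := mem_chart_source (soLie n) (a * A * b)
  rw [chartAt_SOPlus] at hc hc' hA hA'
  have h1 : (leftChart A).symm (leftChart A A) = A := (leftChart A).left_inv hA
  have h2 : ContMDiffAt 𝓘(ℝ, soLie n) 𝓘(ℝ, soLie n) ∞
      (fun X => leftChart (a * A * b) (a * (leftChart A).symm X * b)) (leftChart A A) :=
    (contDiffAt_leftChart_translate a b A (a * A * b) ((leftChart A).map_source hA)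
      (by rw [h1]; exact hA')).contMDiffAt
  have h3 : ContMDiffAt 𝓘(ℝ, soLie n) 𝓘(ℝ, soLie n) ∞
      ((leftChart (a * A * b)).symm ∘
        (fun X => leftChart (a * A * b) (a * (leftChart A).symm X * b)) ∘ leftChart A) A := by
    refine ContMDiffAt.comp A ?_ (h2.comp A (contMDiffAt_of_mem_maximalAtlas hc hA))
    refine contMDiffAt_symm_of_mem_maximalAtlas hc' ?_
    rw [Function.comp_apply, h1]
    exact (leftChart (a * A * b)).map_source hA'
  refine h3.congr_of_eventuallyEq ?_
  have h4 : Continuous fun B : SOPlus n => a * B * b :=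
    (continuous_const.mul continuous_id).mul continuous_const
  filter_upwards [(leftChart A).open_source.mem_nhds hA,
    h4.continuousAt.eventually ((leftChart (a * A * b)).open_source.mem_nhds hA')] with B hB hB'
  rw [Function.comp_apply, Function.comp_apply, (leftChart A).left_inv hB,
    (leftChart (a * A * b)).left_inv hB']

end SOPlusManifold

/-! ### The smooth structure of `Γ\SO⁺(n,1)` -/

section FrameBundleManifold

variable {n : ℕ} (Γ : Subgroup (SOPlus n)) [DiscreteTopology Γ]

/-- The covering projection `SO⁺(n,1) → Γ\SO⁺(n,1)`. -/
def frameMk (Γ : Subgroup (SOPlus n)) : SOPlus n → FrameBundle Γ := Quotient.mk _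

lemma frameMk_surjective (Γ : Subgroup (SOPlus n)) : Function.Surjective (frameMk Γ) :=
  Quotient.mk_surjective

lemma frameMk_eq_iff {Γ : Subgroup (SOPlus n)} {A B : SOPlus n} :
    frameMk Γ A = frameMk Γ B ↔ ∃ γ ∈ Γ, γ * B = A := by
  refine Quotient.eq.trans ⟨?_, ?_⟩
  · rintro ⟨γ, h⟩; exact ⟨γ, γ.2, h⟩
  · rintro ⟨γ, hγ, h⟩; exact ⟨⟨γ, hγ⟩, h⟩

instance continuousConstSMul_SOPlus (Γ : Subgroup (SOPlus n)) : ContinuousConstSMul Γ (SOPlus n) :=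
  ⟨fun γ => continuous_const_mul (γ : SOPlus n)⟩

lemma isQuotientCoveringMap_frameMk : IsQuotientCoveringMap (frameMk Γ) Γ :=
  isQuotientCoveringMap_quotientMk_of_properlyDiscontinuousSMul

lemma hasPushedCharts_frameMk : HasPushedCharts (soLie n) (frameMk Γ) := by
  rintro e ⟨q, rfl⟩
  -- The charts of the orbit space are local inverses of the covering followed by charts upstairs.
  refine ⟨(((isQuotientCoveringMap_frameMk Γ).isCoveringMap.isLocalHomeomorph).localInverseAt
    _).symm, _, chart_mem_atlas (soLie n) _, ?_, rfl⟩
  rw [IsLocalHomeomorph.localInverseAt_symm]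

lemma hasSmoothDeck_frameMk (Γ : Subgroup (SOPlus n)) :
    HasSmoothDeck (soLie n) (frameMk Γ) := by
  intro A B h
  obtain ⟨γ, hγ, rfl⟩ := frameMk_eq_iff.1 h
  refine ⟨fun C => γ⁻¹ * C * 1, contMDiff_translate _ _, by simp, fun C => ?_⟩
  exact frameMk_eq_iff.2 ⟨γ⁻¹, inv_mem hγ, (mul_one _).symm⟩

instance : IsManifold 𝓘(ℝ, soLie n) ∞ (FrameBundle Γ) :=
  (hasPushedCharts_frameMk Γ).isManifold (hasSmoothDeck_frameMk Γ)

lemma isLocalDiffeomorph_frameMk :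
    IsLocalDiffeomorph 𝓘(ℝ, soLie n) 𝓘(ℝ, soLie n) ∞ (frameMk Γ) :=
  (hasPushedCharts_frameMk Γ).isLocalDiffeomorph
    (isQuotientCoveringMap_frameMk Γ).isCoveringMap.isLocalHomeomorph (hasSmoothDeck_frameMk Γ)

open MulOpposite

lemma op_smul_frameMk (Γ : Subgroup (SOPlus n)) (A : SOPlus n) (B : SON n) :
    op B • frameMk Γ A = frameMk Γ (A * soHat n B) := rfl

lemma contMDiff_op_smul_frameBundle (B : SON n) :
    ContMDiff 𝓘(ℝ, soLie n) 𝓘(ℝ, soLie n) ∞ fun x : FrameBundle Γ => op B • x := by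
  refine contMDiff_of_isLocalDiffeomorph_comp (isLocalDiffeomorph_frameMk Γ)
    (frameMk_surjective Γ) ?_
  have h : (fun x : FrameBundle Γ => op B • x) ∘ frameMk Γ =
      frameMk Γ ∘ fun A => 1 * A * soHat n B := by
    ext A : 1
    rw [Function.comp_apply, Function.comp_apply, op_smul_frameMk, one_mul]
  rw [h]
  exact (isLocalDiffeomorph_frameMk Γ).contMDiff.comp (contMDiff_translate _ _)

end FrameBundleManifold

/-! ### Orbit maps of `Spin⁺(n,1)` and of `Hⁿ` -/

section SpinQuotientTopology

open MulOpposite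

variable {n : ℕ}

/-- The quotient map `Spin⁺(n,1) → Δ\Spin⁺(n,1)`. -/
def spinMk (Δ : Subgroup (SpinPlus n)) : SpinPlus n → SpinQuotient Δ := Quotient.mk _

lemma spinMk_surjective (Δ : Subgroup (SpinPlus n)) : Function.Surjective (spinMk Δ) :=
  Quotient.mk_surjective

lemma spinMk_eq_iff {Δ : Subgroup (SpinPlus n)} {g h : SpinPlus n} :
    spinMk Δ g = spinMk Δ h ↔ ∃ δ ∈ Δ, δ * h = g := by
  refine Quotient.eq.trans ⟨?_, ?_⟩
  · rintro ⟨δ, h⟩; exact ⟨δ, δ.2, h⟩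
  · rintro ⟨δ, hδ, h⟩; exact ⟨⟨δ, hδ⟩, h⟩

lemma op_smul_spinMk (Δ : Subgroup (SpinPlus n)) (g : SpinPlus n) (s : SpinN n) :
    op s • spinMk Δ g = spinMk Δ (g * spinHat n s) := rfl

/-- The quotient map `Hⁿ → Γ\Hⁿ`. -/
def hypMk (Γ : Subgroup (SOPlus n)) : Hyp n → SpaceForm Γ := Quotient.mk _

lemma hypMk_surjective (Γ : Subgroup (SOPlus n)) : Function.Surjective (hypMk Γ) :=
  Quotient.mk_surjective

lemma hypMk_eq_iff {Γ : Subgroup (SOPlus n)} {p q : Hyp n} :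
    hypMk Γ p = hypMk Γ q ↔ ∃ γ ∈ Γ, γ • q = p := by
  refine Quotient.eq.trans ⟨?_, ?_⟩
  · rintro ⟨γ, h⟩; exact ⟨γ, γ.2, h⟩
  · rintro ⟨γ, hγ, h⟩; exact ⟨⟨γ, hγ⟩, h⟩

lemma eq_one_of_smul_eq {Γ : Subgroup (SOPlus n)} [DiscreteTopology Γ]
    (hΓ : ∀ γ ∈ Γ, IsOfFinOrder γ → γ = 1) {γ : SOPlus n} (hγ : γ ∈ Γ) {p : Hyp n}
    (h : γ • p = p) : γ = 1 := by
  have := isCancelSMul_hyp Γ hΓ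
  have h1 : (⟨γ, hγ⟩ : Γ) • p = (1 : Γ) • p := by rw [one_smul]; exact h
  exact congrArg Subtype.val (IsCancelSMul.right_cancel _ _ p h1)

lemma isCoveringMap_hypMk (Γ : Subgroup (SOPlus n)) [DiscreteTopology Γ]
    (hΓ : ∀ γ ∈ Γ, IsOfFinOrder γ → γ = 1) : IsCoveringMap (hypMk Γ) :=
  have := isCancelSMul_hyp Γ hΓ
  (isQuotientCoveringMap_quotientMk_of_properlyDiscontinuousSMul (E := Hyp n)
    (G := Γ)).isCoveringMap

end SpinQuotientTopology

/-! ### A lift of `Γ` gives a spin structure -/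

section Induced

open MulOpposite

variable {n : ℕ} {Γ : Subgroup (SOPlus n)} {Δ : Subgroup (SpinPlus n)}

lemma inducedMap_spinMk (h : MapsIsomorphicallyOnto Δ Γ) (g : SpinPlus n) :
    inducedMap h (spinMk Δ g) = frameMk Γ (eta n g) := rfl

lemma MapsIsomorphicallyOnto.eta_mem (h : MapsIsomorphicallyOnto Δ Γ) {δ : SpinPlus n}
    (hδ : δ ∈ Δ) : eta n δ ∈ Γ := h.2 ▸ Subgroup.mem_map_of_mem (eta n) hδ

lemma MapsIsomorphicallyOnto.exists_eta_eq (h : MapsIsomorphicallyOnto Δ Γ) {γ : SOPlus n}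
    (hγ : γ ∈ Γ) : ∃ δ ∈ Δ, eta n δ = γ := by
  rw [← h.2] at hγ
  exact hγ

lemma MapsIsomorphicallyOnto.eq_one (h : MapsIsomorphicallyOnto Δ Γ) {δ : SpinPlus n}
    (hδ : δ ∈ Δ) (h1 : eta n δ = 1) : δ = 1 :=
  h.1 hδ Δ.one_mem (h1.trans (map_one (eta n)).symm)

/-- Openness of the quotient map keeps its product with the identity of `Spin(n)` a quotient map, so
continuity can be tested on `Spin⁺(n,1) × Spin(n)`. -/
lemma continuous_smul_spinQuotient (Δ : Subgroup (SpinPlus n)) (hq : IsOpenQuotientMap (spinMk Δ)) :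
    Continuous fun z : SpinQuotient Δ × SpinN n => op z.2 • z.1 := by
  have h1 : IsOpenQuotientMap (Prod.map (spinMk Δ) (id : SpinN n → SpinN n)) :=
    hq.prodMap IsOpenQuotientMap.id
  rw [← h1.continuous_comp_iff]
  exact hq.continuous.comp (continuous_fst.mul ((continuous_spinHat n).comp continuous_snd))

variable [DiscreteTopology Γ] [NeZero n]

-- `Δ` is discrete because `η` injects it continuously into the discrete group `Γ`.
omit [NeZero n] in
lemma MapsIsomorphicallyOnto.isCoveringMap_spinMk (h : MapsIsomorphicallyOnto Δ Γ) :
    IsCoveringMap (spinMk Δ) := by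
  have hd : DiscreteTopology Δ :=
    DiscreteTopology.of_continuous_injective (β := Γ)
      (f := fun δ => ⟨eta n δ, h.eta_mem δ.2⟩)
      (((continuous_eta n).comp continuous_subtype_val).subtype_mk _)
      fun δ δ' hδ => Subtype.ext (h.1 δ.2 δ'.2 (congrArg Subtype.val hδ))
  refine (Topology.IsQuotientMap.isQuotientCoveringMap_of_subgroup (f := spinMk Δ)
    isQuotientMap_quotient_mk' Δ ⟨hd⟩ ?_).isCoveringMap
  intro g g'
  rw [eq_comm, spinMk_eq_iff]
  constructor
  · rintro ⟨δ, hδ, rfl⟩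
    rwa [mul_inv_cancel_right]
  · exact fun h => ⟨_, h, inv_mul_cancel_right _ _⟩

/-- A fixed point gives `δ g = g ŝ`, so `η(δ)` fixes the point `η(g)e_{n+1}` of `Hⁿ`.
Torsion-freeness gives `η(δ) = 1`, and injectivity of `η` on `Δ` gives `δ = 1`, hence `ŝ = 1`. -/
lemma MapsIsomorphicallyOnto.smul_free (h : MapsIsomorphicallyOnto Δ Γ)
    (hΓ : ∀ γ ∈ Γ, IsOfFinOrder γ → γ = 1) {x : SpinQuotient Δ} {s : SpinN n}
    (hx : op s • x = x) : s = 1 := by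
  obtain ⟨g, rfl⟩ := spinMk_surjective Δ x
  rw [op_smul_spinMk, spinMk_eq_iff] at hx
  obtain ⟨δ, hδ, e⟩ := hx
  have h1 : δ = 1 := h.eq_one hδ (eq_one_of_smul_eq hΓ (h.eta_mem hδ) (p := eta n g • basePoint n)
    (by rw [← mul_smul, ← map_mul, e, eta_mul_spinHat_smul]))
  apply (isEmbedding_spinHat n).injective
  rw [h1, one_mul, left_eq_mul] at e
  rw [e, map_one]

lemma sigma_negOne (n : ℕ) [NeZero n] : sigma n (negOne n) = 1 := by
  apply (isEmbedding_soHat n).injective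
  rw [← eta_spinHat, map_one]
  exact eta_negOnePlus n

lemma sigma_eq_one_iff {s : SpinN n} : sigma n s = 1 ↔ s = 1 ∨ s = negOne n := by
  rw [← (isEmbedding_soHat n).injective.eq_iff, ← eta_spinHat, map_one, eta_eq_one_iff,
    ← (isEmbedding_spinHat n).injective.eq_iff, map_one,
    ← (isEmbedding_spinHat n).injective.eq_iff (a := s) (b := negOne n)]

omit [DiscreteTopology Γ] in
lemma MapsIsomorphicallyOnto.inducedMap_eq_iff (h : MapsIsomorphicallyOnto Δ Γ)
    {x y : SpinQuotient Δ} :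
    inducedMap h x = inducedMap h y ↔ x = y ∨ x = op (negOne n) • y := by
  obtain ⟨g, rfl⟩ := spinMk_surjective Δ x
  obtain ⟨g', rfl⟩ := spinMk_surjective Δ y
  rw [inducedMap_spinMk, inducedMap_spinMk, frameMk_eq_iff, op_smul_spinMk, spinMk_eq_iff,
    spinMk_eq_iff]
  constructor
  · rintro ⟨γ, hγ, e⟩
    obtain ⟨δ, hδ, rfl⟩ := h.exists_eta_eq hγ
    rw [← map_mul, eta_eq_iff] at e
    rcases e with e | e
    · exact Or.inl ⟨δ, hδ, e⟩
    · refine Or.inr ⟨δ, hδ, ?_⟩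
      change δ * (g' * negOnePlus n) = g
      rw [← mul_assoc, e, mul_assoc, negOnePlus_mul_self, mul_one]
  · rintro (⟨δ, hδ, rfl⟩ | ⟨δ, hδ, rfl⟩)
    · exact ⟨eta n δ, h.eta_mem hδ, (map_mul _ _ _).symm⟩
    · refine ⟨eta n δ, h.eta_mem hδ, ?_⟩
      rw [map_mul, map_mul]
      change _ = _ * (_ * eta n (negOnePlus n))
      rw [eta_negOnePlus, mul_one]

/-- The composite with `spinMk Δ` is `η` followed by the covering `frameMk Γ`; the surjective local
homeomorphism `spinMk Δ` can be cancelled on the right. -/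
lemma MapsIsomorphicallyOnto.isLocalHomeomorph_inducedMap (h : MapsIsomorphicallyOnto Δ Γ) :
    IsLocalHomeomorph (inducedMap h) := by
  have h1 : IsLocalHomeomorph (inducedMap h ∘ spinMk Δ) :=
    (isQuotientCoveringMap_frameMk Γ).isCoveringMap.isLocalHomeomorph.comp
      (isCoveringMap_eta n).isLocalHomeomorph
  rw [isLocalHomeomorph_iff_isLocalHomeomorphOn_univ, ← (spinMk_surjective Δ).range_eq,
    ← Set.image_univ]
  exact h1.isLocalHomeomorphOn.of_comp_right h.isCoveringMap_spinMk.isLocalHomeomorph.isLocalHomeomorphOn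

/-- The map is the quotient by the action of `ker σ = {±1}`. Local injectivity makes any element
that returns a point to a small neighbourhood fix that point, and the action is free. -/
lemma MapsIsomorphicallyOnto.isCoveringMap_inducedMap (h : MapsIsomorphicallyOnto Δ Γ)
    (hΓ : ∀ γ ∈ Γ, IsOfFinOrder γ → γ = 1) : IsCoveringMap (inducedMap h) := by
  have hsurj : Function.Surjective (inducedMap h) := by
    intro y
    obtain ⟨A, rfl⟩ := frameMk_surjective Γ y
    obtain ⟨g, rfl⟩ := eta_surjective n A
    exact ⟨spinMk Δ g, rfl⟩
  have hl := h.isLocalHomeomorph_inducedMap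
  have hq : IsOpenQuotientMap (spinMk Δ) :=
    ⟨spinMk_surjective Δ, h.isCoveringMap_spinMk.continuous, h.isCoveringMap_spinMk.isOpenMap⟩
  have hc := continuous_smul_spinQuotient Δ hq
  have key : IsQuotientCoveringMap (inducedMap h) (sigma n).ker.op :=
    { toIsQuotientMap := hl.isOpenMap.isQuotientMap hl.continuous hsurj
      continuous_const_smul := fun s =>
        hc.comp (continuous_id.prodMk (continuous_const (y := unop s.1)))
      apply_eq_iff_mem_orbit := by
        intro x y
        rw [h.inducedMap_eq_iff]
        constructor
        · rintro (rfl | rfl)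
          · exact MulAction.mem_orbit_self _
          · exact ⟨⟨op (negOne n), sigma_negOne n⟩, rfl⟩
        · rintro ⟨⟨s, hs⟩, rfl⟩
          rcases sigma_eq_one_iff.1 (show sigma n (unop s) = 1 from hs) with e | e
          · refine Or.inl ?_
            change s • y = y
            rw [← op_unop s, e, op_one, one_smul]
          · refine Or.inr ?_
            change s • y = _
            rw [← e, op_unop]
      disjoint := by
        intro x
        obtain ⟨U, hU, hxU, hinj⟩ := hl.isLocallyInjective x
        refine ⟨U, hU.mem_nhds hxU, ?_⟩
        rintro ⟨s, hs⟩ ⟨_, ⟨u, hu, rfl⟩, hu'⟩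
        have e : s • u = u := by
          refine hinj hu' hu ?_
          rw [h.inducedMap_eq_iff]
          rcases sigma_eq_one_iff.1 (show sigma n (unop s) = 1 from hs) with e | e
          · refine Or.inl ?_
            change s • u = u
            rw [← op_unop s, e, op_one, one_smul]
          · refine Or.inr ?_
            change s • u = _
            rw [← e, op_unop]
        exact Subtype.ext (unop_injective (h.smul_free hΓ (s := unop s) e)) }
  exact key.isCoveringMap

/-- The polar decomposition gives a map `T : Hⁿ × Spin(n) → Δ\Spin⁺(n,1)`. Over an open set
`φ.source` on which `Hⁿ → Γ\Hⁿ` is injective, `T` is injective and fills the preimage of `φ.target`.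
The trivialization inverts `T` and applies `φ` to the first factor; it is equivariant because `T`
is. -/
lemma MapsIsomorphicallyOnto.exists_trivialization (h : MapsIsomorphicallyOnto Δ Γ)
    (hΓ : ∀ γ ∈ Γ, IsOfFinOrder γ → γ = 1) (b : SpaceForm Γ) :
    ∃ e : Bundle.Trivialization (SpinN n) (frameProj Γ ∘ inducedMap h), b ∈ e.baseSet ∧
      ∀ x, (frameProj Γ ∘ inducedMap h) x ∈ e.baseSet → ∀ s : SpinN n,
        (e (op s • x)).2 = (e x).2 * s := by
  obtain ⟨p, rfl⟩ := hypMk_surjective Γ b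
  obtain ⟨φ, hp, hφ⟩ := (isCoveringMap_hypMk Γ hΓ).isLocalHomeomorph p
  set T : Hyp n × SpinN n → SpinQuotient Δ := fun z => spinMk Δ (boost n z.1 * spinHat n z.2)
    with hT
  have hTcov : IsLocalHomeomorph T :=
    h.isCoveringMap_spinMk.isLocalHomeomorph.comp (polarHomeo n).symm.isLocalHomeomorph
  have hπ : ∀ g, (frameProj Γ ∘ inducedMap h) (spinMk Δ g) = φ (eta n g • basePoint n) :=
    fun g => by rw [← hφ]; rfl
  have hπT : ∀ z, (frameProj Γ ∘ inducedMap h) (T z) = φ z.1 := fun z => by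
    rw [hT, hπ, eta_mul_spinHat_smul, eta_boost_smul]
  have hTs : ∀ z s, op s • T z = T (z.1, z.2 * s) := fun z s => by
    simp only [hT, op_smul_spinMk, map_mul, mul_assoc]
  have hinj : Set.InjOn T (φ.source ×ˢ Set.univ) := by
    rintro ⟨q, s⟩ hq ⟨q', s'⟩ hq' e
    have e1 : q = q' := φ.injOn hq.1 hq'.1 (by
      rw [← hπT (q, s), ← hπT (q', s'), e])
    subst e1
    obtain ⟨δ, hδ, e2⟩ := spinMk_eq_iff.1 e
    have h1 : δ = 1 := h.eq_one hδ (eq_one_of_smul_eq hΓ (h.eta_mem hδ) (p := q) (by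
      have := congrArg (fun g => eta n g • basePoint n) e2
      simpa only [map_mul (eta n) δ, mul_smul, eta_mul_spinHat_smul, eta_boost_smul] using this))
    rw [h1, one_mul, mul_right_inj] at e2
    exact Prod.ext rfl ((isEmbedding_spinHat n).injective e2).symm
  have himg : T '' (φ.source ×ˢ Set.univ) = (frameProj Γ ∘ inducedMap h) ⁻¹' φ.target := by
    ext x
    constructor
    · rintro ⟨z, hz, rfl⟩
      rw [Set.mem_preimage, hπT]
      exact φ.map_source hz.1
    · intro hx
      obtain ⟨g, rfl⟩ := spinMk_surjective Δ x
      rw [Set.mem_preimage, hπ] at hx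
      have e : hypMk Γ (φ.symm (φ (eta n g • basePoint n))) = hypMk Γ (eta n g • basePoint n) := by
        rw [hφ, φ.right_inv hx]
      -- The representative `g` is moved by a lift in `Δ` of the `γ` that carries its point into the
      -- chosen sheet `φ.source`.
      obtain ⟨γ, hγ, e⟩ := hypMk_eq_iff.1 e
      obtain ⟨δ, hδ, rfl⟩ := h.exists_eta_eq hγ
      refine ⟨polarHomeo n (δ * g), ⟨?_, trivial⟩, ?_⟩
      · change eta n (δ * g) • basePoint n ∈ φ.source
        rw [map_mul, mul_smul, e]
        exact φ.map_target hx
      · change spinMk Δ (boost n (eta n (δ * g) • basePoint n) * spinHat n (rot n (δ * g))) = _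
        rw [boost_mul_rot]
        exact spinMk_eq_iff.2 ⟨δ, hδ, rfl⟩
  let τ : OpenPartialHomeomorph (Hyp n × SpinN n) (SpinQuotient Δ) :=
    OpenPartialHomeomorph.ofContinuousOpen (hinj.toPartialEquiv T _)
      hTcov.continuous.continuousOn hTcov.isOpenMap (φ.open_source.prod isOpen_univ)
  have hτT : ∀ z, τ z = T z := fun z => rfl
  have hτs : τ.source = φ.source ×ˢ Set.univ := rfl
  have hτt : τ.target = (frameProj Γ ∘ inducedMap h) ⁻¹' φ.target := himg
  let e₀ := τ.symm.trans (φ.prod (OpenPartialHomeomorph.refl (SpinN n)))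
  have he₀ : ∀ z ∈ τ.source, e₀ (τ z) = (φ z.1, z.2) := fun z hz => by
    simp only [e₀, OpenPartialHomeomorph.coe_trans, Function.comp_apply]
    rw [τ.left_inv hz]
    rfl
  have hsource : e₀.source = τ.target := by
    simp only [e₀, OpenPartialHomeomorph.trans_source, OpenPartialHomeomorph.symm_source]
    refine Set.inter_eq_left.2 fun x hx => ?_
    have := τ.map_target hx
    rw [hτs] at this
    exact this
  have htarget : e₀.target = φ.target ×ˢ Set.univ := by
    simp only [e₀, OpenPartialHomeomorph.trans_target, OpenPartialHomeomorph.symm_target]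
    refine Set.inter_eq_left.2 fun x hx => ?_
    rw [Set.mem_preimage, hτs]
    exact ⟨φ.map_target hx.1, trivial⟩
  have hx : ∀ x, (frameProj Γ ∘ inducedMap h) x ∈ φ.target → ∃ z ∈ τ.source, τ z = x := by
    intro x hx
    have hx' : x ∈ τ.target := by rw [hτt]; exact hx
    exact ⟨τ.symm x, τ.map_target hx', τ.right_inv hx'⟩
  refine ⟨{ toOpenPartialHomeomorph := e₀
            baseSet := φ.target
            open_baseSet := φ.open_target
            source_eq := hsource.trans hτt
            target_eq := htarget
            proj_toFun := ?_ }, by rw [hφ]; exact φ.map_source hp, ?_⟩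
  · intro x hx'
    rw [hsource, hτt] at hx'
    obtain ⟨z, hz, rfl⟩ := hx x hx'
    rw [he₀ z hz, hτT, hπT]
  · intro x hx' s
    obtain ⟨z, hz, rfl⟩ := hx x hx'
    change (e₀ _).2 = (e₀ _).2 * s
    rw [he₀ z hz, hτT, hTs, ← hτT, he₀ _ (by rw [hτs] at hz ⊢; exact ⟨hz.1, trivial⟩)]

lemma MapsIsomorphicallyOnto.exists_isSpinStructure (h : MapsIsomorphicallyOnto Δ Γ)
    (hΓ : ∀ γ ∈ Γ, IsOfFinOrder γ → γ = 1) :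
    ∃ _ : ChartedSpace (soLie n) (SpinQuotient Δ), IsSpinStructure Γ (inducedMap h) := by
  obtain ⟨c, hc⟩ := exists_hasLiftedCharts (E := soLie n) h.isLocalHomeomorph_inducedMap
  have hm := hc.isManifold
  have hq : IsOpenQuotientMap (spinMk Δ) :=
    ⟨spinMk_surjective Δ, h.isCoveringMap_spinMk.continuous, h.isCoveringMap_spinMk.isOpenMap⟩
  have hcont := continuous_smul_spinQuotient Δ hq
  have heq : ∀ (x : SpinQuotient Δ) (s : SpinN n),
      inducedMap h (op s • x) = op (sigma n s) • inducedMap h x := by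
    intro x s
    obtain ⟨g, rfl⟩ := spinMk_surjective Δ x
    rw [op_smul_spinMk, inducedMap_spinMk, inducedMap_spinMk, op_smul_frameMk, map_mul, eta_spinHat]
  refine ⟨c, hm, h.isCoveringMap_inducedMap hΓ, ?_, hc.isLocalDiffeomorph, ?_, ?_, heq⟩
  · intro y
    obtain ⟨A, rfl⟩ := frameMk_surjective Γ y
    obtain ⟨g, rfl⟩ := eta_surjective n A
    have e : inducedMap h ⁻¹' {frameMk Γ (eta n g)} =
        {spinMk Δ g, op (negOne n) • spinMk Δ g} := by
      ext x
      rw [← inducedMap_spinMk h]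
      exact h.inducedMap_eq_iff
    rw [e]
    exact Set.ncard_pair fun e => negOne_ne_one n (h.smul_free hΓ e.symm)
  · refine ⟨hcont, ?_, h.exists_trivialization hΓ⟩
    intro x s
    obtain ⟨g, rfl⟩ := spinMk_surjective Δ x
    change hypMk Γ (eta n (g * spinHat n s) • basePoint n) = hypMk Γ (eta n g • basePoint n)
    rw [eta_mul_spinHat_smul]
  · intro s
    -- The action of `s` covers the action of `σ(s)` on the frame bundle, whose smoothness is known.
    refine contMDiff_of_comp_isLocalDiffeomorph
      (hcont.comp (continuous_id.prodMk (continuous_const (y := s)))) hc.isLocalDiffeomorph ?_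
    have e : inducedMap h ∘ (fun x => op s • x) =
        (fun y => op (sigma n s) • y) ∘ inducedMap h := funext fun x => heq x s
    exact e ▸ (contMDiff_op_smul_frameBundle Γ (sigma n s)).comp hc.isLocalDiffeomorph.contMDiff

end Induced

/-! ### Developing maps of spin structures -/

section Developing

open MulOpposite

variable {n : ℕ} {Γ : Subgroup (SOPlus n)} {P : Type} [TopologicalSpace P]
  [MulAction (SpinN n)ᵐᵒᵖ P] {ρ : P → FrameBundle Γ}

/-- A developing map of `ρ : P → Γ\SO⁺(n,1)`: a `Spin(n)`-equivariant map `Spin⁺(n,1) → P` over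
`η`. -/
structure IsDevelopingMap (ρ : P → FrameBundle Γ) (Ψ : SpinPlus n → P) : Prop where
  continuous : Continuous Ψ
  lifts : ∀ g, ρ (Ψ g) = frameMk Γ (eta n g)
  equivariant : ∀ (g : SpinPlus n) (s : SpinN n), Ψ (g * spinHat n s) = op s • Ψ g

/-- The subgroup of all `δ` that leave `Ψ` invariant by left translation. -/
def leftStabilizer (Ψ : SpinPlus n → P) : Subgroup (SpinPlus n) where
  carrier := {δ | ∀ g, Ψ (δ * g) = Ψ g}
  one_mem' g := by rw [one_mul]
  mul_mem' {a b} ha hb g := by rw [mul_assoc, ha, hb]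
  inv_mem' {a} ha g := by rw [← ha, mul_inv_cancel_left]

omit [TopologicalSpace P] [MulAction (SpinN n)ᵐᵒᵖ P] in
lemma mem_leftStabilizer {Ψ : SpinPlus n → P} {δ : SpinPlus n} :
    δ ∈ leftStabilizer Ψ ↔ ∀ g, Ψ (δ * g) = Ψ g := Iff.rfl

lemma IsDevelopingMap.comp_mul_left {Ψ : SpinPlus n → P} (hΨ : IsDevelopingMap ρ Ψ)
    {δ : SpinPlus n} (hδ : eta n δ ∈ Γ) : IsDevelopingMap ρ fun g => Ψ (δ * g) where
  continuous := hΨ.continuous.comp (continuous_const_mul δ)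
  lifts g := by
    rw [hΨ.lifts, map_mul]
    exact frameMk_eq_iff.2 ⟨_, hδ, rfl⟩
  equivariant g s := by rw [← mul_assoc, hΨ.equivariant]

variable [DiscreteTopology Γ] [ChartedSpace (soLie n) P]

lemma IsSpinStructure.smul_free (h : IsSpinStructure Γ ρ) {x : P} {s : SpinN n}
    (hx : op s • x = x) : s = 1 := by
  obtain ⟨e, he, hes⟩ := h.isPrincipalBundle.locally_trivial ((frameProj Γ ∘ ρ) x)
  have h1 := hes x he s
  rw [hx, left_eq_mul] at h1
  exact h1

lemma IsSpinStructure.continuous_const_smul (h : IsSpinStructure Γ ρ) (s : SpinN n) :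
    Continuous fun x : P => op s • x :=
  h.isPrincipalBundle.continuous_action.comp (continuous_id.prodMk (continuous_const (y := s)))

lemma IsSpinStructure.surjective (h : IsSpinStructure Γ ρ) : Function.Surjective ρ := by
  intro y
  have h1 : (ρ ⁻¹' {y}).Nonempty := by
    rw [Set.nonempty_iff_ne_empty]
    intro e
    have := h.two_sheeted y
    rw [e, Set.ncard_empty] at this
    omega
  exact h1

variable [NeZero n]

lemma IsSpinStructure.smul_negOne_ne (h : IsSpinStructure Γ ρ) (x : P) :
    op (negOne n) • x ≠ x := fun e => negOne_ne_one n (h.smul_free e)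

omit [TopologicalSpace P] [ChartedSpace (soLie n) P] in
lemma smul_negOne_smul_negOne (x : P) : op (negOne n) • op (negOne n) • x = x := by
  rw [smul_smul, ← op_mul, negOne_mul_self, op_one, one_smul]

lemma IsSpinStructure.map_smul_negOne (h : IsSpinStructure Γ ρ) (x : P) :
    ρ (op (negOne n) • x) = ρ x := by
  rw [h.equivariant, sigma_negOne, op_one, one_smul]

/-- `-1` lies in the kernel of `σ` and acts without fixed points, so `y` and its translate exhaust
the two-point fibre. -/
lemma IsSpinStructure.eq_or_eq (h : IsSpinStructure Γ ρ) {x y : P} (hxy : ρ x = ρ y) :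
    x = y ∨ x = op (negOne n) • y := by
  have h1 : ({y, op (negOne n) • y} : Set P) = ρ ⁻¹' {ρ y} := by
    have h2 := h.two_sheeted (ρ y)
    refine Set.eq_of_subset_of_ncard_le ?_ ?_ (Set.finite_of_ncard_ne_zero (by omega))
    · rintro z (rfl | rfl)
      · rfl
      · exact h.map_smul_negOne y
    · rw [h2, Set.ncard_pair (h.smul_negOne_ne y).symm]
  have h3 : x ∈ ρ ⁻¹' {ρ y} := hxy
  rw [← h1] at h3
  exact h3

/-- Since `Hⁿ` is simply connected and locally path connected, the map `p ↦ Γ η(boost p)` lifts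
through `ρ`. The lift `β` gives the values on boosts, and the rotation factor of `g` supplies the
rest by equivariance. -/
lemma IsSpinStructure.exists_isDevelopingMap (h : IsSpinStructure Γ ρ) :
    ∃ Ψ, IsDevelopingMap ρ Ψ := by
  obtain ⟨x₀, hx₀⟩ := h.surjective (frameMk Γ (eta n (boost n (basePoint n))))
  have hf : Continuous fun p => frameMk Γ (eta n (boost n p)) :=
    (isQuotientCoveringMap_frameMk Γ).isCoveringMap.continuous.comp
      ((continuous_eta n).comp (continuous_boost n))
  obtain ⟨β, ⟨-, hβ⟩, -⟩ := h.isCoveringMap.existsUnique_continuousMap_lifts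
    ⟨_, hf⟩ (basePoint n) x₀ hx₀
  have hβ' : ∀ p, ρ (β p) = frameMk Γ (eta n (boost n p)) := fun p => congrFun hβ p
  refine ⟨fun g => op (rot n g) • β (eta n g • basePoint n), ?_, fun g => ?_, fun g s => ?_⟩
  · exact h.isPrincipalBundle.continuous_action.comp
      ((β.continuous.comp ((continuous_eta n).smul continuous_const)).prodMk (continuous_rot n))
  · rw [h.equivariant, hβ', op_smul_frameMk, ← eta_spinHat, ← map_mul, boost_mul_rot]
  · rw [rot_mul_spinHat, eta_mul_spinHat_smul, op_mul, mul_smul]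

namespace IsDevelopingMap

variable {Ψ Ψ' : SpinPlus n → P}

omit [DiscreteTopology Γ] [ChartedSpace (soLie n) P] in
lemma apply_mul_negOnePlus (hΨ : IsDevelopingMap ρ Ψ) (g : SpinPlus n) :
    Ψ (g * negOnePlus n) = op (negOne n) • Ψ g := hΨ.equivariant g (negOne n)

lemma smul_negOne (h : IsSpinStructure Γ ρ) (hΨ : IsDevelopingMap ρ Ψ) :
    IsDevelopingMap ρ fun g => op (negOne n) • Ψ g where
  continuous := (h.continuous_const_smul _).comp hΨ.continuous
  lifts g := by rw [h.map_smul_negOne, hΨ.lifts]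
  equivariant g s := by
    rw [← hΨ.apply_mul_negOnePlus, ← hΨ.apply_mul_negOnePlus, ← hΨ.equivariant, mul_assoc,
      mul_assoc, negOnePlus_mul_comm]

omit [DiscreteTopology Γ] [ChartedSpace (soLie n) P] in
lemma apply_eq (hΨ : IsDevelopingMap ρ Ψ) (g : SpinPlus n) :
    Ψ g = op (rot n g) • Ψ (boost n (eta n g • basePoint n)) := by
  rw [← hΨ.equivariant, boost_mul_rot]

/-- Equivariance reduces both maps to the boosts, where they are lifts of one map on the connected
space `Hⁿ`. Agreement at `g` cancels to agreement at its boost factor. -/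
lemma eq_of_apply_eq (h : IsSpinStructure Γ ρ) (hΨ : IsDevelopingMap ρ Ψ)
    (hΨ' : IsDevelopingMap ρ Ψ') {g : SpinPlus n} (hg : Ψ g = Ψ' g) : Ψ = Ψ' := by
  have h1 : Ψ ∘ boost n = Ψ' ∘ boost n := by
    refine h.isCoveringMap.eq_of_comp_eq (hΨ.continuous.comp (continuous_boost n))
      (hΨ'.continuous.comp (continuous_boost n)) ?_ (eta n g • basePoint n) ?_
    · ext p : 1
      simp only [Function.comp_apply, hΨ.lifts, hΨ'.lifts]
    · rw [hΨ.apply_eq, hΨ'.apply_eq] at hg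
      exact smul_left_cancel _ hg
  ext g : 1
  rw [hΨ.apply_eq, hΨ'.apply_eq]
  exact congrArg _ (congrFun h1 _)

lemma mem_leftStabilizer_iff (h : IsSpinStructure Γ ρ) (hΨ : IsDevelopingMap ρ Ψ)
    {δ : SpinPlus n} (hδ : eta n δ ∈ Γ) : δ ∈ leftStabilizer Ψ ↔ Ψ δ = Ψ 1 := by
  constructor
  · intro hm
    rw [← hm 1, mul_one]
  · intro e g
    refine congrFun (eq_of_apply_eq h (hΨ.comp_mul_left hδ) hΨ (g := 1) ?_) g
    rw [mul_one, e]

/-- For a lift `δ` of `γ ∈ Γ`, the points `Ψ δ` and `Ψ 1` share a fibre of `ρ`, so they agree up to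
`-1`. Hence one of `±δ` stabilizes `Ψ`, and only one, because `-1` moves every point of `P`. -/
lemma mapsIsomorphicallyOnto (h : IsSpinStructure Γ ρ) (hΨ : IsDevelopingMap ρ Ψ) :
    MapsIsomorphicallyOnto (leftStabilizer Ψ) Γ := by
  constructor
  · intro δ hδ δ' hδ' e
    rcases (eta_eq_iff n).1 e with e | e
    · exact e
    · have h1 : Ψ δ = Ψ 1 := by rw [← hδ 1, mul_one]
      have h2 : Ψ δ' = Ψ 1 := by rw [← hδ' 1, mul_one]
      rw [e, hΨ.apply_mul_negOnePlus, h2] at h1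
      exact absurd h1 (h.smul_negOne_ne _)
  · ext γ
    constructor
    · rintro ⟨δ, hδ, rfl⟩
      have h1 : Ψ δ = Ψ 1 := by rw [← hδ 1, mul_one]
      have h2 := congrArg ρ h1
      rw [hΨ.lifts, hΨ.lifts, map_one, frameMk_eq_iff] at h2
      obtain ⟨γ, hγ, e⟩ := h2
      rwa [← e, mul_one]
    · intro hγ
      obtain ⟨δ, rfl⟩ := eta_surjective n γ
      have h1 : ρ (Ψ δ) = ρ (Ψ 1) := by
        rw [hΨ.lifts, hΨ.lifts, map_one, frameMk_eq_iff]
        exact ⟨_, hγ, mul_one _⟩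
      rcases h.eq_or_eq h1 with e | e
      · exact ⟨δ, (mem_leftStabilizer_iff h hΨ hγ).2 e, rfl⟩
      · have h2 : eta n (δ * negOnePlus n) = eta n δ := by
          rw [map_mul, eta_negOnePlus, mul_one]
        refine ⟨δ * negOnePlus n, (mem_leftStabilizer_iff h hΨ (by rwa [h2])).2 ?_, h2⟩
        rw [hΨ.apply_mul_negOnePlus, e, smul_negOne_smul_negOne]

/-- Two developing maps differ at most by the action of `-1`, which does not affect left
stabilizers. The subgroup is thus an invariant of the spin structure. -/
lemma leftStabilizer_eq (h : IsSpinStructure Γ ρ) (hΨ : IsDevelopingMap ρ Ψ)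
    (hΨ' : IsDevelopingMap ρ Ψ') : leftStabilizer Ψ = leftStabilizer Ψ' := by
  rcases h.eq_or_eq ((hΨ.lifts 1).trans (hΨ'.lifts 1).symm) with e | e
  · rw [eq_of_apply_eq h hΨ hΨ' e]
  · rw [eq_of_apply_eq h hΨ (hΨ'.smul_negOne h) e]
    ext δ
    simp only [mem_leftStabilizer, smul_left_cancel_iff]

lemma apply_eq_iff (h : IsSpinStructure Γ ρ) (hΨ : IsDevelopingMap ρ Ψ) {g g' : SpinPlus n} :
    Ψ g = Ψ g' ↔ ∃ δ ∈ leftStabilizer Ψ, δ * g' = g := by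
  constructor
  · intro e
    have h1 := congrArg ρ e
    rw [hΨ.lifts, hΨ.lifts, frameMk_eq_iff] at h1
    obtain ⟨γ, hγ, h1⟩ := h1
    obtain ⟨δ, hδ, rfl⟩ := (hΨ.mapsIsomorphicallyOnto h).exists_eta_eq hγ
    rw [← map_mul] at h1
    rcases (eta_eq_iff n).1 h1.symm with h2 | h2
    · exact ⟨δ, hδ, h2.symm⟩
    · rw [h2, hΨ.apply_mul_negOnePlus, hδ] at e
      exact absurd e (h.smul_negOne_ne _)
  · rintro ⟨δ, hδ, rfl⟩
    exact hδ g'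

lemma surjective (h : IsSpinStructure Γ ρ) (hΨ : IsDevelopingMap ρ Ψ) :
    Function.Surjective Ψ := by
  intro x
  obtain ⟨A, hA⟩ := frameMk_surjective Γ (ρ x)
  obtain ⟨g, rfl⟩ := eta_surjective n A
  rcases h.eq_or_eq ((hΨ.lifts g).trans hA) with e | e
  · exact ⟨g, e⟩
  · exact ⟨g * negOnePlus n, by rw [hΨ.apply_mul_negOnePlus, e, smul_negOne_smul_negOne]⟩

/-- As `ρ ∘ Ψ` is the local homeomorphism `frameMk Γ ∘ η`, so is `Ψ`; in particular it is open. -/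
lemma isQuotientMap (h : IsSpinStructure Γ ρ) (hΨ : IsDevelopingMap ρ Ψ) :
    Topology.IsQuotientMap Ψ := by
  have h1 : IsLocalHomeomorph (ρ ∘ Ψ) := by
    have e : ρ ∘ Ψ = frameMk Γ ∘ eta n := funext hΨ.lifts
    rw [e]
    exact (isQuotientCoveringMap_frameMk Γ).isCoveringMap.isLocalHomeomorph.comp
      (isCoveringMap_eta n).isLocalHomeomorph
  exact (h1.of_comp h.isCoveringMap.isLocalHomeomorph hΨ.continuous).isOpenMap.isQuotientMap
    hΨ.continuous (hΨ.surjective h)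

variable {P' : Type} [TopologicalSpace P'] [MulAction (SpinN n)ᵐᵒᵖ P']
  [ChartedSpace (soLie n) P'] {ρ' : P' → FrameBundle Γ}

/-- The fibres of `Ψ` are the orbits of its stabilizer, so `Φ` is constant on them. The factor is
continuous because `Ψ` is a quotient map, and smooth because it lies over the frame bundle, to which
both spaces are locally diffeomorphic. -/
lemma exists_factor {Φ : SpinPlus n → P'} (h : IsSpinStructure Γ ρ) (h' : IsSpinStructure Γ ρ')
    (hΨ : IsDevelopingMap ρ Ψ) (hΦ : IsDevelopingMap ρ' Φ)
    (hle : leftStabilizer Ψ ≤ leftStabilizer Φ) :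
    ∃ ξ : P → P', ContMDiff 𝓘(ℝ, soLie n) 𝓘(ℝ, soLie n) ∞ ξ ∧ ∀ g, ξ (Ψ g) = Φ g := by
  have hξ : ∀ g, (fun x => Φ (Function.surjInv (hΨ.surjective h) x)) (Ψ g) = Φ g := by
    intro g
    obtain ⟨δ, hδ, e⟩ := (hΨ.apply_eq_iff h).1 (Function.surjInv_eq (hΨ.surjective h) (Ψ g))
    simp only
    rw [← e, hle hδ]
  generalize (fun x => Φ (Function.surjInv (hΨ.surjective h) x)) = ξ at hξ
  refine ⟨ξ, ?_, hξ⟩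
  have hcont : Continuous ξ := by
    rw [(hΨ.isQuotientMap h).continuous_iff]
    exact hΦ.continuous.congr fun g => (hξ g).symm
  have e : ρ' ∘ ξ = ρ := by
    ext x : 1
    obtain ⟨g, rfl⟩ := hΨ.surjective h x
    rw [Function.comp_apply, hξ, hΦ.lifts, hΨ.lifts]
  have := h.isManifold
  have := h'.isManifold
  exact contMDiff_of_comp_isLocalDiffeomorph hcont h'.isLocalDiffeomorph
    (e ▸ h.isLocalDiffeomorph.contMDiff)

lemma exists_diffeomorph {Φ : SpinPlus n → P'} (h : IsSpinStructure Γ ρ)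
    (h' : IsSpinStructure Γ ρ') (hΨ : IsDevelopingMap ρ Ψ) (hΦ : IsDevelopingMap ρ' Φ)
    (he : leftStabilizer Ψ = leftStabilizer Φ) :
    ∃ ξ : Diffeomorph 𝓘(ℝ, soLie n) 𝓘(ℝ, soLie n) P P' ∞,
      (∀ x, ρ' (ξ x) = ρ x) ∧ ∀ (x : P) (s : SpinN n), ξ (op s • x) = op s • ξ x := by
  obtain ⟨ξ, hξ, hξΨ⟩ := exists_factor h h' hΨ hΦ he.le
  obtain ⟨ζ, hζ, hζΦ⟩ := exists_factor h' h hΦ hΨ he.ge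
  refine ⟨⟨⟨ξ, ζ, fun x => ?_, fun x => ?_⟩, hξ, hζ⟩, fun x => ?_, fun x s => ?_⟩
  · obtain ⟨g, rfl⟩ := hΨ.surjective h x
    rw [hξΨ, hζΦ]
  · obtain ⟨g, rfl⟩ := hΦ.surjective h' x
    rw [hζΦ, hξΨ]
  · obtain ⟨g, rfl⟩ := hΨ.surjective h x
    change ρ' (ξ (Ψ g)) = _
    rw [hξΨ, hΦ.lifts, hΨ.lifts]
  · obtain ⟨g, rfl⟩ := hΨ.surjective h x
    change ξ _ = op s • ξ (Ψ g)
    rw [← hΨ.equivariant, hξΨ, hξΨ, hΦ.equivariant]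

end IsDevelopingMap

end Developing

/-! ### The bijection between classes of spin structures and lifts of `Γ` -/

section Correspondence

open MulOpposite

variable {n : ℕ} {Γ : Subgroup (SOPlus n)} [DiscreteTopology Γ] [NeZero n]

/-- A developing map of a spin structure. -/
def SpinStructure.dev (S : SpinStructure Γ) : SpinPlus n → S.P :=
  S.isSpinStructure.exists_isDevelopingMap.choose

lemma SpinStructure.isDevelopingMap_dev (S : SpinStructure Γ) : IsDevelopingMap S.ρ S.dev :=
  S.isSpinStructure.exists_isDevelopingMap.choose_spec

/-- The subgroup of `Spin⁺(n,1)` that corresponds to a spin structure. -/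
def SpinStructure.lift (S : SpinStructure Γ) :
    {Δ : Subgroup (SpinPlus n) // MapsIsomorphicallyOnto Δ Γ} :=
  ⟨leftStabilizer S.dev, S.isDevelopingMap_dev.mapsIsomorphicallyOnto S.isSpinStructure⟩

/-- Equal stabilizers present both total spaces as the same quotient of `Spin⁺(n,1)`. Conversely, an
equivalence `ξ` turns a developing map of `S` into one of `T`, with the same stabilizer since `ξ` is
injective. -/
lemma SpinStructure.lift_eq_iff (S T : SpinStructure Γ) : S.lift = T.lift ↔ S ≈ T := by
  constructor
  · intro e
    exact IsDevelopingMap.exists_diffeomorph S.isSpinStructure T.isSpinStructure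
      S.isDevelopingMap_dev T.isDevelopingMap_dev (congrArg Subtype.val e)
  · rintro ⟨ξ, hξ, hξs⟩
    have h1 : IsDevelopingMap T.ρ (ξ ∘ S.dev) :=
      { continuous := ξ.continuous.comp S.isDevelopingMap_dev.continuous
        lifts := fun g => (hξ _).trans (S.isDevelopingMap_dev.lifts g)
        equivariant := fun g s => by
          rw [Function.comp_apply, S.isDevelopingMap_dev.equivariant, hξs, Function.comp_apply] }
    refine Subtype.ext (Eq.trans ?_
      (h1.leftStabilizer_eq T.isSpinStructure T.isDevelopingMap_dev))
    ext δ
    exact forall_congr' fun g => ξ.injective.eq_iff.symm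

omit [NeZero n] in
lemma isDevelopingMap_spinMk {Δ : Subgroup (SpinPlus n)} (h : MapsIsomorphicallyOnto Δ Γ) :
    IsDevelopingMap (inducedMap h) (spinMk Δ) :=
  ⟨h.isCoveringMap_spinMk.continuous, fun _ => rfl, fun _ _ => rfl⟩

omit [NeZero n] in
lemma leftStabilizer_spinMk (Δ : Subgroup (SpinPlus n)) : leftStabilizer (spinMk Δ) = Δ := by
  ext δ
  constructor
  · intro hδ
    obtain ⟨δ', hδ', e⟩ := spinMk_eq_iff.1 (hδ 1)
    rw [mul_one, mul_one] at e
    exact e ▸ hδ'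
  · exact fun hδ g => spinMk_eq_iff.2 ⟨δ, hδ, rfl⟩

/-- The quotient map `spinMk Δ` is itself a developing map, with stabilizer `Δ`, and the stabilizer
does not depend on the developing map. The charts play no part, so this holds for any smooth
structure that makes the induced map a spin structure. -/
lemma lift_inducedMap {Δ : Subgroup (SpinPlus n)} [ChartedSpace (soLie n) (SpinQuotient Δ)]
    (hΔ : MapsIsomorphicallyOnto Δ Γ) (h : IsSpinStructure Γ (inducedMap hΔ)) :
    SpinStructure.lift ⟨SpinQuotient Δ, inducedMap hΔ, h⟩ = ⟨Δ, hΔ⟩ := by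
  refine Subtype.ext (Eq.trans ?_ (leftStabilizer_spinMk Δ))
  exact (SpinStructure.isDevelopingMap_dev ⟨SpinQuotient Δ, inducedMap hΔ, h⟩).leftStabilizer_eq h
    (isDevelopingMap_spinMk hΔ)

/-- The correspondence between the classes of spin structures on `Γ\Hⁿ` and the lifts of `Γ` to
`Spin⁺(n,1)`. -/
def spinClassEquiv (hΓ : ∀ γ ∈ Γ, IsOfFinOrder γ → γ = 1) :
    SpinStructureClass Γ ≃ {Δ : Subgroup (SpinPlus n) // MapsIsomorphicallyOnto Δ Γ} :=
  Equiv.ofBijective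
    (Quotient.lift SpinStructure.lift fun S T h => (SpinStructure.lift_eq_iff S T).2 h) (by
      constructor
      · rintro ⟨S⟩ ⟨T⟩ e
        exact Quotient.sound ((SpinStructure.lift_eq_iff S T).1 e)
      · rintro ⟨Δ, hΔ⟩
        obtain ⟨_, h⟩ := hΔ.exists_isSpinStructure hΓ
        exact ⟨spinClass h, lift_inducedMap hΔ h⟩)

end Correspondence

end
end HypSpin

theorem theorem2p1 (n : ℕ) (hn : 2 ≤ n) (Γ : Subgroup (HypSpin.SOPlus n)) [DiscreteTopology Γ]
    (hΓ : ∀ γ ∈ Γ, IsOfFinOrder γ → γ = 1) :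
    ∃ Φ : HypSpin.SpinStructureClass Γ ≃
        {Δ : Subgroup (HypSpin.SpinPlus n) // HypSpin.MapsIsomorphicallyOnto Δ Γ},
      ∀ (Δ : Subgroup (HypSpin.SpinPlus n)) (hΔ : HypSpin.MapsIsomorphicallyOnto Δ Γ),
        ∃ (_ : ChartedSpace (HypSpin.soLie n) (HypSpin.SpinQuotient Δ))
          (h : HypSpin.IsSpinStructure Γ (HypSpin.inducedMap hΔ)),
          Φ (HypSpin.spinClass h) = ⟨Δ, hΔ⟩ := by
  have : NeZero n := ⟨by omega⟩
  refine ⟨HypSpin.spinClassEquiv hΓ, fun Δ hΔ => ?_⟩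
  obtain ⟨c, h⟩ := hΔ.exists_isSpinStructure hΓ
  exact ⟨c, h, HypSpin.lift_inducedMap hΔ h⟩
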